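/- Let $T>0$, $\beta\in(1/2,1]$, let $x=(x^1,\dots,x^m):[0,T]\to\mathbb R^m$ be Hölder continuous of order $\beta$, and let $V=(V_1,\dots,V_m)$ be vector fields on $\mathbb R^d$. All integrals against paths are Riemann–Stieltjes integrals. *Notation.* Put $\mathcal V_jf=\sum_{i=1}^dV^i_j\partial_if$, and let $I(y)=y$, $I_i(y)=y_i$. Let $\Gamma$ be the set of multi-indices $\gamma=(\gamma_1,\dots,\gamma_r)$, $r=|\gamma|\ge1$, with letters in $\{1,\dots,m\}$; put $\mathcal V_\gamma=\mathcal V_{\gamma_1}\cdots\mathcal V_{\gamma_r}$ and $x^\gamma_{s,t}=\int_s^t\int_s^{t_r}\cdots\int_s^{t_2}dx^{\gamma_1}_{t_1}\cdots dx^{\gamma_r}_{t_r}$. Let $\Upsilon_p$ be the set of multi-indices of length $p$ with letters in $\{1,\dots,d\}$, and $\partial_\zeta=\partial_{\zeta_1}\cdots\partial_{\zeta_p}$ for $\zeta\in\Upsilon_p$. Let $\widetilde\Gamma\subset\Gamma$ be finite and non-empty, $N=\max_{\gamma\in\widetilde\Gamma}|\gamma|$, and $$\widetilde{\mathcal E}_{s,t}(y)=\sum_{\gamma\in\widetilde\Gamma}\mathcal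 V_\gamma I(y)\,x^\gamma_{s,t},\qquad \mathcal E_{s,t}(y)=\sum_{\gamma\in\Gamma,\,|\gamma|\le N}\mathcal V_\gamma I(y)\,x^\gamma_{s,t}.$$ For $\zeta\in\Upsilon_p$ put $\mathcal E^\zeta_{s,t}(f)=\int_s^t\int_s^{t_p}\cdots\int_s^{t_2}f_{t_1}\,d\mathcal E^{\zeta_1}_{s,t_1}\cdots d\mathcal E^{\zeta_p}_{s,t_p}$ (with $\mathcal E=\mathcal E(y)$) and $\mathcal E^\zeta_{s,t}=\mathcal E^\zeta_{s,t}(1)$; define $\widetilde{\mathcal E}^\zeta$ in the same way from $\widetilde{\mathcal E}$. *Scheme.* Let $n\ge1$, $t_k=kT/n$, and $\eta(t)=t_k$ for $t\in[t_k,t_{k+1})$. Let $y$ be a solution on $[0,T]$, Hölder continuous of order $\beta$, of $dy_t=V(y_t)\,dx_t$, and let $y^n$ be given by $y^n_0=y_0$ and $y^n_t=y^n_{t_k}+\widetilde{\mathcal E}_{t_k,t}(y^n_{t_k})$ for $t\in[t_k,t_{k+1}]$, $0\le k\le n-1$. *Remainders.* Put $$R^1_{s,t}(y)=\sum_{\zeta\in\Upsilon_N}\int_s^t\mathcal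 E^\zeta_{s,u}(y)\,\partial_\zeta V(y)\,dx_u+\sum_{p=1}^{N-1}\sum_{\zeta\in\Upsilon_p}\int_s^tQ(\zeta)_{s,u}(y)\,\partial_\zeta V(y)\,dx_u,$$ $$R^2_{s,t}(y)=\sum_{\zeta\in\Upsilon_{N+1}}\int_s^t\widetilde{\mathcal E}^\zeta_{s,u}\big(\partial_\zeta V(y+\widetilde{\mathcal E}_{s,\cdot}(y))\big)(y)\,dx_u,$$ $$R^3_{s,t}(y)=\sum_{p=1}^{N}\sum_{\zeta\in\Upsilon_p}\int_s^t\big(\widetilde{\mathcal E}^\zeta_{s,u}(y)-\mathcal E^\zeta_{s,u}(y)\big)\partial_\zeta V(y)\,dx_u,\qquad R^4_{s,t}(y)=\mathcal E_{s,t}(y)-\widetilde{\mathcal E}_{s,t}(y),$$ where, for $\zeta\in\Upsilon_p$, $$Q(\zeta)_{s,u}(y)=\sum_{\substack{\gamma^1,\dots,\gamma^p\in\Gamma,\ |\gamma^i|\le N\\|\gamma^1|+\dots+|\gamma^p|>N-1}}\ \prod_{i=1}^p\mathcal V_{\gamma^i}I_{\zeta_i}(y)\ \sum_{\rho}x^{\gamma\circ\rho^{-1}}_{s,u};$$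 here $\gamma=(\gamma^1,\dots,\gamma^p)$ is the concatenation, and $\rho$ runs over the permutations of $\{1,\dots,|\gamma|\}$ that are increasing on each of the $p$ consecutive blocks of lengths $|\gamma^1|,\dots,|\gamma^p|$ and on the set of the last elements of these blocks. *Linear equations.* Put $\dot V_j(\xi,\xi')=\int_0^1\partial V_j(\theta\xi+(1-\theta)\xi')\,d\theta$, and let $\Phi,\Psi:[0,T]\to\mathbb R^{d\times d}$ be the solutions, Hölder continuous of order $\beta$, of $$\Phi_t=I+\sum_{j=1}^m\int_0^t\dot V_j(y_s,y^n_s)\Phi_s\,dx^j_s,\qquad \Psi_t=I-\sum_{j=1}^m\int_0^t\Psi_s\dot V_j(y_s,y^n_s)\,dx^j_s .$$ **Theorem.** Assume $V\in C^{N+1}$ and, if $\beta<1$, that for some $\delta>\frac1\beta-1$ the partial derivatives of $V$ of order $N+1$ are locally Hölder continuous of order $\delta$. Then, for every $t\in[0,T]$, $\Psi_t\Phi_t=I$, the outer integrals below (those of $\Psi$) exist, and $$y_t-y^n_t=\sum_{e=1}^4\Phi_t\sum_{k=0}^{\lfloor nt/T\rfloor}\int_{t_k}^{t_{k+1}\wedge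 t}\Psi_s\,dR^e_{t_k,s}(y^n_{t_k})=\sum_{e=1}^4\Phi_t\int_0^t\Psi_s\,dR^e_{\eta(s),s}(y^n_{\eta(s)}),$$ where $dR^e_{\eta(s),s}(y^n_{\eta(s)})$ is the differential of the continuous path $s\mapsto\sum_{k=0}^{\lfloor ns/T\rfloor}R^e_{t_k,t_{k+1}\wedge s}(y^n_{t_k})$. -/

import Mathlib

open scoped NNReal Matrix

noncomputable section

namespace TaylorScheme

/-! ### Riemann-Stieltjes integrals -/

/-- The Riemann-Stieltjes integral of `f` against `g` over `[a, b]` exists and equals `I`: the sums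
`∑ f (ξ k) * (g (u (k + 1)) - g (u k))` over tagged partitions `a = u 0 ≤ u 1 ≤ ... ≤ u n = b`
converge to `I` as the mesh tends to zero. -/
def HasRSIntegral (f g : ℝ → ℝ) (a b I : ℝ) : Prop :=
  a ≤ b ∧ ∀ ε > 0, ∃ δ > 0, ∀ (n : ℕ) (u ξ : ℕ → ℝ), u 0 = a → u n = b →
    (∀ k < n, u k ≤ ξ k ∧ ξ k ≤ u (k + 1) ∧ u (k + 1) - u k < δ) →
    |∑ k ∈ Finset.range n, f (ξ k) * (g (u (k + 1)) - g (u k)) - I| < ε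

/-- Existence of the Riemann-Stieltjes integral. -/
def RSIntegrable (f g : ℝ → ℝ) (a b : ℝ) : Prop := ∃ I, HasRSIntegral f g a b I

open Classical in
/-- The value of the Riemann-Stieltjes integral `∫_a^b f dg`. -/
def rsInt (f g : ℝ → ℝ) (a b : ℝ) : ℝ :=
  if h : RSIntegrable f g a b then h.choose else 0

/-- The multiple integral `t ↦ ∫_s^t ... ∫_s^{t_2} f_{t_1} dg^{α_1}_{t_1} ... dg^{α_r}_{t_r}`
for the multi-index `α = [α_1, ..., α_r]` (the first letter is the innermost integrator). -/
def multInt {ι : Type*} (g : ι → ℝ → ℝ) (s : ℝ) (f : ℝ → ℝ) (α : List ι) : ℝ → ℝ :=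
  α.foldl (fun J a t => rsInt J (g a) s t) f

/-- The multiple integral with constant integrand one; for the driving path `x` this is
`x^α_{s,t}`. -/
def iterInt {ι : Type*} (g : ι → ℝ → ℝ) (s t : ℝ) (α : List ι) : ℝ :=
  multInt g s (fun _ => 1) α t

/-! ### Differential operators -/

/-- The partial derivative in the `l`-th coordinate. -/
def pderiv {d : ℕ} (l : Fin d) (f : (Fin d → ℝ) → ℝ) : (Fin d → ℝ) → ℝ :=
  fun y => fderiv ℝ f y (Pi.single l 1)

/-- `∂_ζ = ∂_{ζ_1} ... ∂_{ζ_p}`. -/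
def pderivIter {d : ℕ} (ζ : List (Fin d)) (f : (Fin d → ℝ) → ℝ) : (Fin d → ℝ) → ℝ :=
  ζ.foldr pderiv f

/-- The first order operator `∑ i, V_j^i ∂_i`. -/
def vf {d m : ℕ} (V : Fin m → (Fin d → ℝ) → (Fin d → ℝ)) (j : Fin m)
    (f : (Fin d → ℝ) → ℝ) : (Fin d → ℝ) → ℝ :=
  fun y => ∑ i, V j y i * pderiv i f y

/-- The composition of the first order operators with indices `γ_1, ..., γ_r`
(the last one is applied first). -/
def vfIter {d m : ℕ} (V : Fin m → (Fin d → ℝ) → (Fin d → ℝ)) (γ : List (Fin m))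
    (f : (Fin d → ℝ) → ℝ) : (Fin d → ℝ) → ℝ :=
  γ.foldr (vf V) f

/-! ### Taylor expansions and the scheme -/

/-- All multi-indices with letters in `Fin m` and with length between `1` and `N`. -/
def words (m N : ℕ) : Finset (List (Fin m)) :=
  (Finset.Icc 1 N).biUnion fun r => (Finset.univ : Finset (Fin r → Fin m)).image List.ofFn

/-- The Taylor expansion over a finite set `G` of multi-indices:
`∑_{γ ∈ G} (𝒱_γ I)(y) x^γ_{s,t}`, with `I` the identity function. It is the incomplete expansion
for a general `G` and the complete expansion of order `N` for `G = words m N`. -/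
def expansion {d m : ℕ} (V : Fin m → (Fin d → ℝ) → (Fin d → ℝ)) (x : Fin m → ℝ → ℝ)
    (G : Finset (List (Fin m))) (s t : ℝ) (y : Fin d → ℝ) : Fin d → ℝ :=
  fun i => ∑ γ ∈ G, vfIter V γ (fun z => z i) y * iterInt x s t γ

/-- The coordinate paths of an expansion started at time `s` from `y`, used as integrators. -/
def expansionPath {d m : ℕ} (V : Fin m → (Fin d → ℝ) → (Fin d → ℝ)) (x : Fin m → ℝ → ℝ)
    (G : Finset (List (Fin m))) (s : ℝ) (y : Fin d → ℝ) : Fin d → ℝ → ℝ :=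
  fun i t => expansion V x G s t y i

/-- The grid point `t_k = k T / n`. -/
def grid (T : ℝ) (n k : ℕ) : ℝ := k * T / n

/-- `z` is the incomplete Taylor scheme on `[0, T]` with `n` steps, started from `y0`. -/
def IsTaylorScheme {d m : ℕ} (V : Fin m → (Fin d → ℝ) → (Fin d → ℝ)) (x : Fin m → ℝ → ℝ)
    (G : Finset (List (Fin m))) (T : ℝ) (n : ℕ) (y0 : Fin d → ℝ) (z : ℝ → Fin d → ℝ) : Prop :=
  z 0 = y0 ∧ ∀ k < n, ∀ t ∈ Set.Icc (grid T n k) (grid T n (k + 1)),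
    z t = z (grid T n k) + expansion V x G (grid T n k) t (z (grid T n k))

/-! ### The equation and the linear equations -/

/-- Hölder continuity of order `β` on `[0, T]`. -/
def HolderPath {E : Type*} [PseudoEMetricSpace E] (β : ℝ≥0) (T : ℝ) (f : ℝ → E) : Prop :=
  ∃ C : ℝ≥0, HolderOnWith C β f (Set.Icc 0 T)

/-- `y` is a solution of `dy = V(y) dx` on `[0, T]`. -/
def IsSolution {d m : ℕ} (β : ℝ≥0) (V : Fin m → (Fin d → ℝ) → (Fin d → ℝ)) (x : Fin m → ℝ → ℝ)
    (T : ℝ) (y : ℝ → Fin d → ℝ) : Prop :=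
  HolderPath β T y ∧ ∀ t ∈ Set.Icc 0 T, ∀ i,
    y t i = y 0 i + ∑ j, rsInt (fun s => V j (y s) i) (x j) 0 t

/-- The averaged Jacobian `∫_0^1 ∂V_j(θ ξ + (1 - θ) ξ') dθ`. -/
def Vdot {d m : ℕ} (V : Fin m → (Fin d → ℝ) → (Fin d → ℝ)) (j : Fin m) (ξ ξ' : Fin d → ℝ) :
    Matrix (Fin d) (Fin d) ℝ :=
  Matrix.of fun i l => ∫ θ in (0 : ℝ)..1, pderiv l (fun z => V j z i) (θ • ξ + (1 - θ) • ξ')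

/-- `Φ` solves `Φ_t = 1 + ∑_j ∫_0^t A_j(s) Φ_s dx^j_s` on `[0, T]`. -/
def IsFundamental {d m : ℕ} (β : ℝ≥0) (A : Fin m → ℝ → Matrix (Fin d) (Fin d) ℝ)
    (x : Fin m → ℝ → ℝ) (T : ℝ) (Φ : ℝ → Matrix (Fin d) (Fin d) ℝ) : Prop :=
  (∀ i l, HolderPath β T fun t => Φ t i l) ∧ ∀ t ∈ Set.Icc 0 T, ∀ i l,
    Φ t i l = (1 : Matrix (Fin d) (Fin d) ℝ) i l
      + ∑ j, rsInt (fun s => (A j s * Φ s) i l) (x j) 0 t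

/-- `Ψ` solves `Ψ_t = 1 - ∑_j ∫_0^t Ψ_s A_j(s) dx^j_s` on `[0, T]`. -/
def IsInverseFundamental {d m : ℕ} (β : ℝ≥0) (A : Fin m → ℝ → Matrix (Fin d) (Fin d) ℝ)
    (x : Fin m → ℝ → ℝ) (T : ℝ) (Ψ : ℝ → Matrix (Fin d) (Fin d) ℝ) : Prop :=
  (∀ i l, HolderPath β T fun t => Ψ t i l) ∧ ∀ t ∈ Set.Icc 0 T, ∀ i l,
    Ψ t i l = (1 : Matrix (Fin d) (Fin d) ℝ) i l
      - ∑ j, rsInt (fun s => (Ψ s * A j s) i l) (x j) 0 t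

/-! ### The remainder terms -/

open Classical in
/-- The shuffle-type permutations of `r = τ p` letters that are cut into the consecutive blocks
`[τ i, τ (i + 1))`, `i < p`: those that keep the order of the last elements of the blocks and the
order within each block. -/
def Xi (r p : ℕ) (τ : ℕ → ℕ) : Finset (Equiv.Perm (Fin r)) :=
  Finset.univ.filter fun ρ =>
    (∀ i j : ℕ, i < j → j < p → ∀ a b : Fin r, (a : ℕ) + 1 = τ (i + 1) → (b : ℕ) + 1 = τ (j + 1) →
      ρ a < ρ b) ∧
    (∀ i < p, ∀ a b : Fin r, τ i ≤ a → a < b → (b : ℕ) < τ (i + 1) → ρ a < ρ b)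

/-- The total length of the first `i` blocks. -/
def blockEnd {ι : Type*} (γ : List (List ι)) (i : ℕ) : ℕ := ((γ.take i).map List.length).sum

/-- `∑_ρ x^{γ ∘ ρ⁻¹}_{s,t}`, where `γ` is the concatenation of the blocks and `ρ` runs over the
shuffle-type permutations that belong to the blocks. -/
def shuffleInt {m : ℕ} (x : Fin m → ℝ → ℝ) (s t : ℝ) (γ : List (List (Fin m))) : ℝ :=
  ∑ ρ ∈ Xi γ.flatten.length γ.length (blockEnd γ),
    iterInt x s t (List.ofFn fun k => γ.flatten.get (ρ.symm k))

/-- The sum, over the blocks `γ^1, ..., γ^p` with `1 ≤ |γ^i| ≤ N` and `|γ^1| + ... + |γ^p| > M`, of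
`(𝒱_{γ^1} I_{ζ_1})(y) ... (𝒱_{γ^p} I_{ζ_p})(y) ∑_ρ x^{γ ∘ ρ⁻¹}_{s,t}`. -/
def Qterm {d m : ℕ} (V : Fin m → (Fin d → ℝ) → (Fin d → ℝ)) (x : Fin m → ℝ → ℝ) (M N : ℕ)
    {p : ℕ} (ζ : Fin p → Fin d) (s t : ℝ) (y : Fin d → ℝ) : ℝ :=
  ∑ γ ∈ (Fintype.piFinset fun _ : Fin p => words m N) with M < ∑ i, (γ i).length,
    (∏ i, vfIter V (γ i) (fun z => z (ζ i)) y) * shuffleInt x s t (List.ofFn γ)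

/-- The first remainder. -/
def R1 {d m : ℕ} (V : Fin m → (Fin d → ℝ) → (Fin d → ℝ)) (x : Fin m → ℝ → ℝ) (N : ℕ)
    (s t : ℝ) (y : Fin d → ℝ) : Fin d → ℝ := fun i =>
  (∑ ζ : Fin N → Fin d, ∑ j,
    rsInt (fun u => iterInt (expansionPath V x (words m N) s y) s u (List.ofFn ζ)
      * pderivIter (List.ofFn ζ) (fun z => V j z i) y) (x j) s t)
  + ∑ p ∈ Finset.Icc 1 (N - 1), ∑ ζ : Fin p → Fin d, ∑ j,
    rsInt (fun u => Qterm V x (N - 1) N ζ s u y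
      * pderivIter (List.ofFn ζ) (fun z => V j z i) y) (x j) s t

/-- The second remainder. -/
def R2 {d m : ℕ} (V : Fin m → (Fin d → ℝ) → (Fin d → ℝ)) (x : Fin m → ℝ → ℝ) (N : ℕ)
    (G : Finset (List (Fin m))) (s t : ℝ) (y : Fin d → ℝ) : Fin d → ℝ := fun i =>
  ∑ ζ : Fin (N + 1) → Fin d, ∑ j,
    rsInt (fun u => multInt (expansionPath V x G s y) s
      (fun v => pderivIter (List.ofFn ζ) (fun z => V j z i) (y + expansion V x G s v y))
      (List.ofFn ζ) u) (x j) s t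

/-- The third remainder. -/
def R3 {d m : ℕ} (V : Fin m → (Fin d → ℝ) → (Fin d → ℝ)) (x : Fin m → ℝ → ℝ) (N : ℕ)
    (G : Finset (List (Fin m))) (s t : ℝ) (y : Fin d → ℝ) : Fin d → ℝ := fun i =>
  ∑ p ∈ Finset.Icc 1 N, ∑ ζ : Fin p → Fin d, ∑ j,
    rsInt (fun u => (iterInt (expansionPath V x G s y) s u (List.ofFn ζ)
        - iterInt (expansionPath V x (words m N) s y) s u (List.ofFn ζ))
      * pderivIter (List.ofFn ζ) (fun z => V j z i) y) (x j) s t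

/-- The fourth remainder. -/
def R4 {d m : ℕ} (V : Fin m → (Fin d → ℝ) → (Fin d → ℝ)) (x : Fin m → ℝ → ℝ) (N : ℕ)
    (G : Finset (List (Fin m))) (s t : ℝ) (y : Fin d → ℝ) : Fin d → ℝ :=
  expansion V x (words m N) s t y - expansion V x G s t y

/-- The four remainders `R^e_{s,t}(y)`. -/
def remainder {d m : ℕ} (V : Fin m → (Fin d → ℝ) → (Fin d → ℝ)) (x : Fin m → ℝ → ℝ) (N : ℕ)
    (G : Finset (List (Fin m))) : Fin 4 → ℝ → ℝ → (Fin d → ℝ) → Fin d → ℝ :=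
  ![R1 V x N, R2 V x N G, R3 V x N G, R4 V x N G]

/-- The accumulated remainder `s ↦ ∑_{k ≤ ⌊ns/T⌋} R_{t_k, t_{k+1} ∧ s}(z_{t_k})`. On each
`[t_k, t_{k+1}]` it has the increments of `s ↦ R_{t_k, s}(z_{t_k})`, so that its differential is
`dR_{η(s), s}(z_{η(s)})`, where `η(s) = t_k` for `s ∈ [t_k, t_{k+1})`. -/
def accumulated {d : ℕ} (R : ℝ → ℝ → (Fin d → ℝ) → Fin d → ℝ) (T : ℝ) (n : ℕ)
    (z : ℝ → Fin d → ℝ) : ℝ → Fin d → ℝ := fun s =>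
  ∑ k ∈ Finset.range (⌊(n : ℝ) * s / T⌋₊ + 1),
    R (grid T n k) (min (grid T n (k + 1)) s) (z (grid T n k))

/-- The matrix-vector integral `∫_a^b Ψ_s dR_s` exists. -/
def MatRSIntegrable {d : ℕ} (Ψ : ℝ → Matrix (Fin d) (Fin d) ℝ) (R : ℝ → Fin d → ℝ)
    (a b : ℝ) : Prop :=
  ∀ i l, RSIntegrable (fun s => Ψ s i l) (fun s => R s l) a b

/-- The matrix-vector integral `∫_a^b Ψ_s dR_s`. -/
def matRSInt {d : ℕ} (Ψ : ℝ → Matrix (Fin d) (Fin d) ℝ) (R : ℝ → Fin d → ℝ)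
    (a b : ℝ) : Fin d → ℝ :=
  fun i => ∑ l, rsInt (fun s => Ψ s i l) (fun s => R s l) a b

end TaylorScheme

end

/-!
All paths are `β`-Hölder with `β > 1/2`, so the integrals are Young integrals. They are handled
through differentials: `HasDifferential a b F ω` says that `F e - F c = ω c ξ e + o(e - c)` for all
`c ≤ ξ ≤ e`, uniformly. A path is determined by its initial value and its differential
(`HasDifferential.sub_eq_sub`), and a path with `dF = f dg` computes the Riemann-Stieltjes integral
of `f` against `g` (`HasDifferential.rsInt_eq`). Primitives exist
(`IsIntegrand.exists_hasDifferential`): Young's maximal inequality bounds the partial sums over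
finite sets of points, and a limit along an ultrafilter of finite sets passes to the interval. With
the product rule (`HasDifferential.mul`) and the chain rule (`hasDifferential_comp`), identities
between integrals are proved by comparing differentials.

On one step, started from `z` at time `a`, the integrand `V_j` along the scheme is expanded in three
stages. Iterating the chain rule gives Taylor's formula with multiple integrals of the scheme as
monomials (`HasRegularDerivatives.taylor`); its remainder is the integrand of `R²`. Replacing the
incomplete expansion by the complete one in the monomials costs the integrand of `R³`. Finally, the
monomials of the complete expansion are multiple integrals of the `x^γ`, hence shuffle sums of
iterated integrals of `x` (`multInt_iterInt_eq_shuffleInt`): the permutations in `Xi` are the linear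
extensions of an order, and integrals over linear extensions satisfy the recursion that removes a
maximal element. The terms of degree above `N - 1`, together with the monomials of order `N`, form
the integrand of `R¹`. What is left is the Taylor sum of degree `N - 1` of `V_j`
(`sum_pderivIter_mul_iterInt_expansion`). This identity needs no computation with shuffles: Taylor
sums are multiplicative up to higher degree (`taylorSum_mul`), because the `𝒱_j` are derivations and
integration obeys the product rule; so Taylor sums obey a chain rule
(`hasDifferential_taylorSum_chain`), and its iteration produces the left-hand side. Integrating the
Taylor sums against `x` gives the complete expansion, which differs from the increment of the scheme
by `R⁴`. This is `sum_rsInt_scheme_eq`.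

Gluing the steps, the scheme solves the equation up to the accumulated remainders
(`IsTaylorScheme.eq_add_sum_rsInt_sub`). Since `V_j(ξ) - V_j(ξ')` is the averaged Jacobian applied
to `ξ - ξ'`, the error `y - yⁿ` solves a linear equation with the accumulated remainders as
inhomogeneity. The product rule gives `d(ΨΦ) = 0`, hence `ΨΦ = 1` (`inverse_mul_fundamental`), and
`d(Ψ(y - yⁿ)) = ∑ₑ Ψ dRᵉ` (`inverse_mulVec_eq_sum_matRSInt`), which is the representation of the
error.
-/

namespace TaylorScheme

/-! ### Negligible germs and differentials -/

/-- A function `A` of a tagged interval `c ≤ ξ ≤ e` in `[a, b]` is negligible if `A c ξ e` is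
`o(e - c)` as `e - c → 0`, uniformly in `[a, b]`. -/
def Negligible (a b : ℝ) (A : ℝ → ℝ → ℝ → ℝ) : Prop :=
  ∀ ε > 0, ∃ δ > 0, ∀ c ξ e, a ≤ c → c ≤ ξ → ξ ≤ e → e ≤ b → e - c < δ →
    |A c ξ e| ≤ ε * (e - c)

/-- `dF = ω` on `[a, b]`: the increments of `F` agree with the germ `ω` up to a negligible error.
For `ω c ξ e = f ξ * (g e - g c)` this says `dF = f dg`, with the integrand evaluated anywhere in
the interval. -/
def HasDifferential (a b : ℝ) (F : ℝ → ℝ) (ω : ℝ → ℝ → ℝ → ℝ) : Prop :=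
  Negligible a b fun c ξ e => F e - F c - ω c ξ e

/-- Hölder continuity of order `β` of a real path on `[a, b]`. -/
def IsHolder (β a b : ℝ) (f : ℝ → ℝ) : Prop :=
  ∃ C, 0 ≤ C ∧ ∀ s t, a ≤ s → s ≤ t → t ≤ b → |f t - f s| ≤ C * (t - s) ^ β

/-- The integrands that are allowed against `β`-Hölder integrators: Hölder paths of a complementary
order, and arbitrary continuous paths when the integrators are Lipschitz. -/
def IsIntegrand (β a b : ℝ) (f : ℝ → ℝ) : Prop :=
  (∃ α > 0, 1 < α + β ∧ IsHolder α a b f) ∨ (β = 1 ∧ ContinuousOn f (Set.Icc a b))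

section Calculus

variable {a b β : ℝ}

namespace Negligible

variable {A B : ℝ → ℝ → ℝ → ℝ}

theorem congr (hA : Negligible a b A)
    (h : ∀ c ξ e, a ≤ c → c ≤ ξ → ξ ≤ e → e ≤ b → A c ξ e = B c ξ e) : Negligible a b B := by
  intro ε hε
  obtain ⟨δ, hδ, H⟩ := hA ε hε
  refine ⟨δ, hδ, fun c ξ e h1 h2 h3 h4 h5 => ?_⟩
  rw [← h c ξ e h1 h2 h3 h4]
  exact H c ξ e h1 h2 h3 h4 h5

theorem zero : Negligible a b fun _ _ _ => 0 := by
  intro ε hε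
  refine ⟨1, one_pos, fun c ξ e h1 h2 h3 h4 h5 => ?_⟩
  simpa using mul_nonneg hε.le (by linarith : 0 ≤ e - c)

theorem add (hA : Negligible a b A) (hB : Negligible a b B) :
    Negligible a b fun c ξ e => A c ξ e + B c ξ e := by
  intro ε hε
  obtain ⟨δ, hδ, H⟩ := hA (ε / 2) (by positivity)
  obtain ⟨δ', hδ', H'⟩ := hB (ε / 2) (by positivity)
  refine ⟨min δ δ', lt_min hδ hδ', fun c ξ e h1 h2 h3 h4 h5 => ?_⟩
  have := H c ξ e h1 h2 h3 h4 (h5.trans_le (min_le_left _ _))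
  have := H' c ξ e h1 h2 h3 h4 (h5.trans_le (min_le_right _ _))
  have := abs_add_le (A c ξ e) (B c ξ e)
  linarith

theorem bdd_mul {h : ℝ → ℝ} (hA : Negligible a b A) (hh : ∃ M, ∀ t ∈ Set.Icc a b, |h t| ≤ M) :
    Negligible a b fun c ξ e => h ξ * A c ξ e := by
  obtain ⟨M, hM⟩ := hh
  intro ε hε
  obtain ⟨δ, hδ, H⟩ := hA (ε / (|M| + 1)) (by positivity)
  refine ⟨δ, hδ, fun c ξ e h1 h2 h3 h4 h5 => ?_⟩
  have h6 := H c ξ e h1 h2 h3 h4 h5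
  have h7 : |h ξ| ≤ |M| + 1 :=
    ((hM ξ ⟨h1.trans h2, h3.trans h4⟩).trans (le_abs_self M)).trans (by linarith)
  calc |h ξ * A c ξ e| = |h ξ| * |A c ξ e| := abs_mul _ _
    _ ≤ (|M| + 1) * (ε / (|M| + 1) * (e - c)) := by gcongr
    _ = ε * (e - c) := by field_simp

theorem const_mul (k : ℝ) (hA : Negligible a b A) : Negligible a b fun c ξ e => k * A c ξ e :=
  hA.bdd_mul (h := fun _ => k) ⟨|k|, fun _ _ => le_rfl⟩

theorem neg (hA : Negligible a b A) : Negligible a b fun c ξ e => -A c ξ e :=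
  (hA.const_mul (-1)).congr fun _ _ _ _ _ _ _ => by ring

theorem sub (hA : Negligible a b A) (hB : Negligible a b B) :
    Negligible a b fun c ξ e => A c ξ e - B c ξ e :=
  (hA.add hB.neg).congr fun _ _ _ _ _ _ _ => by ring

theorem sum {ι : Type*} (s : Finset ι) {A : ι → ℝ → ℝ → ℝ → ℝ}
    (hA : ∀ i ∈ s, Negligible a b (A i)) : Negligible a b fun c ξ e => ∑ i ∈ s, A i c ξ e := by
  classical
  induction s using Finset.induction_on with
  | empty => simpa using zero
  | insert i s hi ih =>
    refine ((hA i (by simp)).add (ih fun j hj => hA j (by simp [hj]))).congr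
      fun c ξ e _ _ _ _ => ?_
    rw [Finset.sum_insert hi]

theorem mono {a' b' : ℝ} (hA : Negligible a b A) (ha : a ≤ a') (hb : b' ≤ b) :
    Negligible a' b' A := by
  intro ε hε
  obtain ⟨δ, hδ, H⟩ := hA ε hε
  exact ⟨δ, hδ, fun c ξ e h1 h2 h3 h4 h5 => H c ξ e (ha.trans h1) h2 h3 (h4.trans hb) h5⟩

theorem of_rpow_le {K θ : ℝ} (hθ : 1 < θ)
    (h : ∀ c ξ e, a ≤ c → c ≤ ξ → ξ ≤ e → e ≤ b → |A c ξ e| ≤ K * (e - c) ^ θ) :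
    Negligible a b A := by
  intro ε hε
  refine ⟨(ε / (|K| + 1)) ^ (1 / (θ - 1)), by positivity, fun c ξ e h1 h2 h3 h4 h5 => ?_⟩
  have h6 : 0 ≤ e - c := by linarith
  have hθ' : 0 < θ - 1 := by linarith
  have h7 : (e - c) ^ (θ - 1) ≤ ε / (|K| + 1) := by
    calc (e - c) ^ (θ - 1) ≤ ((ε / (|K| + 1)) ^ (1 / (θ - 1))) ^ (θ - 1) :=
          Real.rpow_le_rpow h6 h5.le hθ'.le
      _ = ε / (|K| + 1) := by
          rw [← Real.rpow_mul (by positivity), one_div_mul_cancel hθ'.ne', Real.rpow_one]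
  have h8 : (e - c) ^ θ = (e - c) ^ (θ - 1) * (e - c) := by
    rcases h6.eq_or_lt with h | h
    · rw [← h, Real.zero_rpow (by linarith), mul_zero]
    · rw [← Real.rpow_add_one h.ne']; congr 1; ring
  calc |A c ξ e| ≤ K * (e - c) ^ θ := h c ξ e h1 h2 h3 h4
    _ ≤ (|K| + 1) * ((e - c) ^ (θ - 1) * (e - c)) := by
        rw [h8]; gcongr; exact (le_abs_self K).trans (by linarith)
    _ ≤ (|K| + 1) * (ε / (|K| + 1) * (e - c)) := by gcongr
    _ = ε * (e - c) := by field_simp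

end Negligible

/-- A path with negligible increments is constant. -/
theorem Negligible.eq_of_increment {F : ℝ → ℝ} (h : Negligible a b fun c _ e => F e - F c)
    {t : ℝ} (ht : t ∈ Set.Icc a b) : F t = F a := by
  have key : ∀ ε > 0, |F t - F a| ≤ ε * (t - a) := by
    intro ε hε
    obtain ⟨δ, hδ, H⟩ := h ε hε
    obtain ⟨n, hn⟩ := exists_nat_gt ((t - a) / δ)
    have hta : 0 ≤ t - a := by linarith [ht.1]
    have hn0 : (0 : ℝ) < n := lt_of_le_of_lt (by positivity) hn
    set u : ℕ → ℝ := fun k => a + k * ((t - a) / n) with hu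
    have hstep : ∀ k, u (k + 1) - u k = (t - a) / n := fun k => by simp [hu]; ring
    have hun : u n = t := by simp [hu]; field_simp; ring
    have hu0 : u 0 = a := by simp [hu]
    have hmono : Monotone u := monotone_nat_of_le_succ fun k => by
      have := hstep k; have : 0 ≤ (t - a) / n := by positivity
      linarith
    have hlt : (t - a) / n < δ := by
      rw [div_lt_iff₀ hn0]; rw [div_lt_iff₀ hδ] at hn; linarith
    calc |F t - F a| = |∑ k ∈ Finset.range n, (F (u (k + 1)) - F (u k))| := by
          rw [Finset.sum_range_sub (fun k => F (u k)), hun, hu0]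
      _ ≤ ∑ k ∈ Finset.range n, |F (u (k + 1)) - F (u k)| := Finset.abs_sum_le_sum_abs _ _
      _ ≤ ∑ k ∈ Finset.range n, ε * (u (k + 1) - u k) := by
          refine Finset.sum_le_sum fun k hk => ?_
          have hk' := Finset.mem_range.1 hk
          refine H (u k) (u k) (u (k + 1)) ?_ le_rfl (hmono (by omega)) ?_ ((hstep k).trans_lt hlt)
          · rw [← hu0]; exact hmono (by omega)
          · refine le_trans ?_ ht.2
            rw [← hun]; exact hmono (by omega)
      _ = ε * (t - a) := by rw [← Finset.mul_sum, Finset.sum_range_sub u, hun, hu0]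
  have : |F t - F a| ≤ 0 := by
    refine le_of_forall_pos_le_add fun ε hε => ?_
    have hp : 0 < t - a + 1 := by linarith [ht.1]
    have := key (ε / (t - a + 1)) (by positivity)
    have h2 : ε / (t - a + 1) * (t - a) ≤ ε := by
      rw [div_mul_eq_mul_div, div_le_iff₀ hp]; nlinarith
    linarith
  have := abs_nonpos_iff.1 this
  linarith

namespace HasDifferential

variable {F G : ℝ → ℝ} {ω η : ℝ → ℝ → ℝ → ℝ}

theorem congr (h : HasDifferential a b F ω)
    (h' : ∀ c ξ e, a ≤ c → c ≤ ξ → ξ ≤ e → e ≤ b → ω c ξ e = η c ξ e) :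
    HasDifferential a b F η :=
  Negligible.congr h fun c ξ e h1 h2 h3 h4 => by rw [h' c ξ e h1 h2 h3 h4]

theorem congr_fun (h : HasDifferential a b F ω) (h' : ∀ t ∈ Set.Icc a b, F t = G t) :
    HasDifferential a b G ω :=
  Negligible.congr h fun c ξ e h1 h2 h3 h4 => by
    rw [h' c ⟨h1, h2.trans (h3.trans h4)⟩, h' e ⟨h1.trans (h2.trans h3), h4⟩]

theorem subst (h : HasDifferential a b F ω)
    (h' : Negligible a b fun c ξ e => ω c ξ e - η c ξ e) : HasDifferential a b F η :=
  (Negligible.add h h').congr fun c ξ e _ _ _ _ => by ring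

theorem mono {a' b' : ℝ} (h : HasDifferential a b F ω) (ha : a ≤ a') (hb : b' ≤ b) :
    HasDifferential a' b' F ω :=
  Negligible.mono h ha hb

theorem self (F : ℝ → ℝ) : HasDifferential a b F fun c _ e => F e - F c :=
  Negligible.zero.congr fun c ξ e _ _ _ _ => by ring

theorem const (k : ℝ) : HasDifferential a b (fun _ => k) fun _ _ _ => 0 :=
  Negligible.zero.congr fun c ξ e _ _ _ _ => by ring

theorem add (hF : HasDifferential a b F ω) (hG : HasDifferential a b G η) :
    HasDifferential a b (fun t => F t + G t) fun c ξ e => ω c ξ e + η c ξ e :=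
  (Negligible.add hF hG).congr fun c ξ e _ _ _ _ => by ring

theorem sub (hF : HasDifferential a b F ω) (hG : HasDifferential a b G η) :
    HasDifferential a b (fun t => F t - G t) fun c ξ e => ω c ξ e - η c ξ e :=
  (Negligible.sub hF hG).congr fun c ξ e _ _ _ _ => by ring

theorem const_mul (k : ℝ) (hF : HasDifferential a b F ω) :
    HasDifferential a b (fun t => k * F t) fun c ξ e => k * ω c ξ e :=
  (Negligible.const_mul k hF).congr fun c ξ e _ _ _ _ => by ring

theorem sum {ι : Type*} (s : Finset ι) {F : ι → ℝ → ℝ} {ω : ι → ℝ → ℝ → ℝ → ℝ}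
    (hF : ∀ i ∈ s, HasDifferential a b (F i) (ω i)) :
    HasDifferential a b (fun t => ∑ i ∈ s, F i t) fun c ξ e => ∑ i ∈ s, ω i c ξ e :=
  (Negligible.sum s hF).congr fun c ξ e _ _ _ _ => by
    simp only [Finset.sum_sub_distrib]

/-- Two paths with the same differential have the same increments. -/
theorem sub_eq_sub (hF : HasDifferential a b F ω) (hG : HasDifferential a b G ω) {t : ℝ}
    (ht : t ∈ Set.Icc a b) : F t - F a = G t - G a := by
  have h : Negligible a b fun c _ e => (fun t => F t - G t) e - (fun t => F t - G t) c :=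
    (Negligible.sub hF hG).congr fun c ξ e _ _ _ _ => by ring
  have := h.eq_of_increment ht
  linarith

end HasDifferential

/-! ### Hölder paths -/

theorem rpow_le_const_mul_rpow {h L α γ : ℝ} (hh : 0 ≤ h) (hL : h ≤ L) (hα : 0 < α)
    (hαγ : α ≤ γ) : h ^ γ ≤ L ^ (γ - α) * h ^ α := by
  rcases hh.eq_or_lt with h0 | h0
  · rw [← h0, Real.zero_rpow (by linarith), Real.zero_rpow hα.ne', mul_zero]
  · calc h ^ γ = h ^ (γ - α) * h ^ α := by rw [← Real.rpow_add h0]; congr 1; ring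
      _ ≤ L ^ (γ - α) * h ^ α := by
        gcongr

namespace IsHolder

variable {f g : ℝ → ℝ} {α : ℝ}

theorem mono {a' b' : ℝ} (hf : IsHolder β a b f) (ha : a ≤ a') (hb : b' ≤ b) :
    IsHolder β a' b' f := by
  obtain ⟨C, hC, h⟩ := hf
  exact ⟨C, hC, fun s t h1 h2 h3 => h s t (ha.trans h1) h2 (h3.trans hb)⟩

theorem congr (hf : IsHolder β a b f) (h : ∀ t ∈ Set.Icc a b, f t = g t) : IsHolder β a b g := by
  obtain ⟨C, hC, hf⟩ := hf
  refine ⟨C, hC, fun s t h1 h2 h3 => ?_⟩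
  rw [← h s ⟨h1, h2.trans h3⟩, ← h t ⟨h1.trans h2, h3⟩]
  exact hf s t h1 h2 h3

theorem abs_sub_le (hf : IsHolder β a b f) : ∃ C, 0 ≤ C ∧ ∀ s ∈ Set.Icc a b, ∀ t ∈ Set.Icc a b,
    |f t - f s| ≤ C * |t - s| ^ β := by
  obtain ⟨C, hC, hf⟩ := hf
  refine ⟨C, hC, fun s hs t ht => ?_⟩
  rcases le_total s t with h | h
  · rw [abs_of_nonneg (sub_nonneg.2 h)]; exact hf s t hs.1 h ht.2
  · rw [abs_sub_comm, abs_sub_comm t, abs_of_nonneg (sub_nonneg.2 h)]; exact hf t s ht.1 h hs.2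

theorem bounded (hβ : 0 < β) (hf : IsHolder β a b f) : ∃ M, ∀ t ∈ Set.Icc a b, |f t| ≤ M := by
  obtain ⟨C, hC, h⟩ := hf
  refine ⟨|f a| + C * (b - a) ^ β, fun t ht => ?_⟩
  have h1 := h a t le_rfl ht.1 ht.2
  have h2 : (t - a) ^ β ≤ (b - a) ^ β :=
    Real.rpow_le_rpow (by linarith [ht.1]) (by linarith [ht.2]) hβ.le
  have h3 : |f t| ≤ |f a| + |f t - f a| := by
    have := abs_add_le (f a) (f t - f a); simpa using this
  nlinarith

theorem continuousOn (hβ : 0 < β) (hf : IsHolder β a b f) : ContinuousOn f (Set.Icc a b) := by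
  obtain ⟨C, hC, h⟩ := hf.abs_sub_le
  intro s hs
  rw [ContinuousWithinAt, tendsto_iff_dist_tendsto_zero]
  have : Filter.Tendsto (fun t => C * |t - s| ^ β) (nhdsWithin s (Set.Icc a b)) (nhds 0) := by
    have h1 : ContinuousAt (fun t : ℝ => C * |t - s| ^ β) s := by
      refine ContinuousAt.mul continuousAt_const (ContinuousAt.rpow_const (by fun_prop) ?_)
      right; exact hβ.le
    have h2 := h1.tendsto
    simp only [sub_self, abs_zero, Real.zero_rpow hβ.ne', mul_zero] at h2
    exact h2.mono_left nhdsWithin_le_nhds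
  refine squeeze_zero' (Filter.Eventually.of_forall fun _ => dist_nonneg) ?_ this
  filter_upwards [self_mem_nhdsWithin] with t ht
  rw [Real.dist_eq]
  exact h s hs t ht

theorem const (k : ℝ) : IsHolder β a b fun _ => k :=
  ⟨0, le_rfl, fun s t _ _ _ => by simp⟩

theorem add (hf : IsHolder β a b f) (hg : IsHolder β a b g) :
    IsHolder β a b fun t => f t + g t := by
  obtain ⟨C, hC, h⟩ := hf
  obtain ⟨D, hD, h'⟩ := hg
  refine ⟨C + D, by positivity, fun s t h1 h2 h3 => ?_⟩
  have e : f t + g t - (f s + g s) = (f t - f s) + (g t - g s) := by ring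
  rw [e, add_mul]
  exact (abs_add_le _ _).trans (add_le_add (h s t h1 h2 h3) (h' s t h1 h2 h3))

theorem mul (hβ : 0 < β) (hf : IsHolder β a b f) (hg : IsHolder β a b g) :
    IsHolder β a b fun t => f t * g t := by
  obtain ⟨M, hM⟩ := hf.bounded hβ
  obtain ⟨M', hM'⟩ := hg.bounded hβ
  obtain ⟨C, hC, h⟩ := hf
  obtain ⟨D, hD, h'⟩ := hg
  refine ⟨|M| * D + |M'| * C, by positivity, fun s t h1 h2 h3 => ?_⟩
  have e : f t * g t - f s * g s = f t * (g t - g s) + g s * (f t - f s) := by ring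
  rw [e, add_mul]
  refine (abs_add_le _ _).trans (add_le_add ?_ ?_)
  · rw [abs_mul, mul_assoc]
    exact mul_le_mul ((hM t ⟨h1.trans h2, h3⟩).trans (le_abs_self M)) (h' s t h1 h2 h3)
      (abs_nonneg _) (abs_nonneg _)
  · rw [abs_mul, mul_assoc]
    exact mul_le_mul ((hM' s ⟨h1, h2.trans h3⟩).trans (le_abs_self M')) (h s t h1 h2 h3)
      (abs_nonneg _) (abs_nonneg _)

theorem const_mul (hβ : 0 < β) (k : ℝ) (hf : IsHolder β a b f) : IsHolder β a b fun t => k * f t :=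
  (const k).mul hβ hf

theorem sub (hβ : 0 < β) (hf : IsHolder β a b f) (hg : IsHolder β a b g) :
    IsHolder β a b fun t => f t - g t :=
  (hf.add (hg.const_mul hβ (-1))).congr fun t _ => by ring

theorem sum {ι : Type*} (s : Finset ι) {f : ι → ℝ → ℝ} (hf : ∀ i ∈ s, IsHolder β a b (f i)) :
    IsHolder β a b fun t => ∑ i ∈ s, f i t := by
  classical
  induction s using Finset.induction_on with
  | empty => simpa using const 0
  | insert i s hi ih =>
    refine ((hf i (by simp)).add (ih fun j hj => hf j (by simp [hj]))).congr fun t _ => ?_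
    rw [Finset.sum_insert hi]

/-- Hölder continuity on two adjacent intervals. -/
theorem union {c : ℝ} (hβ : 0 < β) (hf : IsHolder β a b f) (hf' : IsHolder β b c f) :
    IsHolder β a c f := by
  obtain ⟨C, hC, h⟩ := hf
  obtain ⟨D, hD, h'⟩ := hf'
  refine ⟨C + D, by positivity, fun s t h1 h2 h3 => ?_⟩
  have hst : 0 ≤ (t - s) ^ β := Real.rpow_nonneg (by linarith) _
  rcases le_total t b with htb | htb
  · have := h s t h1 h2 htb
    nlinarith
  rcases le_total b s with hbs | hbs
  · have := h' s t hbs h2 h3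
    nlinarith
  · have e1 := h s b h1 hbs le_rfl
    have e2 := h' b t le_rfl htb h3
    have e3 : (b - s) ^ β ≤ (t - s) ^ β := Real.rpow_le_rpow (by linarith) (by linarith) hβ.le
    have e4 : (t - b) ^ β ≤ (t - s) ^ β := Real.rpow_le_rpow (by linarith) (by linarith) hβ.le
    have e5 : |f t - f s| ≤ |f t - f b| + |f b - f s| := _root_.abs_sub_le _ _ _
    nlinarith

/-- A Hölder bound at a fixed small scale gives Hölder continuity. -/
theorem of_local (hβ : 0 < β) {C δ : ℝ} (hC : 0 ≤ C) (hδ : 0 < δ)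
    (h : ∀ s t, a ≤ s → s ≤ t → t ≤ b → t - s < δ → |f t - f s| ≤ C * (t - s) ^ β) :
    IsHolder β a b f := by
  obtain ⟨n, hn⟩ := exists_nat_gt ((b - a) / δ)
  refine ⟨(n + 1) * C, by positivity, fun s t h1 h2 h3 => ?_⟩
  have hts : 0 ≤ t - s := by linarith
  set u : ℕ → ℝ := fun k => s + k * ((t - s) / (n + 1)) with hu
  have hstep : ∀ k, u (k + 1) - u k = (t - s) / (n + 1) := fun k => by simp [hu]; ring
  have hun : u (n + 1) = t := by simp [hu]; field_simp; ring
  have hu0 : u 0 = s := by simp [hu]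
  have hq : 0 ≤ (t - s) / (n + 1) := by positivity
  have hmono : Monotone u := monotone_nat_of_le_succ fun k => by
    have := hstep k
    linarith
  have hlt : (t - s) / (n + 1) < δ := by
    rw [div_lt_iff₀ (by positivity)]; rw [div_lt_iff₀ hδ] at hn; nlinarith
  have hle : (t - s) / (n + 1) ≤ t - s := div_le_self hts (by simp)
  calc |f t - f s| = |∑ k ∈ Finset.range (n + 1), (f (u (k + 1)) - f (u k))| := by
        rw [Finset.sum_range_sub (fun k => f (u k)), hun, hu0]
    _ ≤ ∑ k ∈ Finset.range (n + 1), |f (u (k + 1)) - f (u k)| := Finset.abs_sum_le_sum_abs _ _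
    _ ≤ ∑ k ∈ Finset.range (n + 1), C * (t - s) ^ β := by
        refine Finset.sum_le_sum fun k hk => ?_
        have hk' := Finset.mem_range.1 hk
        refine (h (u k) (u (k + 1)) ?_ (hmono (by omega)) ?_ ((hstep k).trans_lt hlt)).trans ?_
        · refine h1.trans ?_
          rw [← hu0]; exact hmono (by omega)
        · refine le_trans ?_ h3
          rw [← hun]; exact hmono (by omega)
        · rw [hstep]; gcongr
    _ = (n + 1) * C * (t - s) ^ β := by simp; ring

theorem isIntegrand (hβ : 1 / 2 < β) (hf : IsHolder β a b f) : IsIntegrand β a b f :=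
  Or.inl ⟨β, by linarith, by linarith, hf⟩

theorem negligible_mul {α : ℝ} (hα : 0 < α) (hβ : 0 < β) (h : 1 < α + β) (hf : IsHolder α a b f)
    (hg : IsHolder β a b g) :
    Negligible a b fun c ξ e => (f c - f ξ) * (g e - g c) := by
  obtain ⟨C, hC, hf⟩ := hf
  obtain ⟨D, hD, hg⟩ := hg
  refine Negligible.of_rpow_le (K := C * D) h fun c ξ e h1 h2 h3 h4 => ?_
  have e0 : 0 ≤ e - c := by linarith
  have e1 := hf c ξ h1 h2 (h3.trans h4)
  have e2 := hg c e h1 (h2.trans h3) h4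
  have e3 : (ξ - c) ^ α ≤ (e - c) ^ α := Real.rpow_le_rpow (by linarith) (by linarith) hα.le
  rw [abs_mul, abs_sub_comm (f c)]
  rw [Real.rpow_add_of_nonneg e0 hα.le hβ.le]
  calc |f ξ - f c| * |g e - g c| ≤ (C * (e - c) ^ α) * (D * (e - c) ^ β) := by
        gcongr
        exact e1.trans (by gcongr)
    _ = C * D * ((e - c) ^ α * (e - c) ^ β) := by ring

end IsHolder

theorem IsIntegrand.continuousOn {f : ℝ → ℝ} (hf : IsIntegrand β a b f) :
    ContinuousOn f (Set.Icc a b) := by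
  rcases hf with ⟨α, hα, _, hf⟩ | ⟨_, hf⟩
  · exact hf.continuousOn hα
  · exact hf

theorem IsIntegrand.bounded {f : ℝ → ℝ} (hf : IsIntegrand β a b f) :
    ∃ M, ∀ t ∈ Set.Icc a b, |f t| ≤ M :=
  isCompact_Icc.exists_bound_of_continuousOn hf.continuousOn

/-- The product rule. The error terms are products of two increments, which are negligible because
`2 * β > 1`. -/
theorem HasDifferential.mul {F G : ℝ → ℝ} {ω η : ℝ → ℝ → ℝ → ℝ} (hβ : 1 / 2 < β)
    (hF : HasDifferential a b F ω) (hG : HasDifferential a b G η) (hF' : IsHolder β a b F)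
    (hG' : IsHolder β a b G) :
    HasDifferential a b (fun t => F t * G t) fun c ξ e => F ξ * η c ξ e + G ξ * ω c ξ e := by
  have hβ0 : 0 < β := by linarith
  have h1 := Negligible.bdd_mul hG (hF'.bounded hβ0)
  have h2 := Negligible.bdd_mul hF (hG'.bounded hβ0)
  have h3 := hF'.negligible_mul hβ0 hβ0 (by linarith) hG'
  have h4 := hG'.negligible_mul hβ0 hβ0 (by linarith) hF'
  have h5 : Negligible a b fun c _ e => (F e - F c) * (G e - G c) := by
    obtain ⟨C, hC, hf⟩ := hF'
    obtain ⟨D, hD, hg⟩ := hG'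
    refine Negligible.of_rpow_le (K := C * D) (θ := β + β) (by linarith)
      fun c ξ e h1 h2 h3 h4 => ?_
    have e1 := hf c e h1 (h2.trans h3) h4
    have e2 := hg c e h1 (h2.trans h3) h4
    rw [abs_mul, Real.rpow_add_of_nonneg (by linarith) hβ0.le hβ0.le]
    calc |F e - F c| * |G e - G c| ≤ (C * (e - c) ^ β) * (D * (e - c) ^ β) :=
          mul_le_mul e1 e2 (abs_nonneg _) ((abs_nonneg _).trans e1)
      _ = C * D * ((e - c) ^ β * (e - c) ^ β) := by ring
  exact ((((h1.add h2).add h3).add h4).add h5).congr fun c ξ e _ _ _ _ => by ring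

/-- If `dF = f dg` with `f` bounded and `g` Hölder, then `F` is Hölder. -/
theorem HasDifferential.isHolder {F f g : ℝ → ℝ} (hβ : 0 < β) (hβ1 : β ≤ 1)
    (hF : HasDifferential a b F fun c ξ e => f ξ * (g e - g c))
    (hf : ∃ M, ∀ t ∈ Set.Icc a b, |f t| ≤ M) (hg : IsHolder β a b g) : IsHolder β a b F := by
  obtain ⟨M, hM⟩ := hf
  obtain ⟨C, hC, hg⟩ := hg
  obtain ⟨δ, hδ, H⟩ := hF 1 one_pos
  refine IsHolder.of_local hβ (C := |M| * C + |b - a| ^ (1 - β)) (by positivity) hδ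
    fun s t h1 h2 h3 h4 => ?_
  have e1 := H s s t h1 le_rfl h2 h3 h4
  have e2 := hg s t h1 h2 h3
  have e3 : t - s ≤ |b - a| ^ (1 - β) * (t - s) ^ β := by
    have := rpow_le_const_mul_rpow (h := t - s) (L := |b - a|) (by linarith)
      (le_trans (by linarith) (le_abs_self _)) hβ hβ1
    rwa [Real.rpow_one] at this
  have e4 : |f s * (g t - g s)| ≤ |M| * (C * (t - s) ^ β) := by
    rw [abs_mul]
    exact mul_le_mul ((hM s ⟨h1, h2.trans h3⟩).trans (le_abs_self M)) e2 (abs_nonneg _)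
      (abs_nonneg _)
  have e5 : |F t - F s| ≤ |F t - F s - f s * (g t - g s)| + |f s * (g t - g s)| := by
    have := abs_add_le (F t - F s - f s * (g t - g s)) (f s * (g t - g s)); simpa using this
  nlinarith

/-! ### Differentials and Riemann-Stieltjes integrals -/

theorem HasRSIntegral.unique {f g : ℝ → ℝ} {I J : ℝ} (hI : HasRSIntegral f g a b I)
    (hJ : HasRSIntegral f g a b J) : I = J := by
  by_contra hne
  have hpos : 0 < |I - J| := abs_pos.2 (sub_ne_zero.2 hne)
  obtain ⟨hab, hI⟩ := hI
  obtain ⟨δ, hδ, H⟩ := hI (|I - J| / 2) (by positivity)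
  obtain ⟨δ', hδ', H'⟩ := hJ.2 (|I - J| / 2) (by positivity)
  obtain ⟨n, hn⟩ := exists_nat_gt ((b - a) / min δ δ')
  have hm : 0 < min δ δ' := lt_min hδ hδ'
  have hba : 0 ≤ b - a := by linarith
  have hn0 : (0 : ℝ) < n := lt_of_le_of_lt (by positivity) hn
  have hlt : (b - a) / n < min δ δ' := by
    rw [div_lt_iff₀ hn0]; rw [div_lt_iff₀ hm] at hn; linarith
  set u : ℕ → ℝ := fun k => a + k * ((b - a) / n) with hu
  have hstep : ∀ k, u (k + 1) - u k = (b - a) / n := fun k => by simp [hu]; ring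
  have hun : u n = b := by simp [hu]; field_simp; ring
  have hu0 : u 0 = a := by simp [hu]
  have hq : 0 ≤ (b - a) / n := by positivity
  have h1 := H n u u hu0 hun fun k _ => ⟨le_rfl, by linarith [hstep k],
    by rw [hstep]; exact hlt.trans_le (min_le_left _ _)⟩
  have h2 := H' n u u hu0 hun fun k _ => ⟨le_rfl, by linarith [hstep k],
    by rw [hstep]; exact hlt.trans_le (min_le_right _ _)⟩
  rw [abs_sub_comm] at h1
  have := abs_sub_le I (∑ k ∈ Finset.range n, f (u k) * (g (u (k + 1)) - g (u k))) J
  linarith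

theorem HasRSIntegral.rsInt_eq {f g : ℝ → ℝ} {I : ℝ} (h : HasRSIntegral f g a b I) :
    rsInt f g a b = I := by
  have h' : RSIntegrable f g a b := ⟨I, h⟩
  rw [rsInt, dif_pos h']
  exact h'.choose_spec.unique h

/-- A primitive computes the Riemann-Stieltjes integral: over a partition of `[c, e]` into intervals
shorter than `δ`, the errors `ε * (length)` add up to at most `ε * (e - c)`. -/
theorem HasDifferential.hasRSIntegral {F f g : ℝ → ℝ}
    (hF : HasDifferential a b F fun c ξ e => f ξ * (g e - g c)) {c e : ℝ} (hc : a ≤ c)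
    (hce : c ≤ e) (he : e ≤ b) : HasRSIntegral f g c e (F e - F c) := by
  refine ⟨hce, fun ε hε => ?_⟩
  have hp : 0 < e - c + 1 := by linarith
  obtain ⟨δ, hδ, H⟩ := hF (ε / (e - c + 1)) (by positivity)
  refine ⟨δ, hδ, fun n u ξ hu0 hun hu => ?_⟩
  have hmono : ∀ k ≤ n, c ≤ u k := by
    intro k
    induction k with
    | zero => intro _; rw [hu0]
    | succ k ih =>
      intro hk
      obtain ⟨h1, h2, _⟩ := hu k (by omega)
      exact (ih (by omega)).trans (h1.trans h2)
  have hmono' : ∀ k ≤ n, u (n - k) ≤ e := by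
    intro k
    induction k with
    | zero => intro _; rw [Nat.sub_zero, hun]
    | succ k ih =>
      intro hk
      obtain ⟨h1, h2, _⟩ := hu (n - (k + 1)) (by omega)
      rw [show n - (k + 1) + 1 = n - k by omega] at h2
      exact (h1.trans h2).trans (ih (by omega))
  calc |∑ k ∈ Finset.range n, f (ξ k) * (g (u (k + 1)) - g (u k)) - (F e - F c)|
      = |∑ k ∈ Finset.range n,
          (F (u (k + 1)) - F (u k) - f (ξ k) * (g (u (k + 1)) - g (u k)))| := by
        rw [Finset.sum_sub_distrib, Finset.sum_range_sub (fun k => F (u k)), hun, hu0,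
          abs_sub_comm]
    _ ≤ ∑ k ∈ Finset.range n,
          |F (u (k + 1)) - F (u k) - f (ξ k) * (g (u (k + 1)) - g (u k))| :=
        Finset.abs_sum_le_sum_abs _ _
    _ ≤ ∑ k ∈ Finset.range n, ε / (e - c + 1) * (u (k + 1) - u k) := by
        refine Finset.sum_le_sum fun k hk => ?_
        have hk' := Finset.mem_range.1 hk
        obtain ⟨h1, h2, h3⟩ := hu k hk'
        have h4 := hmono' (n - (k + 1)) (by omega)
        rw [show n - (n - (k + 1)) = k + 1 by omega] at h4
        exact H _ _ _ (hc.trans (hmono k hk'.le)) h1 h2 (h4.trans he) h3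
    _ = ε / (e - c + 1) * (e - c) := by
        rw [← Finset.mul_sum, Finset.sum_range_sub u, hun, hu0]
    _ < ε := by
        rw [div_mul_eq_mul_div, div_lt_iff₀ hp]; nlinarith

theorem HasDifferential.rsInt_eq {F f g : ℝ → ℝ}
    (hF : HasDifferential a b F fun c ξ e => f ξ * (g e - g c)) {c e : ℝ} (hc : a ≤ c)
    (hce : c ≤ e) (he : e ≤ b) : rsInt f g c e = F e - F c :=
  (hF.hasRSIntegral hc hce he).rsInt_eq

theorem hasRSIntegral_self (f g : ℝ → ℝ) (a : ℝ) : HasRSIntegral f g a a 0 := by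
  have h : HasDifferential a a (fun _ => 0) fun c ξ e => f ξ * (g e - g c) :=
    Negligible.zero.congr fun c ξ e h1 h2 h3 h4 => by
      have e1 : e = c := by linarith
      simp [e1]
  simpa using h.hasRSIntegral le_rfl le_rfl le_rfl

theorem rsInt_self (f g : ℝ → ℝ) (a : ℝ) : rsInt f g a a = 0 := (hasRSIntegral_self f g a).rsInt_eq

end Calculus

/-! ### Existence of Young integrals -/

section Existence

variable {a b β : ℝ}

/-- A two-parameter germ with an approximate primitive on every finite set of points has one on
`[a, b]`: a limit of the former along an ultrafilter. -/
theorem exists_primitive_of_finset (hab : a ≤ b) (A κ : ℝ → ℝ → ℝ)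
    (h : ∀ P : Finset ℝ, (∀ p ∈ P, p ∈ Set.Icc a b) →
      ∃ F : ℝ → ℝ, ∀ c ∈ P, ∀ e ∈ P, c ≤ e → |F e - F c - A c e| ≤ κ c e) :
    ∃ F : ℝ → ℝ, ∀ c e, a ≤ c → c ≤ e → e ≤ b → |F e - F c - A c e| ≤ κ c e := by
  classical
  have h' : ∀ P : Finset ℝ, ∃ F : ℝ → ℝ, ∀ c ∈ insert a (P.filter (· ∈ Set.Icc a b)),
      ∀ e ∈ insert a (P.filter (· ∈ Set.Icc a b)), c ≤ e → |F e - F c - A c e| ≤ κ c e := by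
    intro P
    refine h _ fun p hp => ?_
    rcases Finset.mem_insert.1 hp with rfl | hp
    · exact ⟨le_rfl, hab⟩
    · exact (Finset.mem_filter.1 hp).2
  choose F hF using h'
  let U : Ultrafilter (Finset ℝ) := Ultrafilter.of Filter.atTop
  have hU : (U : Filter (Finset ℝ)) ≤ Filter.atTop := Ultrafilter.of_le _
  have hev : ∀ c ∈ Set.Icc a b,
      ∀ᶠ P in (U : Filter (Finset ℝ)), c ∈ insert a (P.filter (· ∈ Set.Icc a b)) := by
    intro c hc
    refine hU ?_
    filter_upwards [Filter.eventually_ge_atTop ({c} : Finset ℝ)] with P hP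
    simp only [Finset.singleton_subset_iff] at hP
    exact Finset.mem_insert_of_mem (Finset.mem_filter.2 ⟨hP, hc⟩)
  have hlim : ∀ t, ∃ l, t ∈ Set.Icc a b →
      Filter.Tendsto (fun P => F P t - F P a) U (nhds l) := by
    intro t
    by_cases ht : t ∈ Set.Icc a b
    · have hb : ∀ᶠ P in (U : Filter (Finset ℝ)),
          F P t - F P a ∈ Set.Icc (A a t - κ a t) (A a t + κ a t) := by
        filter_upwards [hev t ht] with P hP
        have := abs_le.1 (hF P a (Finset.mem_insert_self _ _) t hP ht.1)
        constructor <;> linarith [this.1, this.2]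
      obtain ⟨l, _, hl⟩ := (isCompact_Icc (a := A a t - κ a t)
        (b := A a t + κ a t)).ultrafilter_le_nhds (U.map fun P => F P t - F P a)
        (Filter.le_principal_iff.2 hb)
      exact ⟨l, fun _ => hl⟩
    · exact ⟨0, fun h => absurd h ht⟩
  choose L hL using hlim
  refine ⟨L, fun c e hc hce he => ?_⟩
  have hc' : c ∈ Set.Icc a b := ⟨hc, hce.trans he⟩
  have he' : e ∈ Set.Icc a b := ⟨hc.trans hce, he⟩
  have ht := (((hL e he').sub (hL c hc')).sub (tendsto_const_nhds (x := A c e))).abs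
  refine le_of_tendsto ht ?_
  filter_upwards [hev c hc', hev e he'] with P h1 h2
  have := hF P c h1 e h2 hce
  rwa [show F P e - F P a - (F P c - F P a) - A c e = F P e - F P c - A c e by ring]

/-- The partial sums of `A` over the consecutive points of a finite set. -/
theorem exists_partial_sums (A : ℝ → ℝ → ℝ) (P : Finset ℝ) :
    ∃ F : ℝ → ℝ, ∀ c ∈ P, ∀ e ∈ P, c < e → (∀ q ∈ P, c < q → e ≤ q) → F e - F c = A c e := by
  classical
  induction P using Finset.induction_on_max with
  | empty => exact ⟨0, by simp⟩
  | insert w P hw ih =>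
    obtain ⟨F, hF⟩ := ih
    rcases P.eq_empty_or_nonempty with rfl | hP
    · refine ⟨0, fun c hc e he hce _ => ?_⟩
      simp at hc he
      subst hc; subst he
      exact absurd hce (lt_irrefl _)
    · set M := P.max' hP
      have hwP : ∀ q ∈ P, q ≠ w := fun q hq => (hw q hq).ne
      refine ⟨fun t => if t = w then F M + A M w else F t, fun c hc e he hce hcons => ?_⟩
      have hcP : c ∈ P := by
        rcases Finset.mem_insert.1 hc with rfl | hc
        · rcases Finset.mem_insert.1 he with rfl | he
          · exact absurd hce (lt_irrefl _)
          · exact absurd hce (hw e he).not_gt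
        · exact hc
      rcases Finset.mem_insert.1 he with rfl | he
      · have hcM : c = M := by
          refine le_antisymm (P.le_max' c hcP) (not_lt.1 fun hlt => ?_)
          have h1 := hcons M (Finset.mem_insert_of_mem (P.max'_mem hP)) hlt
          exact absurd h1 (hw M (P.max'_mem hP)).not_ge
        simp [hcM, hwP M (P.max'_mem hP)]
      · simp only [hwP c hcP, hwP e he, if_false]
        exact hF c hcP e he hce fun q hq => hcons q (Finset.mem_insert_of_mem hq)

/-- Young's maximal inequality for the partial sums over a finite set, by bisection. -/
theorem abs_partial_sum_le {θ C : ℝ} (hθ : 1 < θ) (hC : 0 ≤ C) {f g F : ℝ → ℝ} {P : Finset ℝ}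
    (hfg : ∀ c ∈ P, ∀ m ∈ P, ∀ e ∈ P, ∀ e' ∈ P, c ≤ m → m ≤ e → e ≤ e' →
      |(f m - f c) * (g e - g m)| ≤ C * (e' - c) ^ θ)
    (hF : ∀ c ∈ P, ∀ e ∈ P, c < e → (∀ q ∈ P, c < q → e ≤ q) →
      F e - F c = f c * (g e - g c)) :
    ∀ c ∈ P, ∀ e ∈ P, c ≤ e →
      |F e - F c - f c * (g e - g c)| ≤ 2 * C / (1 - 2 * (1 / 2) ^ θ) * (e - c) ^ θ := by
  classical
  set K := 2 * C / (1 - 2 * (1 / 2 : ℝ) ^ θ) with hK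
  have hlt : (1 / 2 : ℝ) ^ θ < 1 / 2 := by
    have := Real.rpow_lt_rpow_of_exponent_gt (x := 1 / 2) (by norm_num) (by norm_num) hθ
    rwa [Real.rpow_one] at this
  have hpos : 0 < 1 - 2 * (1 / 2 : ℝ) ^ θ := by linarith
  have hK0 : 0 ≤ K := by positivity
  have hKC : 2 * K * (1 / 2 : ℝ) ^ θ + 2 * C = K := by
    have : K * (1 - 2 * (1 / 2 : ℝ) ^ θ) = 2 * C := by rw [hK]; field_simp
    linarith
  have main : ∀ n : ℕ, ∀ c ∈ P, ∀ e ∈ P, c ≤ e →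
      (P.filter fun q => c < q ∧ q ≤ e).card ≤ n →
      |F e - F c - f c * (g e - g c)| ≤ K * (e - c) ^ θ := by
    intro n
    induction n with
    | zero =>
      intro c hc e he hce hcard
      have hce' : c = e := by
        by_contra hne
        have : e ∈ P.filter fun q => c < q ∧ q ≤ e :=
          Finset.mem_filter.2 ⟨he, lt_of_le_of_ne hce hne, le_rfl⟩
        have := Finset.card_pos.2 ⟨e, this⟩
        omega
      subst hce'
      simp [Real.zero_rpow (by linarith : θ ≠ 0)]
    | succ n ih =>
      intro c hc e he hce hcard
      rcases hce.eq_or_lt with rfl | hlt'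
      · simp [Real.zero_rpow (by linarith : θ ≠ 0)]
      -- `q` is the last point of the left half, `q'` the next point
      have hS : (P.filter fun q => c ≤ q ∧ q ≤ (c + e) / 2).Nonempty :=
        ⟨c, Finset.mem_filter.2 ⟨hc, le_rfl, by linarith⟩⟩
      obtain ⟨hq, hqc, hqm⟩ := Finset.mem_filter.1 (Finset.max'_mem _ hS)
      set q := (P.filter fun q => c ≤ q ∧ q ≤ (c + e) / 2).max' hS
      have hqmax : ∀ p ∈ P, q < p → (c + e) / 2 < p := by
        intro p hp hqp
        by_contra hcon
        exact absurd (Finset.le_max' _ p (Finset.mem_filter.2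
          ⟨hp, hqc.trans hqp.le, not_lt.1 hcon⟩)) hqp.not_ge
      have hS' : (P.filter fun p => q < p).Nonempty :=
        ⟨e, Finset.mem_filter.2 ⟨he, by linarith⟩⟩
      obtain ⟨hq', hqq'⟩ := Finset.mem_filter.1 (Finset.min'_mem _ hS')
      set q' := (P.filter fun p => q < p).min' hS'
      have hmin : ∀ p ∈ P, q < p → q' ≤ p := fun p hp hqp =>
        Finset.min'_le _ p (Finset.mem_filter.2 ⟨hp, hqp⟩)
      have hq'e : q' ≤ e := hmin e he (by linarith)
      have hq'm := hqmax q' hq' hqq'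
      have c1 : (P.filter fun p => c < p ∧ p ≤ q).card ≤ n := by
        refine Nat.le_of_lt_succ (lt_of_lt_of_le (Finset.card_lt_card ?_) hcard)
        refine (Finset.ssubset_iff_of_subset ?_).2 ⟨e, ?_, ?_⟩
        · intro p; simp only [Finset.mem_filter]
          exact fun h => ⟨h.1, h.2.1, by linarith [h.2.2]⟩
        · exact Finset.mem_filter.2 ⟨he, hlt', le_rfl⟩
        · simp only [Finset.mem_filter, not_and, not_le]
          intros; linarith
      have c2 : (P.filter fun p => q' < p ∧ p ≤ e).card ≤ n := by
        refine Nat.le_of_lt_succ (lt_of_lt_of_le (Finset.card_lt_card ?_) hcard)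
        refine (Finset.ssubset_iff_of_subset ?_).2 ⟨q', ?_, ?_⟩
        · intro p; simp only [Finset.mem_filter]
          exact fun h => ⟨h.1, by linarith [h.2.1], h.2.2⟩
        · exact Finset.mem_filter.2 ⟨hq', by linarith, hq'e⟩
        · simp
      have i1 := ih c hc q hq hqc c1
      have i2 := ih q' hq' e he hq'e c2
      have i3 := hF q hq q' hq' hqq' hmin
      have half : ∀ r, 0 ≤ r → r ≤ (e - c) / 2 → K * r ^ θ ≤ K * (1 / 2 : ℝ) ^ θ * (e - c) ^ θ := by
        intro r h0 hr
        rw [mul_assoc, ← Real.mul_rpow (by norm_num) (by linarith)]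
        refine mul_le_mul_of_nonneg_left (Real.rpow_le_rpow h0 (by linarith) (by linarith)) hK0
      have j1 := half (q - c) (by linarith) (by linarith)
      have j2 := half (e - q') (by linarith) (by linarith)
      have k1 := hfg c hc q hq q' hq' e he hqc hqq'.le hq'e
      have k2 := hfg c hc q' hq' e he e he (by linarith) hq'e le_rfl
      have e1 : F e - F c - f c * (g e - g c) = (F q - F c - f c * (g q - g c))
          + (F e - F q' - f q' * (g e - g q')) + (f q - f c) * (g q' - g q)
          + (f q' - f c) * (g e - g q') := by linear_combination i3
      calc |F e - F c - f c * (g e - g c)|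
          ≤ |F q - F c - f c * (g q - g c)| + |F e - F q' - f q' * (g e - g q')|
            + |(f q - f c) * (g q' - g q)| + |(f q' - f c) * (g e - g q')| := by
            rw [e1]
            refine (abs_add_le _ _).trans (add_le_add_left ((abs_add_le _ _).trans
              (add_le_add_left (abs_add_le _ _) _)) _)
        _ ≤ (2 * K * (1 / 2 : ℝ) ^ θ + 2 * C) * (e - c) ^ θ := by linarith
        _ = K * (e - c) ^ θ := by rw [hKC]
  exact fun c hc e he hce => main _ c hc e he hce le_rfl

/-- The analogue of the maximal inequality for a Lipschitz integrator and an integrand whose values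
stay within `η` of a constant `r`. -/
theorem abs_partial_sum_le_of_lipschitz {L : ℝ} {f g F : ℝ → ℝ} {P : Finset ℝ}
    (hg : ∀ c ∈ P, ∀ e ∈ P, c ≤ e → |g e - g c| ≤ L * (e - c))
    (hF : ∀ c ∈ P, ∀ e ∈ P, c < e → (∀ q ∈ P, c < q → e ≤ q) →
      F e - F c = f c * (g e - g c)) {r η : ℝ} :
    ∀ e ∈ P, ∀ c ∈ P, c ≤ e → (∀ q ∈ P, c ≤ q → q ≤ e → |f q - r| ≤ η) →
      |F e - F c - r * (g e - g c)| ≤ η * (L * (e - c)) := by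
  classical
  intro e he
  have main : ∀ n : ℕ, ∀ c ∈ P, c ≤ e → (P.filter fun q => c < q ∧ q ≤ e).card ≤ n →
      (∀ q ∈ P, c ≤ q → q ≤ e → |f q - r| ≤ η) →
      |F e - F c - r * (g e - g c)| ≤ η * (L * (e - c)) := by
    intro n
    induction n with
    | zero =>
      intro c hc hce hcard _
      have hce' : c = e := by
        by_contra hne
        have : e ∈ P.filter fun q => c < q ∧ q ≤ e :=
          Finset.mem_filter.2 ⟨he, lt_of_le_of_ne hce hne, le_rfl⟩
        have := Finset.card_pos.2 ⟨e, this⟩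
        omega
      subst hce'
      simp
    | succ n ih =>
      intro c hc hce hcard hη
      rcases hce.eq_or_lt with rfl | hlt
      · simp
      have hS' : (P.filter fun p => c < p).Nonempty := ⟨e, Finset.mem_filter.2 ⟨he, hlt⟩⟩
      obtain ⟨hq, hcq⟩ := Finset.mem_filter.1 (Finset.min'_mem _ hS')
      set q := (P.filter fun p => c < p).min' hS'
      have hmin : ∀ p ∈ P, c < p → q ≤ p := fun p hp hqp =>
        Finset.min'_le _ p (Finset.mem_filter.2 ⟨hp, hqp⟩)
      have hqe := hmin e he hlt
      have c2 : (P.filter fun p => q < p ∧ p ≤ e).card ≤ n := by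
        refine Nat.le_of_lt_succ (lt_of_lt_of_le (Finset.card_lt_card ?_) hcard)
        refine (Finset.ssubset_iff_of_subset ?_).2 ⟨q, ?_, ?_⟩
        · intro p; simp only [Finset.mem_filter]
          exact fun h => ⟨h.1, by linarith [h.2.1], h.2.2⟩
        · exact Finset.mem_filter.2 ⟨hq, by linarith, hqe⟩
        · simp
      have i1 := ih q hq hqe c2 fun p hp h1 h2 => hη p hp (hcq.le.trans h1) h2
      have i2 := hF c hc q hq hcq hmin
      have e1 : F e - F c - r * (g e - g c)
          = (F e - F q - r * (g e - g q)) + (f c - r) * (g q - g c) := by linear_combination i2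
      have i3 : |(f c - r) * (g q - g c)| ≤ η * (L * (q - c)) := by
        rw [abs_mul]
        have := hη c hc le_rfl hce
        exact mul_le_mul this (hg c hc q hq hcq.le) (abs_nonneg _) ((abs_nonneg _).trans this)
      rw [e1]
      have := abs_add_le (F e - F q - r * (g e - g q)) ((f c - r) * (g q - g c))
      linarith
  exact fun c hc hce hη => main _ c hc hce le_rfl hη

/-- Existence of the Young integral, in the form of a primitive. -/
theorem IsIntegrand.exists_hasDifferential {f g : ℝ → ℝ} (hab : a ≤ b) (hβ : 0 < β)
    (hf : IsIntegrand β a b f) (hg : IsHolder β a b g) :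
    ∃ F, HasDifferential a b F fun c ξ e => f ξ * (g e - g c) := by
  rcases hf with ⟨α, hα, hαβ, hf⟩ | ⟨rfl, hf⟩
  · obtain ⟨C, hC, hfC⟩ := hf
    obtain ⟨D, hD, hgD⟩ := hg
    obtain ⟨F, hF⟩ := exists_primitive_of_finset hab (fun c e => f c * (g e - g c))
      (fun c e => 2 * (C * D) / (1 - 2 * (1 / 2) ^ (α + β)) * (e - c) ^ (α + β)) (by
        intro P hP
        obtain ⟨F, hF⟩ := exists_partial_sums (fun c e => f c * (g e - g c)) P
        refine ⟨F, abs_partial_sum_le hαβ (by positivity) ?_ hF⟩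
        intro c hc m hm e he e' he' h1 h2 h3
        have i1 := hfC c m (hP c hc).1 h1 (hP m hm).2
        have i2 := hgD m e (hP m hm).1 h2 (hP e he).2
        have i3 : (m - c) ^ α ≤ (e' - c) ^ α :=
          Real.rpow_le_rpow (by linarith) (by linarith) hα.le
        have i4 : (e - m) ^ β ≤ (e' - c) ^ β :=
          Real.rpow_le_rpow (by linarith) (by linarith) hβ.le
        have i5 : 0 ≤ (e' - c) ^ α := Real.rpow_nonneg (by linarith) _
        rw [abs_mul, Real.rpow_add_of_nonneg (by linarith) hα.le hβ.le]
        calc |f m - f c| * |g e - g m| ≤ (C * (e' - c) ^ α) * (D * (e' - c) ^ β) :=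
              mul_le_mul (i1.trans (by gcongr)) (i2.trans (by gcongr)) (abs_nonneg _)
                (by positivity)
          _ = C * D * ((e' - c) ^ α * (e' - c) ^ β) := by ring)
    refine ⟨F, ?_⟩
    have h1 : Negligible a b fun c ξ e => F e - F c - f c * (g e - g c) :=
      Negligible.of_rpow_le hαβ fun c ξ e h1 h2 h3 h4 => hF c e h1 (h2.trans h3) h4
    exact (h1.add (IsHolder.negligible_mul hα hβ hαβ ⟨C, hC, hfC⟩ ⟨D, hD, hgD⟩)).congr
      fun c ξ e _ _ _ _ => by ring
  · obtain ⟨L, hL, hgL⟩ := hg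
    simp only [Real.rpow_one] at hgL
    -- `κ c e` is `L (e - c)` times the oscillation of `f` on `[c, e]`
    have hbdd : ∀ c e, a ≤ c → e ≤ b →
        BddAbove ((fun q => |f q - f c|) '' Set.Icc c e) := by
      intro c e h1 h2
      refine (isCompact_Icc.image_of_continuousOn ?_).bddAbove
      exact ((hf.mono (Set.Icc_subset_Icc h1 h2)).sub continuousOn_const).abs
    obtain ⟨F, hF⟩ := exists_primitive_of_finset hab (fun c e => f c * (g e - g c))
      (fun c e => sSup ((fun q => |f q - f c|) '' Set.Icc c e) * (L * (e - c))) (by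
        intro P hP
        obtain ⟨F, hF⟩ := exists_partial_sums (fun c e => f c * (g e - g c)) P
        refine ⟨F, fun c hc e he hce => ?_⟩
        refine abs_partial_sum_le_of_lipschitz (fun c hc e he hce =>
          hgL c e (hP c hc).1 hce (hP e he).2) hF e he c hc hce fun q hq h1 h2 => ?_
        exact le_csSup (hbdd c e (hP c hc).1 (hP e he).2) ⟨q, ⟨h1, h2⟩, rfl⟩)
    refine ⟨F, fun ε hε => ?_⟩
    have huc := isCompact_Icc.uniformContinuousOn_of_continuous hf
    rw [Metric.uniformContinuousOn_iff_le] at huc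
    obtain ⟨δ, hδ, H⟩ := huc (ε / (2 * L + 1)) (by positivity)
    refine ⟨δ, hδ, fun c ξ e h1 h2 h3 h4 h5 => ?_⟩
    have hce : 0 ≤ e - c := by linarith
    have hosc : ∀ q ∈ Set.Icc c e, |f q - f c| ≤ ε / (2 * L + 1) := by
      intro q hq
      rw [← Real.dist_eq]
      refine H q ⟨h1.trans hq.1, hq.2.trans h4⟩ c ⟨h1, by linarith⟩ ?_
      rw [Real.dist_eq, abs_of_nonneg (by linarith [hq.1])]
      linarith [hq.2]
    have i1 := hF c e h1 (h2.trans h3) h4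
    have i2 : sSup ((fun q => |f q - f c|) '' Set.Icc c e) ≤ ε / (2 * L + 1) := by
      refine csSup_le ((Set.nonempty_Icc.2 (h2.trans h3)).image _) ?_
      rintro _ ⟨q, hq, rfl⟩
      exact hosc q hq
    have i3 := hosc ξ ⟨h2, h3⟩
    have i4 := hgL c e h1 (h2.trans h3) h4
    have i5 : |(f ξ - f c) * (g e - g c)| ≤ ε / (2 * L + 1) * (L * (e - c)) := by
      rw [abs_mul]
      exact mul_le_mul i3 i4 (abs_nonneg _) (by positivity)
    have i6 : sSup ((fun q => |f q - f c|) '' Set.Icc c e) * (L * (e - c))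
        ≤ ε / (2 * L + 1) * (L * (e - c)) :=
      mul_le_mul_of_nonneg_right i2 (by positivity)
    have i7 : ε / (2 * L + 1) * (L * (e - c)) + ε / (2 * L + 1) * (L * (e - c))
        ≤ ε * (e - c) := by
      have : ε / (2 * L + 1) * (2 * L + 1) = ε := by field_simp
      have : 0 ≤ ε / (2 * L + 1) * (e - c) := by positivity
      nlinarith
    have e1 : F e - F c - f ξ * (g e - g c)
        = (F e - F c - f c * (g e - g c)) - (f ξ - f c) * (g e - g c) := by ring
    have e2 := abs_sub (F e - F c - f c * (g e - g c)) ((f ξ - f c) * (g e - g c))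
    rw [← e1] at e2
    exact e2.trans (by linarith)

theorem IsIntegrand.hasDifferential_rsInt {f g : ℝ → ℝ} (hβ : 0 < β)
    (hf : IsIntegrand β a b f) (hg : IsHolder β a b g) :
    HasDifferential a b (fun t => rsInt f g a t) fun c ξ e => f ξ * (g e - g c) := by
  rcases le_or_gt a b with hab | hab
  · obtain ⟨F, hF⟩ := hf.exists_hasDifferential hab hβ hg
    have h : HasDifferential a b (fun t => F t - F a) fun c ξ e => f ξ * (g e - g c) :=
      (hF.sub (HasDifferential.const (F a))).congr fun c ξ e _ _ _ _ => by ring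
    refine h.congr_fun fun t ht => ?_
    rw [hF.rsInt_eq le_rfl ht.1 ht.2]
  · intro ε hε
    exact ⟨1, one_pos, fun c ξ e h1 h2 h3 h4 _ => by linarith⟩

theorem IsIntegrand.isHolder_rsInt {f g : ℝ → ℝ} (hβ : 0 < β) (hβ1 : β ≤ 1)
    (hf : IsIntegrand β a b f) (hg : IsHolder β a b g) :
    IsHolder β a b fun t => rsInt f g a t :=
  (hf.hasDifferential_rsInt hβ hg).isHolder hβ hβ1 hf.bounded hg

theorem IsIntegrand.rsIntegrable {f g : ℝ → ℝ} (hab : a ≤ b) (hβ : 0 < β)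
    (hf : IsIntegrand β a b f) (hg : IsHolder β a b g) : RSIntegrable f g a b :=
  ⟨_, (hf.hasDifferential_rsInt hβ hg).hasRSIntegral le_rfl hab le_rfl⟩

end Existence

/-! ### Functions of Hölder paths -/

section Functions

variable {a b β : ℝ} {d : ℕ}

/-- The local regularity of a function on `ℝ^d` that makes its compositions with `β`-Hölder paths
integrands. -/
def IsLocallyRegular (β : ℝ) (φ : (Fin d → ℝ) → ℝ) : Prop :=
  (∃ δ > 0, 1 < δ * β + β ∧ ∀ K, IsCompact K → ∃ C, 0 ≤ C ∧ ∀ p ∈ K, ∀ q ∈ K,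
    |φ p - φ q| ≤ C * ‖p - q‖ ^ δ) ∨ (β = 1 ∧ Continuous φ)

theorem exists_lipschitz_bound_of_contDiff {φ : (Fin d → ℝ) → ℝ} (hφ : ContDiff ℝ 1 φ)
    {K : Set (Fin d → ℝ)} (hK : IsCompact K) :
    ∃ C, 0 ≤ C ∧ ∀ p ∈ K, ∀ q ∈ K, |φ p - φ q| ≤ C * ‖p - q‖ := by
  obtain ⟨R, hR⟩ := hK.isBounded.subset_closedBall 0
  have hcont : Continuous fun w => ‖fderiv ℝ φ w‖ := (hφ.continuous_fderiv one_ne_zero).norm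
  obtain ⟨C, hC⟩ := (isCompact_closedBall (0 : Fin d → ℝ) R).exists_bound_of_continuousOn
    hcont.continuousOn
  refine ⟨|C|, abs_nonneg _, fun p hp q hq => ?_⟩
  have := Convex.norm_image_sub_le_of_norm_fderiv_le (𝕜 := ℝ) (f := φ) (C := |C|)
    (s := Metric.closedBall 0 R) (fun w _ => (hφ.differentiable one_ne_zero) w)
    (fun w hw => by simpa using (hC w hw).trans (le_abs_self C)) (convex_closedBall _ _)
    (hR hq) (hR hp)
  simpa using this

theorem IsLocallyRegular.of_contDiff (hβ : 1 / 2 < β) {φ : (Fin d → ℝ) → ℝ}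
    (hφ : ContDiff ℝ 1 φ) : IsLocallyRegular β φ := by
  refine Or.inl ⟨1, one_pos, by linarith, fun K hK => ?_⟩
  simpa using exists_lipschitz_bound_of_contDiff hφ hK

theorem exists_norm_bound_of_isHolder {P : ℝ → Fin d → ℝ} (hβ : 0 < β)
    (hP : ∀ l, IsHolder β a b fun t => P t l) :
    ∃ R, ∀ t ∈ Set.Icc a b, P t ∈ Metric.closedBall (0 : Fin d → ℝ) R := by
  choose M hM using fun l => (hP l).bounded hβ
  refine ⟨∑ l, |M l|, fun t ht => ?_⟩
  rw [mem_closedBall_zero_iff, pi_norm_le_iff_of_nonneg (Finset.sum_nonneg fun _ _ => abs_nonneg _)]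
  intro l
  exact ((hM l t ht).trans (le_abs_self _)).trans
    (Finset.single_le_sum (f := fun l => |M l|) (fun _ _ => abs_nonneg _) (Finset.mem_univ l))

theorem exists_norm_sub_le_of_isHolder {P : ℝ → Fin d → ℝ}
    (hP : ∀ l, IsHolder β a b fun t => P t l) :
    ∃ C, 0 ≤ C ∧ ∀ s t, a ≤ s → s ≤ t → t ≤ b → ‖P t - P s‖ ≤ C * (t - s) ^ β := by
  choose C hC hP using hP
  refine ⟨∑ l, C l, Finset.sum_nonneg fun l _ => hC l, fun s t h1 h2 h3 => ?_⟩
  have h4 : 0 ≤ (t - s) ^ β := Real.rpow_nonneg (by linarith) _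
  rw [pi_norm_le_iff_of_nonneg (mul_nonneg (Finset.sum_nonneg fun l _ => hC l) h4)]
  intro l
  refine (hP l s t h1 h2 h3).trans (mul_le_mul_of_nonneg_right ?_ h4)
  exact Finset.single_le_sum (f := C) (fun l _ => hC l) (Finset.mem_univ l)

theorem IsLocallyRegular.isIntegrand_comp {φ : (Fin d → ℝ) → ℝ} (hφ : IsLocallyRegular β φ)
    (hβ : 0 < β) {P : ℝ → Fin d → ℝ} (hP : ∀ l, IsHolder β a b fun t => P t l) :
    IsIntegrand β a b fun t => φ (P t) := by
  rcases hφ with ⟨δ, hδ, hδβ, h⟩ | ⟨h1, h⟩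
  · obtain ⟨R, hR⟩ := exists_norm_bound_of_isHolder hβ hP
    obtain ⟨C, hC, hPC⟩ := exists_norm_sub_le_of_isHolder hP
    obtain ⟨D, hD, hφ⟩ := h _ (isCompact_closedBall (0 : Fin d → ℝ) R)
    refine Or.inl ⟨δ * β, by positivity, hδβ, D * C ^ δ, by positivity, fun s t h1 h2 h3 => ?_⟩
    have h4 := hφ (P t) (hR t ⟨h1.trans h2, h3⟩) (P s) (hR s ⟨h1, h2.trans h3⟩)
    have h5 : 0 ≤ t - s := by linarith
    calc |φ (P t) - φ (P s)| ≤ D * ‖P t - P s‖ ^ δ := h4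
      _ ≤ D * (C * (t - s) ^ β) ^ δ := by
        gcongr
        exact hPC s t h1 h2 h3
      _ = D * C ^ δ * (t - s) ^ (δ * β) := by
        rw [Real.mul_rpow hC (by positivity), ← Real.rpow_mul h5, mul_comm β δ, mul_assoc]
  · refine Or.inr ⟨h1, h.comp_continuousOn ?_⟩
    exact continuousOn_pi.2 fun l => (hP l).continuousOn hβ

theorem isHolder_comp_of_contDiff {φ : (Fin d → ℝ) → ℝ} (hφ : ContDiff ℝ 1 φ) (hβ : 0 < β)
    {P : ℝ → Fin d → ℝ} (hP : ∀ l, IsHolder β a b fun t => P t l) :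
    IsHolder β a b fun t => φ (P t) := by
  obtain ⟨R, hR⟩ := exists_norm_bound_of_isHolder hβ hP
  obtain ⟨C, hC, hPC⟩ := exists_norm_sub_le_of_isHolder hP
  obtain ⟨D, hD, hφ⟩ := exists_lipschitz_bound_of_contDiff hφ
    (isCompact_closedBall (0 : Fin d → ℝ) R)
  refine ⟨D * C, by positivity, fun s t h1 h2 h3 => ?_⟩
  refine (hφ (P t) (hR t ⟨h1.trans h2, h3⟩) (P s) (hR s ⟨h1, h2.trans h3⟩)).trans ?_
  rw [mul_assoc]
  exact mul_le_mul_of_nonneg_left (hPC s t h1 h2 h3) hD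

theorem fderiv_apply_eq_sum_pderiv (h : (Fin d → ℝ) → ℝ) (w v : Fin d → ℝ) :
    fderiv ℝ h w v = ∑ l, pderiv l h w * v l := by
  conv_lhs => rw [pi_eq_sum_univ' v]
  rw [map_sum]
  refine Finset.sum_congr rfl fun l _ => ?_
  rw [map_smul, smul_eq_mul, mul_comm, pderiv]

theorem abs_sub_sub_sum_pderiv_le {h : (Fin d → ℝ) → ℝ} (hh : Differentiable ℝ h)
    {w p q : Fin d → ℝ} {r η : ℝ} (hη : 0 ≤ η) (hp : p ∈ Metric.closedBall w r)
    (hq : q ∈ Metric.closedBall w r)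
    (hb : ∀ v ∈ Metric.closedBall w r, ∀ l, |pderiv l h v - pderiv l h w| ≤ η) :
    |h q - h p - ∑ l, pderiv l h w * (q l - p l)| ≤ d * η * ‖q - p‖ := by
  have := Convex.norm_image_sub_le_of_norm_fderiv_le' (𝕜 := ℝ) (f := h) (C := d * η)
    (φ := fderiv ℝ h w) (s := Metric.closedBall w r) (fun v _ => hh v) (fun v hv => by
      refine ContinuousLinearMap.opNorm_le_bound _ (by positivity) fun u => ?_
      rw [sub_apply, fderiv_apply_eq_sum_pderiv, fderiv_apply_eq_sum_pderiv,
        ← Finset.sum_sub_distrib, Real.norm_eq_abs]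
      refine (Finset.abs_sum_le_sum_abs _ _).trans ?_
      calc ∑ l, |pderiv l h v * u l - pderiv l h w * u l| ≤ ∑ _l : Fin d, η * ‖u‖ := by
            refine Finset.sum_le_sum fun l _ => ?_
            rw [← sub_mul, abs_mul]
            exact mul_le_mul (hb v hv l) (norm_le_pi_norm u l) (abs_nonneg _) hη
        _ = d * η * ‖u‖ := by simp; ring) (convex_closedBall _ _) hp hq
  rw [fderiv_apply_eq_sum_pderiv] at this
  simpa using this

/-- The chain rule. The increment of `h` differs from its linearization at the tag by the
oscillation of the gradient times the increment of the path. -/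
theorem hasDifferential_comp {h : (Fin d → ℝ) → ℝ} (hh : ContDiff ℝ 1 h)
    (hreg : ∀ l, IsLocallyRegular β (pderiv l h)) (hβ : 0 < β) {P : ℝ → Fin d → ℝ}
    (hP : ∀ l, IsHolder β a b fun t => P t l) :
    HasDifferential a b (fun t => h (P t))
      fun c ξ e => ∑ l, pderiv l h (P ξ) * (P e l - P c l) := by
  obtain ⟨R, hR⟩ := exists_norm_bound_of_isHolder hβ hP
  obtain ⟨C, hC, hPC⟩ := exists_norm_sub_le_of_isHolder hP
  have hdiff := hh.differentiable one_ne_zero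
  -- the path stays in a ball around its value at the tag
  have hball : ∀ c ξ e, a ≤ c → c ≤ ξ → ξ ≤ e → e ≤ b →
      P c ∈ Metric.closedBall (P ξ) (C * (e - c) ^ β) ∧
      P e ∈ Metric.closedBall (P ξ) (C * (e - c) ^ β) := by
    intro c ξ e h1 h2 h3 h4
    constructor
    · rw [mem_closedBall_iff_norm']
      refine (hPC c ξ h1 h2 (h3.trans h4)).trans ?_
      gcongr
    · rw [mem_closedBall_iff_norm]
      refine (hPC ξ e (h1.trans h2) h3 h4).trans ?_
      gcongr
  by_cases hβ1 : β = 1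
  · subst hβ1
    simp only [Real.rpow_one] at hPC hball
    intro ε hε
    have huc : ∀ l, ∃ δ > 0, ∀ p ∈ Metric.closedBall (0 : Fin d → ℝ) (R + 1),
        ∀ q ∈ Metric.closedBall (0 : Fin d → ℝ) (R + 1), dist p q ≤ δ →
          dist (pderiv l h p) (pderiv l h q) ≤ ε / (d * C + 1) := by
      intro l
      have hc : Continuous (pderiv l h) :=
        (hh.continuous_fderiv one_ne_zero).clm_apply continuous_const
      have := (isCompact_closedBall (0 : Fin d → ℝ) (R + 1)).uniformContinuousOn_of_continuous
        hc.continuousOn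
      rw [Metric.uniformContinuousOn_iff_le] at this
      exact this _ (by positivity)
    choose δ hδ hδ' using huc
    obtain ⟨δ₀, hδ₀, hle⟩ : ∃ δ₀ > 0, ∀ l, δ₀ ≤ δ l := by
      rcases isEmpty_or_nonempty (Fin d) with hd | hd
      · exact ⟨1, one_pos, fun l => hd.elim l⟩
      · obtain ⟨l, hl⟩ := Finite.exists_min δ
        exact ⟨δ l, hδ l, hl⟩
    refine ⟨min 1 δ₀ / (C + 1), by positivity, fun c ξ e h1 h2 h3 h4 h5 => ?_⟩
    have h0 : 0 ≤ e - c := by linarith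
    obtain ⟨hc, he⟩ := hball c ξ e h1 h2 h3 h4
    have hr : C * (e - c) ≤ min 1 δ₀ := by
      rw [lt_div_iff₀ (by positivity)] at h5
      nlinarith
    have hξ := hR ξ ⟨h1.trans h2, h3.trans h4⟩
    have key := abs_sub_sub_sum_pderiv_le hdiff (η := ε / (d * C + 1)) (by positivity) hc he
      (fun v hv l => by
        have hvξ := Metric.mem_closedBall.1 hv
        rw [← Real.dist_eq]
        refine hδ' l v ?_ (P ξ) ?_ ?_
        · rw [Metric.mem_closedBall] at hξ ⊢
          have := dist_triangle v (P ξ) 0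
          have := hr.trans (min_le_left _ _)
          linarith
        · exact Metric.closedBall_subset_closedBall (by linarith) hξ
        · exact (hvξ.trans (hr.trans (min_le_right _ _))).trans (hle l))
    refine key.trans ?_
    have h6 := hPC c e h1 (h2.trans h3) h4
    calc d * (ε / (d * C + 1)) * ‖P e - P c‖ ≤ d * (ε / (d * C + 1)) * (C * (e - c)) := by gcongr
      _ = (d * C / (d * C + 1)) * (ε * (e - c)) := by ring
      _ ≤ 1 * (ε * (e - c)) := by
        gcongr
        rw [div_le_one (by positivity)]; linarith
      _ = ε * (e - c) := one_mul _
  · have hreg' : ∀ l, ∃ δ > 0, 1 < δ * β + β ∧ ∀ K, IsCompact K → ∃ C, 0 ≤ C ∧ ∀ p ∈ K, ∀ q ∈ K,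
        |pderiv l h p - pderiv l h q| ≤ C * ‖p - q‖ ^ δ := fun l =>
      (hreg l).resolve_right fun h => hβ1 h.1
    choose δ hδ hδβ H using hreg'
    obtain ⟨R', hR'⟩ : ∃ R', ∀ c ξ e, a ≤ c → c ≤ ξ → ξ ≤ e → e ≤ b →
        Metric.closedBall (P ξ) (C * (e - c) ^ β) ⊆ Metric.closedBall (0 : Fin d → ℝ) R' := by
      refine ⟨R + C * |b - a| ^ β, fun c ξ e h1 h2 h3 h4 => ?_⟩
      refine Metric.closedBall_subset_closedBall' ?_
      have h5 := Metric.mem_closedBall.1 (hR ξ ⟨h1.trans h2, h3.trans h4⟩)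
      have h6 : C * (e - c) ^ β ≤ C * |b - a| ^ β := by
        gcongr
        · linarith
        · exact le_trans (by linarith) (le_abs_self _)
      linarith
    choose D hD hDb using fun l => H l _ (isCompact_closedBall (0 : Fin d → ℝ) R')
    -- the error is a sum over the coordinates, as the Hölder exponents may differ
    have key : ∀ c ξ e, a ≤ c → c ≤ ξ → ξ ≤ e → e ≤ b →
        |h (P e) - h (P c) - ∑ l, pderiv l h (P ξ) * (P e l - P c l)| ≤
          ∑ l, d * D l * C ^ (δ l) * C * (e - c) ^ (δ l * β + β) := by
      intro c ξ e h1 h2 h3 h4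
      have h0 : 0 ≤ e - c := by linarith
      obtain ⟨hc, he⟩ := hball c ξ e h1 h2 h3 h4
      have hsub := hR' c ξ e h1 h2 h3 h4
      have hr0 : 0 ≤ C * (e - c) ^ β := by positivity
      have hterm : ∀ l, 0 ≤ D l * (C * (e - c) ^ β) ^ (δ l) := fun l => by
        have := hD l
        positivity
      have := abs_sub_sub_sum_pderiv_le hdiff (w := P ξ)
        (η := ∑ l, D l * (C * (e - c) ^ β) ^ (δ l)) (Finset.sum_nonneg fun l _ => hterm l) hc he
        (fun v hv l => by
          refine (hDb l v (hsub hv) (P ξ) (hsub (Metric.mem_closedBall_self hr0))).trans ?_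
          refine le_trans ?_ (Finset.single_le_sum (f := fun l => D l * (C * (e - c) ^ β) ^ (δ l))
            (fun l _ => hterm l) (Finset.mem_univ l))
          have h5 := hD l
          have h6 := hδ l
          have h7 := mem_closedBall_iff_norm.1 hv
          gcongr)
      refine this.trans ?_
      have h6 := hPC c e h1 (h2.trans h3) h4
      calc d * (∑ l, D l * (C * (e - c) ^ β) ^ (δ l)) * ‖P e - P c‖
          ≤ d * (∑ l, D l * (C * (e - c) ^ β) ^ (δ l)) * (C * (e - c) ^ β) := by
            have := Finset.sum_nonneg fun l (_ : l ∈ Finset.univ) => hterm l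
            gcongr
        _ = ∑ l, d * D l * C ^ (δ l) * C * (e - c) ^ (δ l * β + β) := by
            rw [Finset.mul_sum, Finset.sum_mul]
            refine Finset.sum_congr rfl fun l _ => ?_
            have h8 := hδ l
            rw [Real.mul_rpow hC (by positivity), ← Real.rpow_mul h0,
              Real.rpow_add_of_nonneg h0 (by positivity) hβ.le, mul_comm β]
            ring
    have hneg : Negligible a b fun c _ e =>
        ∑ l, d * D l * C ^ (δ l) * C * (e - c) ^ (δ l * β + β) :=
      Negligible.sum _ fun l _ => Negligible.of_rpow_le (K := d * D l * C ^ (δ l) * C) (hδβ l)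
        fun c ξ e h1 h2 h3 h4 => by
          have h0 : 0 ≤ e - c := by linarith
          have := hD l
          rw [abs_of_nonneg (by positivity)]
    intro ε hε
    obtain ⟨δ', hδ', h'⟩ := hneg ε hε
    exact ⟨δ', hδ', fun c ξ e h1 h2 h3 h4 h5 =>
      (key c ξ e h1 h2 h3 h4).trans ((le_abs_self _).trans (h' c ξ e h1 h2 h3 h4 h5))⟩

/-! ### Smoothness of iterated derivatives -/

theorem ContDiff.pderiv {k : ℕ} {f : (Fin d → ℝ) → ℝ} (hf : ContDiff ℝ (k + 1 : ℕ) f) (l : Fin d) :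
    ContDiff ℝ (k : ℕ) (pderiv l f) := by
  unfold TaylorScheme.pderiv
  exact (hf.fderiv_right (m := (k : ℕ)) (by push_cast; exact le_rfl)).clm_apply contDiff_const

theorem ContDiff.pderivIter {k : ℕ} {f : (Fin d → ℝ) → ℝ} (ζ : List (Fin d))
    (hf : ContDiff ℝ (k + ζ.length : ℕ) f) : ContDiff ℝ (k : ℕ) (pderivIter ζ f) := by
  induction ζ generalizing k with
  | nil => simpa [TaylorScheme.pderivIter] using hf
  | cons l ζ ih =>
    refine ContDiff.pderiv (ih ?_) l
    rw [List.length_cons] at hf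
    convert hf using 2
    ring

/-! ### The averaged Jacobian -/

theorem sum_average_pderiv_mul_sub {h : (Fin d → ℝ) → ℝ} (hh : ContDiff ℝ 1 h)
    (ξ ξ' : Fin d → ℝ) :
    ∑ l, (∫ θ in (0 : ℝ)..1, pderiv l h (θ • ξ + (1 - θ) • ξ')) * (ξ l - ξ' l) = h ξ - h ξ' := by
  have hc : ∀ l, Continuous fun θ : ℝ => pderiv l h (θ • ξ + (1 - θ) • ξ') := fun l =>
    ((hh.continuous_fderiv one_ne_zero).comp (by fun_prop)).clm_apply continuous_const
  have hd : ∀ θ : ℝ, HasDerivAt (fun θ : ℝ => h (θ • ξ + (1 - θ) • ξ'))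
      (∑ l, pderiv l h (θ • ξ + (1 - θ) • ξ') * (ξ l - ξ' l)) θ := by
    intro θ
    have h1 : HasDerivAt (fun θ : ℝ => θ • ξ + (1 - θ) • ξ') (ξ - ξ') θ := by
      have := ((hasDerivAt_id θ).smul_const ξ).add
        (((hasDerivAt_const θ (1 : ℝ)).sub (hasDerivAt_id θ)).smul_const ξ')
      exact this.congr_deriv (by simp [sub_eq_add_neg])
    have h2 := ((hh.differentiable one_ne_zero _).hasFDerivAt).comp_hasDerivAt θ h1
    rw [fderiv_apply_eq_sum_pderiv] at h2
    exact h2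
  have := intervalIntegral.integral_eq_sub_of_hasDerivAt (a := 0) (b := 1) (fun θ _ => hd θ)
    (Continuous.intervalIntegrable (continuous_finsetSum _ fun l _ => (hc l).mul continuous_const)
      _ _)
  rw [intervalIntegral.integral_finsetSum fun l _ =>
    Continuous.intervalIntegrable (u := fun θ : ℝ => pderiv l h (θ • ξ + (1 - θ) • ξ')
      * (ξ l - ξ' l)) ((hc l).mul continuous_const) _ _] at this
  simp only [intervalIntegral.integral_mul_const] at this
  rw [this]
  simp

theorem isHolder_average {φ : (Fin d → ℝ) → ℝ} (hφ : ContDiff ℝ 1 φ) (hβ : 0 < β)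
    {P Q : ℝ → Fin d → ℝ} (hP : ∀ l, IsHolder β a b fun t => P t l)
    (hQ : ∀ l, IsHolder β a b fun t => Q t l) :
    IsHolder β a b fun t => ∫ θ in (0 : ℝ)..1, φ (θ • P t + (1 - θ) • Q t) := by
  obtain ⟨R, hR⟩ := exists_norm_bound_of_isHolder hβ hP
  obtain ⟨R', hR'⟩ := exists_norm_bound_of_isHolder hβ hQ
  obtain ⟨C, hC, hPC⟩ := exists_norm_sub_le_of_isHolder hP
  obtain ⟨C', hC', hQC⟩ := exists_norm_sub_le_of_isHolder hQ
  obtain ⟨D, hD, hφD⟩ := exists_lipschitz_bound_of_contDiff hφ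
    (isCompact_closedBall (0 : Fin d → ℝ) (max R R'))
  have hmem : ∀ t ∈ Set.Icc a b, ∀ θ ∈ Set.uIoc (0 : ℝ) 1,
      θ • P t + (1 - θ) • Q t ∈ Metric.closedBall (0 : Fin d → ℝ) (max R R') := by
    intro t ht θ hθ
    rw [Set.uIoc_of_le zero_le_one] at hθ
    exact (convex_closedBall (0 : Fin d → ℝ) (max R R'))
      (Metric.closedBall_subset_closedBall (le_max_left _ _) (hR t ht))
      (Metric.closedBall_subset_closedBall (le_max_right _ _) (hR' t ht)) hθ.1.le
      (by linarith [hθ.2]) (by ring)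
  refine ⟨D * (C + C'), by positivity, fun s t h1 h2 h3 => ?_⟩
  have hc : ∀ u, Continuous fun θ : ℝ => φ (θ • P u + (1 - θ) • Q u) := fun u =>
    hφ.continuous.comp (by fun_prop)
  rw [← intervalIntegral.integral_sub ((hc t).intervalIntegrable _ _)
    ((hc s).intervalIntegrable _ _)]
  have := intervalIntegral.norm_integral_le_of_norm_le_const (a := (0 : ℝ)) (b := 1)
    (C := D * (C + C') * (t - s) ^ β)
    (f := fun θ : ℝ => φ (θ • P t + (1 - θ) • Q t) - φ (θ • P s + (1 - θ) • Q s)) (by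
      intro θ hθ
      have e1 := hφD _ (hmem t ⟨h1.trans h2, h3⟩ θ hθ) _ (hmem s ⟨h1, h2.trans h3⟩ θ hθ)
      rw [Set.uIoc_of_le zero_le_one] at hθ
      have e2 : θ • P t + (1 - θ) • Q t - (θ • P s + (1 - θ) • Q s)
          = θ • (P t - P s) + (1 - θ) • (Q t - Q s) := by
        simp only [smul_sub]; abel
      have e3 : ‖θ • (P t - P s)‖ ≤ C * (t - s) ^ β := by
        rw [norm_smul, Real.norm_eq_abs, abs_of_pos hθ.1]
        exact (mul_le_of_le_one_left (norm_nonneg _) hθ.2).trans (hPC s t h1 h2 h3)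
      have e4 : ‖(1 - θ) • (Q t - Q s)‖ ≤ C' * (t - s) ^ β := by
        rw [norm_smul, Real.norm_eq_abs, abs_of_nonneg (by linarith [hθ.2])]
        exact (mul_le_of_le_one_left (norm_nonneg _) (by linarith [hθ.1])).trans
          (hQC s t h1 h2 h3)
      rw [Real.norm_eq_abs]
      refine e1.trans ?_
      rw [mul_assoc]
      refine mul_le_mul_of_nonneg_left ?_ hD
      rw [e2, add_mul]
      exact (norm_add_le _ _).trans (add_le_add e3 e4))
  simpa using this

end Functions

/-! ### Sums over words -/

section WordSum

variable {κ : Type*}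

/-- The sum of `φ` over the words of length `p` with letters in `K`. -/
def wordSum (K : Finset κ) (p : ℕ) (φ : List κ → ℝ) : ℝ :=
  ∑ α ∈ Fintype.piFinset fun _ : Fin p => K, φ (List.ofFn α)

theorem wordSum_zero (K : Finset κ) (φ : List κ → ℝ) : wordSum K 0 φ = φ [] := by
  simp [wordSum]

theorem wordSum_congr {K : Finset κ} {p : ℕ} {φ ψ : List κ → ℝ}
    (h : ∀ α, α.length = p → (∀ k ∈ α, k ∈ K) → φ α = ψ α) : wordSum K p φ = wordSum K p ψ := by
  refine Finset.sum_congr rfl fun α hα => h _ (by simp) fun k hk => ?_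
  obtain ⟨i, rfl⟩ := (List.mem_ofFn' _ _).1 hk
  exact Fintype.mem_piFinset.1 hα i

theorem wordSum_succ (K : Finset κ) (p : ℕ) (φ : List κ → ℝ) :
    wordSum K (p + 1) φ = ∑ k ∈ K, wordSum K p fun α => φ (k :: α) := by
  unfold wordSum
  rw [← Finset.sum_product']
  refine Finset.sum_nbij' (fun α => (α 0, Fin.tail α)) (fun q => Fin.cons q.1 q.2) ?_ ?_ ?_ ?_ ?_
  · intro α hα
    rw [Fintype.mem_piFinset] at hα
    exact Finset.mem_product.2 ⟨hα 0, Fintype.mem_piFinset.2 fun i => hα i.succ⟩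
  · rintro ⟨k, α⟩ h
    obtain ⟨h1, h2⟩ := Finset.mem_product.1 h
    rw [Fintype.mem_piFinset] at h2 ⊢
    exact fun i => Fin.cases h1 h2 i
  · intro α _; simp
  · rintro ⟨k, α⟩ _; simp
  · intro α _
    rw [List.ofFn_succ]; rfl

theorem wordSum_succ_last (K : Finset κ) (p : ℕ) (φ : List κ → ℝ) :
    wordSum K (p + 1) φ = ∑ k ∈ K, wordSum K p fun α => φ (α ++ [k]) := by
  induction p generalizing φ with
  | zero => simp [wordSum_succ, wordSum_zero]
  | succ p ih =>
    calc wordSum K (p + 1 + 1) φ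
        = ∑ k ∈ K, ∑ k' ∈ K, wordSum K p fun α => φ (k :: (α ++ [k'])) := by
          rw [wordSum_succ]
          exact Finset.sum_congr rfl fun k _ => ih _
      _ = ∑ k' ∈ K, wordSum K (p + 1) fun α => φ (α ++ [k']) := by
          rw [Finset.sum_comm]
          refine Finset.sum_congr rfl fun k _ => ?_
          rw [wordSum_succ]
          rfl

theorem wordSum_add (K : Finset κ) (p : ℕ) (φ ψ : List κ → ℝ) :
    (wordSum K p fun α => φ α + ψ α) = wordSum K p φ + wordSum K p ψ :=
  Finset.sum_add_distrib

theorem wordSum_finset_sum {ι : Type*} (s : Finset ι) (K : Finset κ) (p : ℕ)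
    (φ : ι → List κ → ℝ) :
    (wordSum K p fun α => ∑ i ∈ s, φ i α) = ∑ i ∈ s, wordSum K p (φ i) :=
  Finset.sum_comm

theorem wordSum_univ [Fintype κ] (p : ℕ) (φ : List κ → ℝ) :
    wordSum Finset.univ p φ = ∑ α : Fin p → κ, φ (List.ofFn α) := by
  rw [wordSum, Fintype.piFinset_univ]

theorem wordSum_product {κ' : Type*} (K : Finset κ) (K' : Finset κ') (p : ℕ)
    (φ : List (κ × κ') → ℝ) :
    wordSum (K ×ˢ K') p φ = ∑ ζ ∈ Fintype.piFinset fun _ : Fin p => K,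
      ∑ γ ∈ Fintype.piFinset fun _ : Fin p => K', φ (List.ofFn fun i => (ζ i, γ i)) := by
  unfold wordSum
  rw [← Finset.sum_product']
  refine Finset.sum_nbij' (fun α => (fun i => (α i).1, fun i => (α i).2))
    (fun q i => (q.1 i, q.2 i)) ?_ ?_ ?_ ?_ ?_
  · intro α hα
    simp only [Fintype.mem_piFinset, Finset.mem_product] at hα ⊢
    exact ⟨fun i => (hα i).1, fun i => (hα i).2⟩
  · intro q hq
    simp only [Fintype.mem_piFinset, Finset.mem_product] at hq ⊢
    exact fun i => ⟨hq.1 i, hq.2 i⟩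
  · intro α _; rfl
  · intro q _; rfl
  · intro α _; rfl

theorem sum_words {m : ℕ} (N : ℕ) (φ : List (Fin m) → ℝ) :
    ∑ γ ∈ words m N, φ γ = ∑ r ∈ Finset.range N, wordSum Finset.univ (r + 1) φ := by
  rw [words, Finset.sum_biUnion]
  · rw [Finset.range_eq_Ico, Finset.sum_Ico_add' (fun r => wordSum Finset.univ r φ) 0 N 1,
      zero_add, show Finset.Ico 1 (N + 1) = Finset.Icc 1 N from rfl]
    refine Finset.sum_congr rfl fun r _ => ?_
    rw [Finset.sum_image fun α _ β _ h => List.ofFn_injective h, wordSum_univ]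
  · intro r _ r' _ hne
    rw [Function.onFun, Finset.disjoint_left]
    rintro γ h h'
    obtain ⟨α, _, rfl⟩ := Finset.mem_image.1 h
    obtain ⟨α', _, h'⟩ := Finset.mem_image.1 h'
    have := congrArg List.length h'
    simp at this
    exact hne this.symm

theorem length_of_mem_words {m N : ℕ} {γ : List (Fin m)} (h : γ ∈ words m N) :
    1 ≤ γ.length ∧ γ.length ≤ N := by
  obtain ⟨r, hr, h⟩ := Finset.mem_biUnion.1 h
  obtain ⟨α, _, rfl⟩ := Finset.mem_image.1 h
  simpa using hr

end WordSum

/-! ### Multiple integrals -/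

section MultInt

variable {a b β : ℝ} {κ : Type*}

theorem rsInt_eq_sum {ι : Type*} (s : Finset ι) {c : ι → ℝ} {f : ι → ℝ → ℝ} {f' g : ℝ → ℝ}
    (hβ : 0 < β) (hf : ∀ i ∈ s, IsIntegrand β a b (f i)) (hg : IsHolder β a b g)
    (hff : ∀ t ∈ Set.Icc a b, f' t = ∑ i ∈ s, c i * f i t) {t : ℝ} (ht : t ∈ Set.Icc a b) :
    rsInt f' g a t = ∑ i ∈ s, c i * rsInt (f i) g a t := by
  have h : HasDifferential a b (fun t => ∑ i ∈ s, c i * rsInt (f i) g a t)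
      fun c ξ e => f' ξ * (g e - g c) :=
    (HasDifferential.sum s fun i hi =>
      ((hf i hi).hasDifferential_rsInt hβ hg).const_mul (c i)).congr fun c ξ e h1 h2 h3 h4 => by
        rw [hff ξ ⟨h1.trans h2, h3.trans h4⟩, Finset.sum_mul]
        exact Finset.sum_congr rfl fun i _ => by ring
  rw [h.rsInt_eq le_rfl ht.1 ht.2]
  simp [rsInt_self]

theorem rsInt_eq_sum_right {ι : Type*} (s : Finset ι) {c : ι → ℝ} {g : ι → ℝ → ℝ}
    {f g' : ℝ → ℝ} (hβ : 0 < β) (hf : IsIntegrand β a b f) (hg : ∀ i ∈ s, IsHolder β a b (g i))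
    (hgg : ∀ t ∈ Set.Icc a b, g' t = ∑ i ∈ s, c i * g i t) {t : ℝ} (ht : t ∈ Set.Icc a b) :
    rsInt f g' a t = ∑ i ∈ s, c i * rsInt f (g i) a t := by
  have h : HasDifferential a b (fun t => ∑ i ∈ s, c i * rsInt f (g i) a t)
      fun c ξ e => f ξ * (g' e - g' c) :=
    (HasDifferential.sum s fun i hi =>
      (hf.hasDifferential_rsInt hβ (hg i hi)).const_mul (c i)).congr fun c ξ e h1 h2 h3 h4 => by
        rw [hgg c ⟨h1, h2.trans (h3.trans h4)⟩, hgg e ⟨h1.trans (h2.trans h3), h4⟩,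
          ← Finset.sum_sub_distrib, Finset.mul_sum]
        exact Finset.sum_congr rfl fun i _ => by ring
  rw [h.rsInt_eq le_rfl ht.1 ht.2]
  simp [rsInt_self]

theorem multInt_cons (g : κ → ℝ → ℝ) (s : ℝ) (f : ℝ → ℝ) (k : κ) (α : List κ) :
    multInt g s f (k :: α) = multInt g s (fun t => rsInt f (g k) s t) α := rfl

theorem multInt_concat (g : κ → ℝ → ℝ) (s : ℝ) (f : ℝ → ℝ) (α : List κ) (k : κ) :
    multInt g s f (α ++ [k]) = fun t => rsInt (multInt g s f α) (g k) s t := by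
  simp [multInt, List.foldl_append]

theorem isHolder_multInt {g : κ → ℝ → ℝ} {f : ℝ → ℝ} (hβ : 1 / 2 < β) (hβ1 : β ≤ 1)
    (hg : ∀ k, IsHolder β a b (g k)) (hf : IsHolder β a b f) (α : List κ) :
    IsHolder β a b (multInt g a f α) := by
  induction α generalizing f with
  | nil => exact hf
  | cons k α ih =>
    exact ih ((hf.isIntegrand hβ).isHolder_rsInt (by linarith) hβ1 (hg k))

theorem isIntegrand_multInt {g : κ → ℝ → ℝ} {f : ℝ → ℝ} (hβ : 1 / 2 < β) (hβ1 : β ≤ 1)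
    (hg : ∀ k, IsHolder β a b (g k)) (hf : IsIntegrand β a b f) (α : List κ) :
    IsIntegrand β a b (multInt g a f α) := by
  cases α with
  | nil => exact hf
  | cons k α =>
    exact (isHolder_multInt hβ hβ1 hg (hf.isHolder_rsInt (by linarith) hβ1 (hg k)) α).isIntegrand hβ

/-- Multiple integrals are linear in the integrand. -/
theorem multInt_eq_sum {ι : Type*} (s : Finset ι) {c : ι → ℝ} {f : ι → ℝ → ℝ} {f' : ℝ → ℝ}
    {g : κ → ℝ → ℝ} (hβ : 1 / 2 < β) (hβ1 : β ≤ 1) (hg : ∀ k, IsHolder β a b (g k))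
    (hf : ∀ i ∈ s, IsIntegrand β a b (f i))
    (hff : ∀ t ∈ Set.Icc a b, f' t = ∑ i ∈ s, c i * f i t) (α : List κ) :
    ∀ t ∈ Set.Icc a b, multInt g a f' α t = ∑ i ∈ s, c i * multInt g a (f i) α t := by
  induction α generalizing f f' with
  | nil => exact hff
  | cons k α ih =>
    have hβ0 : 0 < β := by linarith
    exact ih (fun i hi => ((hf i hi).isHolder_rsInt hβ0 hβ1 (hg k)).isIntegrand hβ)
      fun t ht => rsInt_eq_sum s hβ0 hf (hg k) hff ht

/-- Multiple integrals are multilinear in the integrators: expansion of sums of integrators. -/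
theorem multInt_eq_sum_integrators {ι : Type*} (L : Finset κ) {g : ι → ℝ → ℝ}
    {G : ι × κ → ℝ → ℝ} (hβ : 1 / 2 < β) (hβ1 : β ≤ 1) (hG : ∀ k, IsHolder β a b (G k))
    (hg : ∀ i, ∀ t ∈ Set.Icc a b, g i t = ∑ k ∈ L, G (i, k) t) {f : ℝ → ℝ}
    (hf : IsIntegrand β a b f) {p : ℕ} (ζ : Fin p → ι) :
    ∀ t ∈ Set.Icc a b, multInt g a f (List.ofFn ζ) t =
      ∑ γ ∈ Fintype.piFinset fun _ : Fin p => L,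
        multInt G a f (List.ofFn fun i => (ζ i, γ i)) t := by
  have hβ0 : 0 < β := by linarith
  have hgH : ∀ i, IsHolder β a b (g i) := fun i =>
    (IsHolder.sum L fun k _ => hG (i, k)).congr fun t ht => (hg i t ht).symm
  induction p generalizing f with
  | zero =>
    intro t _
    simp [multInt]
  | succ p ih =>
    intro t ht
    have hh : ∀ t ∈ Set.Icc a b, rsInt f (g (ζ 0)) a t =
        ∑ k ∈ L, 1 * rsInt f (G (ζ 0, k)) a t := fun t ht =>
      rsInt_eq_sum_right L hβ0 hf (fun k _ => hG _) (fun t ht => by simp [hg _ t ht]) ht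
    have e := multInt_eq_sum L hβ hβ1 hgH
      (fun k _ => (hf.isHolder_rsInt hβ0 hβ1 (hG (ζ 0, k))).isIntegrand hβ) hh
      (List.ofFn fun i : Fin p => ζ i.succ) t ht
    rw [List.ofFn_succ, multInt_cons, e]
    have e2 : ∀ k ∈ L, 1 * multInt g a (fun t => rsInt f (G (ζ 0, k)) a t)
        (List.ofFn fun i : Fin p => ζ i.succ) t =
        ∑ γ ∈ Fintype.piFinset fun _ : Fin p => L, multInt G a f
          ((ζ 0, k) :: List.ofFn fun i : Fin p => (ζ i.succ, γ i)) t := fun k _ => by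
      rw [one_mul, ih (((hf.isHolder_rsInt hβ0 hβ1 (hG (ζ 0, k))).isIntegrand hβ))
        (fun i : Fin p => ζ i.succ) t ht]
      rfl
    rw [Finset.sum_congr rfl e2, ← Finset.sum_product']
    symm
    refine Finset.sum_nbij' (fun α => (α 0, Fin.tail α)) (fun q => Fin.cons q.1 q.2) ?_ ?_ ?_ ?_ ?_
    · intro α hα
      rw [Fintype.mem_piFinset] at hα
      exact Finset.mem_product.2 ⟨hα 0, Fintype.mem_piFinset.2 fun i => hα i.succ⟩
    · rintro ⟨k, α⟩ h
      obtain ⟨h1, h2⟩ := Finset.mem_product.1 h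
      rw [Fintype.mem_piFinset] at h2 ⊢
      exact fun i => Fin.cases h1 h2 i
    · intro α _; simp
    · rintro ⟨k, α⟩ _; simp
    · intro α _
      rw [List.ofFn_succ]; rfl

/-- Scalar factors of the integrators come out of a multiple integral. -/
theorem multInt_smul_integrators {g : κ → ℝ → ℝ} (c : κ → ℝ) (hβ : 1 / 2 < β) (hβ1 : β ≤ 1)
    (hg : ∀ k, IsHolder β a b (g k)) {f : ℝ → ℝ} (hf : IsIntegrand β a b f) (α : List κ) :
    ∀ t ∈ Set.Icc a b, multInt (fun k t => c k * g k t) a f α t =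
      (α.map c).prod * multInt g a f α t := by
  have hβ0 : 0 < β := by linarith
  induction α using List.reverseRecOn with
  | nil => intro t _; simp [multInt]
  | append_singleton α k ih =>
    intro t ht
    rw [multInt_concat, multInt_concat]
    have hi := isIntegrand_multInt hβ hβ1 hg hf α
    have hi' := isIntegrand_multInt hβ hβ1 (fun k => (hg k).const_mul hβ0 (c k)) hf α
    have e1 := rsInt_eq_sum_right (β := β) (Finset.univ : Finset Unit) (c := fun _ => c k)
      (g := fun _ => g k) (g' := fun t => c k * g k t) hβ0 hi' (fun _ _ => hg k)
      (fun t _ => by simp) ht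
    have e2 := rsInt_eq_sum (β := β) (Finset.univ : Finset Unit) (c := fun _ => (α.map c).prod)
      (f := fun _ => multInt g a f α) (f' := multInt (fun k t => c k * g k t) a f α) hβ0
      (fun _ _ => hi) (hg k) (fun t ht => by simp [ih t ht]) ht
    simp only [Finset.univ_unique, Finset.sum_const, Finset.card_singleton, one_smul] at e1 e2
    simp only [e1, e2]
    simp only [List.map_append, List.map_cons, List.map_nil, List.prod_append, List.prod_cons,
      List.prod_nil]
    ring

/-- Iterated expansion: if the paths `A α` satisfy `A α = c α + ∑ k, ∫ A (k :: α) dg_k`, then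
`A []` is the sum of its first `q` terms, which are multiple integrals of the integrators with
coefficients `c α`, and of a remainder. -/
theorem expand_multInt (K : Finset κ) {g : κ → ℝ → ℝ} (hβ : 1 / 2 < β)
    (hβ1 : β ≤ 1) (hg : ∀ k, IsHolder β a b (g k)) (A : List κ → ℝ → ℝ) (c : List κ → ℝ) (q : ℕ)
    (hA : ∀ α, α.length ≤ q → IsIntegrand β a b (A α))
    (h : ∀ α, α.length < q → (∀ k ∈ α, k ∈ K) → ∀ t ∈ Set.Icc a b,
      A α t = c α + ∑ k ∈ K, rsInt (A (k :: α)) (g k) a t) :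
    ∀ t ∈ Set.Icc a b, A [] t =
      ∑ p ∈ Finset.range q, (wordSum K p fun α => c α * multInt g a (fun _ => 1) α t)
        + wordSum K q fun α => multInt g a (A α) α t := by
  have hβ0 : 0 < β := by linarith
  induction q with
  | zero => intro t _; simp [wordSum_zero, multInt]
  | succ q ih =>
    intro t ht
    rw [ih (fun α hα => hA α (by omega)) (fun α hα => h α (by omega)) t ht,
      Finset.sum_range_succ, add_assoc]
    congr 1
    rw [wordSum_succ, ← wordSum_finset_sum, ← wordSum_add]
    refine wordSum_congr fun α hα hK => ?_
    have e := multInt_eq_sum (β := β) (Finset.insertNone K)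
      (c := fun o => o.elim (c α) fun _ => 1)
      (f := fun o => o.elim (fun _ => (1 : ℝ)) fun k t => rsInt (A (k :: α)) (g k) a t)
      (f' := A α) hβ hβ1 hg (fun o _ => ?_) (fun t ht => ?_) α t ht
    · rw [e, Finset.sum_insertNone]
      simp [multInt_cons]
    · rcases o with _ | k
      · exact (IsHolder.const 1).isIntegrand hβ
      · exact ((hA (k :: α) (by simp [hα])).isHolder_rsInt hβ0 hβ1 (hg k)).isIntegrand hβ
    · rw [h α (by omega) hK t ht, Finset.sum_insertNone]
      simp

end MultInt

/-! ### Iterated integrals over linear extensions -/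

section IterInt

variable {a b β : ℝ} {m : ℕ} {x : Fin m → ℝ → ℝ}

theorem iterInt_concat (a t : ℝ) (γ : List (Fin m)) (j : Fin m) :
    iterInt x a t (γ ++ [j]) = rsInt (fun u => iterInt x a u γ) (x j) a t := by
  simp only [iterInt, multInt_concat]

theorem isHolder_iterInt (hβ : 1 / 2 < β) (hβ1 : β ≤ 1) (hx : ∀ j, IsHolder β a b (x j))
    (γ : List (Fin m)) : IsHolder β a b fun t => iterInt x a t γ :=
  isHolder_multInt hβ hβ1 hx (IsHolder.const 1) γ

theorem iterInt_self (a : ℝ) {γ : List (Fin m)} (hγ : γ ≠ []) : iterInt x a a γ = 0 := by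
  obtain ⟨γ', j, rfl⟩ := List.eq_nil_or_concat γ |>.resolve_left hγ
  rw [List.concat_eq_append, iterInt_concat, rsInt_self]

theorem hasDifferential_iterInt_concat (hβ : 1 / 2 < β) (hβ1 : β ≤ 1)
    (hx : ∀ j, IsHolder β a b (x j)) (γ : List (Fin m)) (j : Fin m) :
    HasDifferential a b (fun t => iterInt x a t (γ ++ [j]))
      fun c ξ e => iterInt x a ξ γ * (x j e - x j c) := by
  simp only [iterInt_concat]
  exact ((isHolder_iterInt hβ hβ1 hx γ).isIntegrand hβ).hasDifferential_rsInt (by linarith) (hx j)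

end IterInt

section LinearExtensions

variable {α : Type*} [DecidableEq α]

open Classical in
/-- The elements of `S` without an `R`-successor in `S`. -/
noncomputable def maximals (R : α → α → Prop) (S : Finset α) : Finset α :=
  S.filter fun u => ∀ v ∈ S.erase u, ¬R u v

/-- The linear extensions of the relation `R` on a set `S` of `n` elements, as lists. The last
entry of a linear extension is a maximal element of `S`. -/
noncomputable def linExt (R : α → α → Prop) : ℕ → Finset α → Finset (List α)
  | 0, _ => {[]}
  | n + 1, S => (maximals R S).biUnion fun u => (linExt R n (S.erase u)).image (· ++ [u])

theorem mem_maximals {R : α → α → Prop} {S : Finset α} {u : α} :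
    u ∈ maximals R S ↔ u ∈ S ∧ ∀ v ∈ S, v ≠ u → ¬R u v := by
  simp only [maximals, Finset.mem_filter, Finset.mem_erase]
  exact ⟨fun h => ⟨h.1, fun v hv hne => h.2 v ⟨hne, hv⟩⟩,
    fun h => ⟨h.1, fun v hv => h.2 v hv.2 hv.1⟩⟩

theorem mem_linExt {R : α → α → Prop} {n : ℕ} {S : Finset α} (hS : S.card = n) {l : List α} :
    l ∈ linExt R n S ↔ l.Nodup ∧ (∀ u, u ∈ l ↔ u ∈ S) ∧ l.Pairwise fun u v => ¬R v u := by
  induction n generalizing S l with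
  | zero =>
    rw [Finset.card_eq_zero] at hS
    subst hS
    simp only [linExt, Finset.mem_singleton]
    constructor
    · rintro rfl; simp
    · rintro ⟨_, h, _⟩
      exact List.eq_nil_iff_forall_not_mem.2 fun u hu => by simpa using (h u).1 hu
  | succ n ih =>
    simp only [linExt, Finset.mem_biUnion, Finset.mem_image, mem_maximals]
    constructor
    · rintro ⟨u, ⟨huS, hu⟩, l', hl', rfl⟩
      obtain ⟨h1, h2, h3⟩ := (ih (by rw [Finset.card_erase_of_mem huS, hS]; rfl)).1 hl'
      refine ⟨?_, fun v => ?_, ?_⟩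
      · rw [List.nodup_append]
        refine ⟨h1, by simp, fun v hv w hw => ?_⟩
        rw [List.mem_singleton.1 hw]
        exact Finset.ne_of_mem_erase ((h2 v).1 hv)
      · rw [List.mem_append, h2, Finset.mem_erase, List.mem_singleton]
        by_cases hvu : v = u
        · simp [hvu, huS]
        · simp [hvu]
      · rw [List.pairwise_append]
        refine ⟨h3, by simp, fun v hv w hw => ?_⟩
        rw [List.mem_singleton.1 hw]
        have := (h2 v).1 hv
        exact hu v (Finset.mem_of_mem_erase this) (Finset.ne_of_mem_erase this)
    · rintro ⟨h1, h2, h3⟩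
      have hne : l ≠ [] := by
        rintro rfl
        obtain ⟨u, hu⟩ := Finset.card_pos.1 (by omega : 0 < S.card)
        simpa using (h2 u).2 hu
      obtain ⟨l', u, rfl⟩ := List.eq_nil_or_concat l |>.resolve_left hne
      simp only [List.concat_eq_append] at h1 h2 h3 ⊢
      rw [List.nodup_append] at h1
      rw [List.pairwise_append] at h3
      have huS : u ∈ S := (h2 u).1 (by simp)
      have hul : u ∉ l' := fun h => h1.2.2 u h u (by simp) rfl
      refine ⟨u, ⟨huS, fun v hv hvu => ?_⟩, l', ?_, rfl⟩
      · have := (h2 v).2 hv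
        rw [List.mem_append, List.mem_singleton] at this
        exact h3.2.2 v (this.resolve_right hvu) u (by simp)
      · refine (ih (by rw [Finset.card_erase_of_mem huS, hS]; rfl)).2 ⟨h1.1, fun v => ?_, h3.1⟩
        rw [Finset.mem_erase, ← h2 v, List.mem_append, List.mem_singleton]
        constructor
        · intro hv
          exact ⟨fun h => hul (h ▸ hv), Or.inl hv⟩
        · rintro ⟨h, h' | h'⟩
          · exact h'
          · exact absurd h' h

variable {a b β : ℝ} {m : ℕ} (x : Fin m → ℝ → ℝ) (a) (R : α → α → Prop) (lab : α → Fin m)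

/-- The sum of the iterated integrals over the linear extensions of `R` on `S`, i.e. the integral
of `∏ u ∈ S, dx^{lab u}` over the order polytope. -/
noncomputable def linExtInt (S : Finset α) (t : ℝ) : ℝ :=
  ∑ l ∈ linExt R S.card S, iterInt x a t (l.map lab)

variable {x a R lab}

theorem linExtInt_empty (t : ℝ) : linExtInt x a R lab ∅ t = 1 := by
  simp [linExtInt, linExt, iterInt, multInt]

theorem linExtInt_eq_sum (S : Finset α) (hS : S.Nonempty) (t : ℝ) :
    linExtInt x a R lab S t = ∑ u ∈ maximals R S,
      ∑ l ∈ linExt R (S.erase u).card (S.erase u), iterInt x a t (l.map lab ++ [lab u]) := by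
  obtain ⟨n, hn⟩ := Nat.exists_eq_succ_of_ne_zero (Finset.card_pos.2 hS).ne'
  rw [linExtInt, hn, linExt, Finset.sum_biUnion]
  · refine Finset.sum_congr rfl fun u hu => ?_
    rw [Finset.sum_image fun l _ l' _ h => List.append_cancel_right h,
      Finset.card_erase_of_mem (mem_maximals.1 hu).1, hn]
    simp
  · intro u _ v _ hne
    rw [Function.onFun, Finset.disjoint_left]
    intro l h h'
    obtain ⟨l1, _, rfl⟩ := Finset.mem_image.1 h
    obtain ⟨l2, _, h'⟩ := Finset.mem_image.1 h'
    have := List.append_inj_right' h' rfl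
    exact hne (by simpa using this.symm)

theorem linExtInt_self (S : Finset α) (hS : S.Nonempty) : linExtInt x a R lab S a = 0 := by
  rw [linExtInt_eq_sum S hS]
  exact Finset.sum_eq_zero fun u _ => Finset.sum_eq_zero fun l _ => iterInt_self a (by simp)

variable (R lab) in
theorem isHolder_linExtInt (hβ : 1 / 2 < β) (hβ1 : β ≤ 1) (hx : ∀ j, IsHolder β a b (x j))
    (S : Finset α) : IsHolder β a b (linExtInt x a R lab S) :=
  IsHolder.sum _ fun l _ => isHolder_iterInt hβ hβ1 hx (l.map lab)

/-- The fundamental recursion: the last element of a linear extension is a maximal element. -/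
theorem hasDifferential_linExtInt (hβ : 1 / 2 < β) (hβ1 : β ≤ 1)
    (hx : ∀ j, IsHolder β a b (x j)) (S : Finset α) (hS : S.Nonempty) :
    HasDifferential a b (linExtInt x a R lab S) fun c ξ e => ∑ u ∈ maximals R S,
      linExtInt x a R lab (S.erase u) ξ * (x (lab u) e - x (lab u) c) := by
  have h := HasDifferential.sum (maximals R S) fun u _ =>
    HasDifferential.sum (linExt R (S.erase u).card (S.erase u)) fun l _ =>
      hasDifferential_iterInt_concat hβ hβ1 hx (l.map lab) (lab u)
  refine (h.congr_fun fun t _ => (linExtInt_eq_sum S hS t).symm).congr fun c ξ e _ _ _ _ => ?_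
  simp only [linExtInt, Finset.sum_mul]

/-- For unrelated sets of letters the integrals multiply: by the product rule and induction both
sides have the same differential, since the maximal elements of the union are those of the two
sets. -/
theorem linExtInt_union (hβ : 1 / 2 < β) (hβ1 : β ≤ 1) (hx : ∀ j, IsHolder β a b (x j))
    (S₁ S₂ : Finset α) (hd : Disjoint S₁ S₂) (hR : ∀ u ∈ S₁, ∀ v ∈ S₂, ¬R u v ∧ ¬R v u) :
    ∀ t ∈ Set.Icc a b, linExtInt x a R lab (S₁ ∪ S₂) t =
      linExtInt x a R lab S₁ t * linExtInt x a R lab S₂ t := by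
  have key : ∀ n : ℕ, ∀ S₁ S₂ : Finset α, S₁.card + S₂.card = n → Disjoint S₁ S₂ →
      (∀ u ∈ S₁, ∀ v ∈ S₂, ¬R u v ∧ ¬R v u) → ∀ t ∈ Set.Icc a b,
      linExtInt x a R lab (S₁ ∪ S₂) t =
        linExtInt x a R lab S₁ t * linExtInt x a R lab S₂ t := by
    intro n
    induction n with
    | zero =>
      intro S₁ S₂ hn _ _ t _
      have h1 : S₁ = ∅ := Finset.card_eq_zero.1 (by omega)
      have h2 : S₂ = ∅ := Finset.card_eq_zero.1 (by omega)
      subst h1; subst h2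
      simp [linExtInt_empty]
    | succ n ih =>
      intro S₁ S₂ hn hd hR t ht
      rcases S₁.eq_empty_or_nonempty with rfl | hS₁
      · simp [linExtInt_empty]
      rcases S₂.eq_empty_or_nonempty with rfl | hS₂
      · simp [linExtInt_empty]
      have hmax : maximals R (S₁ ∪ S₂) = maximals R S₁ ∪ maximals R S₂ := by
        ext u
        simp only [Finset.mem_union, mem_maximals]
        constructor
        · rintro ⟨h | h, h'⟩
          · exact Or.inl ⟨h, fun v hv => h' v (Or.inl hv)⟩
          · exact Or.inr ⟨h, fun v hv => h' v (Or.inr hv)⟩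
        · rintro (⟨h, h'⟩ | ⟨h, h'⟩)
          · refine ⟨Or.inl h, ?_⟩
            rintro v (hv | hv) hne
            · exact h' v hv hne
            · exact (hR u h v hv).1
          · refine ⟨Or.inr h, ?_⟩
            rintro v (hv | hv) hne
            · exact (hR v hv u h).2
            · exact h' v hv hne
      have hdm : Disjoint (maximals R S₁) (maximals R S₂) :=
        hd.mono (fun u hu => (mem_maximals.1 hu).1) fun u hu => (mem_maximals.1 hu).1
      have e1 : ∀ u ∈ maximals R S₁, ∀ t ∈ Set.Icc a b,
          linExtInt x a R lab ((S₁ ∪ S₂).erase u) t =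
            linExtInt x a R lab (S₁.erase u) t * linExtInt x a R lab S₂ t := by
        intro u hu t ht
        have huS := (mem_maximals.1 hu).1
        have : u ∉ S₂ := Finset.disjoint_left.1 hd huS
        rw [Finset.erase_union_distrib, Finset.erase_eq_of_notMem this]
        refine ih _ _ ?_ (hd.mono_left (Finset.erase_subset _ _)) (fun v hv w hw =>
          hR v (Finset.mem_of_mem_erase hv) w hw) t ht
        have := Finset.card_erase_add_one huS
        omega
      have e2 : ∀ u ∈ maximals R S₂, ∀ t ∈ Set.Icc a b,
          linExtInt x a R lab ((S₁ ∪ S₂).erase u) t =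
            linExtInt x a R lab S₁ t * linExtInt x a R lab (S₂.erase u) t := by
        intro u hu t ht
        have huS := (mem_maximals.1 hu).1
        have : u ∉ S₁ := Finset.disjoint_right.1 hd huS
        rw [Finset.erase_union_distrib, Finset.erase_eq_of_notMem this]
        refine ih _ _ ?_ (hd.mono_right (Finset.erase_subset _ _)) (fun v hv w hw =>
          hR v hv w (Finset.mem_of_mem_erase hw)) t ht
        have := Finset.card_erase_add_one huS
        omega
      have hL := hasDifferential_linExtInt (lab := lab) (R := R) hβ hβ1 hx (S₁ ∪ S₂)
        (hS₁.mono Finset.subset_union_left)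
      have hP := (hasDifferential_linExtInt (lab := lab) (R := R) hβ hβ1 hx S₁ hS₁).mul hβ
        (hasDifferential_linExtInt (lab := lab) (R := R) hβ hβ1 hx S₂ hS₂)
        (isHolder_linExtInt R lab hβ hβ1 hx S₁) (isHolder_linExtInt R lab hβ hβ1 hx S₂)
      have hL' := hL.congr (η := fun c ξ e => linExtInt x a R lab S₁ ξ *
          ∑ u ∈ maximals R S₂, linExtInt x a R lab (S₂.erase u) ξ * (x (lab u) e - x (lab u) c)
          + linExtInt x a R lab S₂ ξ *
          ∑ u ∈ maximals R S₁, linExtInt x a R lab (S₁.erase u) ξ * (x (lab u) e - x (lab u) c))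
        fun c ξ e h1 h2 h3 h4 => by
          have hξ : ξ ∈ Set.Icc a b := ⟨h1.trans h2, h3.trans h4⟩
          rw [hmax, Finset.sum_union hdm, add_comm, Finset.mul_sum, Finset.mul_sum]
          congr 1
          · exact Finset.sum_congr rfl fun u hu => by rw [e2 u hu ξ hξ]; ring
          · exact Finset.sum_congr rfl fun u hu => by rw [e1 u hu ξ hξ]; ring
      have := hL'.sub_eq_sub hP ht
      rw [linExtInt_self _ (hS₁.mono Finset.subset_union_left), linExtInt_self _ hS₁] at this
      linarith
  exact key _ S₁ S₂ rfl hd hR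

theorem hasDifferential_linExtInt_of_maximals_eq (hβ : 1 / 2 < β) (hβ1 : β ≤ 1)
    (hx : ∀ j, IsHolder β a b (x j)) (S : Finset α) {u : α} (hu : maximals R S = {u}) :
    HasDifferential a b (linExtInt x a R lab S) fun c ξ e =>
      linExtInt x a R lab (S.erase u) ξ * (x (lab u) e - x (lab u) c) := by
  have hS : S.Nonempty := ⟨u, (mem_maximals.1 (hu ▸ Finset.mem_singleton_self u)).1⟩
  refine (hasDifferential_linExtInt hβ hβ1 hx S hS).congr fun c ξ e _ _ _ _ => ?_
  rw [hu, Finset.sum_singleton]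

end LinearExtensions

/-! ### Iterated integrals of iterated integrals -/

section Shuffle

/-- The order relation that the permutations in `Xi r p τ` respect: `u` and `v` are either the last
elements of an earlier and of a later block, or in increasing order in the same block. -/
def blockRel (r p : ℕ) (τ : ℕ → ℕ) (u v : Fin r) : Prop :=
  (∃ i j : ℕ, i < j ∧ j < p ∧ (u : ℕ) + 1 = τ (i + 1) ∧ (v : ℕ) + 1 = τ (j + 1)) ∨
  (∃ i < p, τ i ≤ u ∧ u < v ∧ (v : ℕ) < τ (i + 1))

theorem mem_Xi {r p : ℕ} {τ : ℕ → ℕ} {ρ : Equiv.Perm (Fin r)} :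
    ρ ∈ Xi r p τ ↔ ∀ u v, blockRel r p τ u v → ρ u < ρ v := by
  simp only [Xi, Finset.mem_filter, Finset.mem_univ, true_and, blockRel]
  constructor
  · rintro ⟨h1, h2⟩ u v (⟨i, j, hij, hj, hu, hv⟩ | ⟨i, hi, hu, huv, hv⟩)
    · exact h1 i j hij hj u v hu hv
    · exact h2 i hi u v hu huv hv
  · intro h
    exact ⟨fun i j hij hj u v hu hv => h u v (Or.inl ⟨i, j, hij, hj, hu, hv⟩),
      fun i hi u v hu huv hv => h u v (Or.inr ⟨i, hi, hu, huv, hv⟩)⟩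

theorem blockRel.lt {r p : ℕ} {τ : ℕ → ℕ} (hτ : ∀ i j, i < j → j ≤ p → τ i < τ j) {u v : Fin r}
    (h : blockRel r p τ u v) : u < v := by
  rcases h with ⟨i, j, hij, hj, hu, hv⟩ | ⟨i, hi, hu, huv, hv⟩
  · have := hτ (i + 1) (j + 1) (by omega) (by omega)
    exact Fin.lt_def.2 (by omega)
  · exact huv

variable {a b β : ℝ} {m : ℕ} {x : Fin m → ℝ → ℝ}

/-- The permutations in `Xi` are the linear extensions of the block relation. -/
theorem sum_Xi_eq_linExtInt {r p : ℕ} {τ : ℕ → ℕ} (hτ : ∀ i j, i < j → j ≤ p → τ i < τ j)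
    (lab : Fin r → Fin m) (t : ℝ) :
    ∑ ρ ∈ Xi r p τ, iterInt x a t (List.ofFn fun k => lab (ρ.symm k)) =
      linExtInt x a (blockRel r p τ) lab Finset.univ t := by
  rw [linExtInt]
  refine Finset.sum_bij (fun ρ _ => List.ofFn fun k => ρ.symm k) ?_ ?_ ?_ ?_
  · intro ρ hρ
    rw [mem_Xi] at hρ
    refine (mem_linExt rfl).2 ⟨List.nodup_ofFn.2 ρ.symm.injective, fun u => ?_, ?_⟩
    · simp only [Finset.mem_univ, iff_true, List.mem_ofFn']
      exact ρ.symm.surjective u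
    · rw [List.pairwise_ofFn]
      intro i j hij h
      have := hρ _ _ h
      rw [ρ.apply_symm_apply, ρ.apply_symm_apply] at this
      exact absurd hij this.not_gt
  · intro ρ _ ρ' _ h
    have h' := List.ofFn_injective h
    have : ρ.symm = ρ'.symm := Equiv.ext fun k => congrFun h' k
    simpa using congrArg Equiv.symm this
  · intro l hl
    obtain ⟨h1, h2, h3⟩ := (mem_linExt rfl).1 hl
    have hlen : l.length = r := by
      have : l.toFinset = Finset.univ := by ext u; simpa using (h2 u).2 (Finset.mem_univ u)
      rw [← List.toFinset_card_of_nodup h1, this, Finset.card_univ, Fintype.card_fin]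
    have hinj : Function.Injective fun k : Fin r => l.get (k.cast hlen.symm) := fun i j h => by
      have := (List.nodup_iff_injective_get.1 h1) h
      simpa using this
    let σ : Equiv.Perm (Fin r) := Equiv.ofBijective _ (Finite.injective_iff_bijective.1 hinj)
    have hσ : (List.ofFn fun k => σ k) = l := by
      refine List.ext_get (by simp [hlen]) fun n h h' => ?_
      simp [σ]
    refine ⟨σ.symm, ?_, by simpa using hσ⟩
    rw [mem_Xi]
    intro u v huv
    by_contra hcon
    have hne : u ≠ v := (huv.lt hτ).ne
    have hlt : σ.symm v < σ.symm u :=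
      lt_of_le_of_ne (not_lt.1 hcon) fun h => hne (σ.symm.injective h.symm)
    rw [← hσ, List.pairwise_ofFn] at h3
    have := h3 hlt
    rw [σ.apply_symm_apply, σ.apply_symm_apply] at this
    exact this huv
  · intro ρ _
    rw [List.map_ofFn]
    rfl

theorem blockEnd_succ (γ : List (List (Fin m))) {i : ℕ} (hi : i < γ.length) :
    blockEnd γ (i + 1) = blockEnd γ i + γ[i].length := by
  rw [blockEnd, blockEnd, List.take_succ_eq_append_getElem hi, List.map_append, List.sum_append]
  simp

theorem blockEnd_lt {γ : List (List (Fin m))} (hγ : ∀ w ∈ γ, w ≠ []) :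
    ∀ i j, i < j → j ≤ γ.length → blockEnd γ i < blockEnd γ j := by
  intro i j hij
  induction j with
  | zero => omega
  | succ j ih =>
    intro hj
    have h1 := blockEnd_succ γ (show j < γ.length by omega)
    have h2 := List.length_pos_of_ne_nil (hγ γ[j] (List.getElem_mem _))
    rcases Nat.lt_succ_iff_lt_or_eq.1 hij with h | rfl
    · have := ih h (by omega); omega
    · omega

theorem blockEnd_length (γ : List (List (Fin m))) : blockEnd γ γ.length = γ.flatten.length := by
  simp [blockEnd]

theorem blockEnd_le (γ : List (List (Fin m))) {i : ℕ} (hi : i ≤ γ.length) :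
    blockEnd γ i ≤ γ.flatten.length := by
  rw [← blockEnd_length]
  obtain ⟨k, hk⟩ := Nat.exists_eq_add_of_le hi
  rw [hk]
  clear hi hk
  induction k with
  | zero => rfl
  | succ k ih =>
    refine ih.trans ?_
    rw [← add_assoc]
    rcases lt_or_ge (i + k) γ.length with h | h
    · rw [blockEnd_succ γ h]; omega
    · simp [blockEnd, List.take_of_length_le h, List.take_of_length_le (h.trans (Nat.le_succ _))]

theorem flatten_getElem (γ : List (List (Fin m))) {i k : ℕ} (hi : i < γ.length)
    (hk : k < γ[i].length) (h : blockEnd γ i + k < γ.flatten.length) :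
    γ.flatten[blockEnd γ i + k] = γ[i][k] := by
  have h1 := List.drop_take_succ_flatten_eq_getElem γ i hi
  rw [← List.map_take, ← List.map_take] at h1
  change (γ.flatten.take (blockEnd γ (i + 1))).drop (blockEnd γ i) = γ[i] at h1
  simp only [← h1, List.getElem_drop, List.getElem_take]

theorem exists_block {γ : List (List (Fin m))} {q k : ℕ} (hk : k < blockEnd γ q) :
    ∃ i < q, blockEnd γ i ≤ k ∧ k < blockEnd γ (i + 1) := by
  induction q with
  | zero => simp [blockEnd] at hk
  | succ q ih =>
    by_cases h : k < blockEnd γ q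
    · obtain ⟨i, hi, h⟩ := ih h
      exact ⟨i, by omega, h⟩
    · exact ⟨q, by omega, by omega, hk⟩

/-- Within a block the letters are totally ordered. -/
theorem linExtInt_block (hβ : 1 / 2 < β) (hβ1 : β ≤ 1) (hx : ∀ j, IsHolder β a b (x j))
    {γ : List (List (Fin m))} (hγ : ∀ w ∈ γ, w ≠ []) {q : ℕ} (hq : q < γ.length) (k : ℕ)
    (hk : k ≤ γ[q].length) : ∀ t ∈ Set.Icc a b,
    linExtInt x a (blockRel γ.flatten.length γ.length (blockEnd γ)) γ.flatten.get
      (Finset.univ.filter fun u => blockEnd γ q ≤ u ∧ (u : ℕ) < blockEnd γ q + k) t =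
      iterInt x a t (γ[q].take k) := by
  have hτ := blockEnd_lt hγ
  induction k with
  | zero =>
    intro t _
    have : (Finset.univ.filter fun u : Fin γ.flatten.length =>
        blockEnd γ q ≤ u ∧ (u : ℕ) < blockEnd γ q + 0) = ∅ := by
      ext u; simp
    rw [this, linExtInt_empty]; simp [iterInt, multInt]
  | succ k ih =>
    intro t ht
    have hb := blockEnd_succ γ hq
    have hle := blockEnd_le γ (show q + 1 ≤ γ.length from hq)
    set S := Finset.univ.filter fun u : Fin γ.flatten.length =>
      blockEnd γ q ≤ u ∧ (u : ℕ) < blockEnd γ q + (k + 1) with hS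
    let top : Fin γ.flatten.length := ⟨blockEnd γ q + k, by omega⟩
    have htop : top ∈ S := by simp [hS, top]
    have hmax : maximals (blockRel γ.flatten.length γ.length (blockEnd γ)) S = {top} := by
      ext u
      rw [mem_maximals, Finset.mem_singleton]
      constructor
      · rintro ⟨hu, h⟩
        by_contra hne
        simp only [hS, Finset.mem_filter, Finset.mem_univ, true_and] at hu
        have hne' : (u : ℕ) ≠ blockEnd γ q + k := fun h => hne (Fin.ext h)
        refine h top htop (Ne.symm hne) (Or.inr ⟨q, hq, hu.1, ?_, ?_⟩)
        · exact Fin.lt_def.2 (show (u : ℕ) < blockEnd γ q + k by omega)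
        · change blockEnd γ q + k < _; omega
      · rintro rfl
        refine ⟨htop, fun v hv _ h => ?_⟩
        have h1 : blockEnd γ q + k < (v : ℕ) := Fin.lt_def.1 (h.lt hτ)
        simp only [hS, Finset.mem_filter, Finset.mem_univ, true_and] at hv
        omega
    have herase : S.erase top = Finset.univ.filter fun u : Fin γ.flatten.length =>
        blockEnd γ q ≤ u ∧ (u : ℕ) < blockEnd γ q + k := by
      ext u
      simp only [hS, Finset.mem_erase, Finset.mem_filter, Finset.mem_univ, true_and, ne_eq,
        Fin.ext_iff, top]
      omega
    have h1 := hasDifferential_linExtInt_of_maximals_eq (lab := γ.flatten.get) hβ hβ1 hx S hmax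
    rw [herase] at h1
    have hlab : γ.flatten.get top = γ[q][k] :=
      flatten_getElem γ hq (by omega) _
    have h2 := hasDifferential_iterInt_concat hβ hβ1 hx (γ[q].take k) γ[q][k]
    rw [← List.take_succ_eq_append_getElem (show k < γ[q].length by omega)] at h2
    have h1' := h1.congr (η := fun c ξ e => iterInt x a ξ (γ[q].take k)
        * (x γ[q][k] e - x γ[q][k] c)) fun c ξ e g1 g2 g3 g4 => by
      rw [ih (by omega) ξ ⟨g1.trans g2, g3.trans g4⟩, hlab]
    have h3 := h1'.sub_eq_sub h2 ht
    rw [linExtInt_self _ ⟨top, htop⟩, iterInt_self _ (by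
      rw [List.take_succ_eq_append_getElem (show k < γ[q].length by omega)]
      exact List.concat_ne_nil _ _)] at h3
    linarith

/-- The multiple integrals of iterated integrals are shuffle sums of iterated integrals. The last
letter of the last block follows all other letters; once it is removed, the rest of this block is
unrelated to the earlier blocks, so that the integral splits into a product. -/
theorem multInt_iterInt_eq_linExtInt (hβ : 1 / 2 < β) (hβ1 : β ≤ 1)
    (hx : ∀ j, IsHolder β a b (x j)) {γ : List (List (Fin m))} (hγ : ∀ w ∈ γ, w ≠ []) (q : ℕ)
    (hq : q ≤ γ.length) : ∀ t ∈ Set.Icc a b,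
    linExtInt x a (blockRel γ.flatten.length γ.length (blockEnd γ)) γ.flatten.get
      (Finset.univ.filter fun u => (u : ℕ) < blockEnd γ q) t =
      multInt (fun w t => iterInt x a t w) a (fun _ => 1) (γ.take q) t := by
  have hτ := blockEnd_lt hγ
  have hβ0 : 0 < β := by linarith
  induction q with
  | zero =>
    intro t _
    have : (Finset.univ.filter fun u : Fin γ.flatten.length => (u : ℕ) < blockEnd γ 0) = ∅ := by
      ext u; simp [blockEnd]
    rw [this, linExtInt_empty]; simp [multInt]
  | succ q ih =>
    intro t ht
    have hq' : q < γ.length := hq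
    have hb := blockEnd_succ γ hq'
    have hle := blockEnd_le γ hq
    have hpos := List.length_pos_of_ne_nil (hγ γ[q] (List.getElem_mem _))
    obtain ⟨k, hk⟩ := Nat.exists_eq_succ_of_ne_zero hpos.ne'
    set R := blockRel γ.flatten.length γ.length (blockEnd γ) with hR
    set S := Finset.univ.filter fun u : Fin γ.flatten.length => (u : ℕ) < blockEnd γ (q + 1) with hS
    set S₁ := Finset.univ.filter fun u : Fin γ.flatten.length => (u : ℕ) < blockEnd γ q with hS₁
    set S₂ := Finset.univ.filter fun u : Fin γ.flatten.length =>
      blockEnd γ q ≤ u ∧ (u : ℕ) < blockEnd γ q + k with hS₂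
    let top : Fin γ.flatten.length := ⟨blockEnd γ q + k, by omega⟩
    have htop : top ∈ S := by
      simp only [hS, top, Finset.mem_filter, Finset.mem_univ, true_and]; omega
    -- the last letter of the last block is the only maximal element
    have hmax : maximals R S = {top} := by
      ext u
      rw [mem_maximals, Finset.mem_singleton]
      constructor
      · rintro ⟨hu, h⟩
        by_contra hne
        simp only [hS, Finset.mem_filter, Finset.mem_univ, true_and] at hu
        have hne' : (u : ℕ) ≠ blockEnd γ q + k := fun h => hne (Fin.ext h)
        obtain ⟨i, hi, hi1, hi2⟩ := exists_block hu
        by_cases hlast : (u : ℕ) + 1 = blockEnd γ (i + 1)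
        · have hiq : i < q := by
            rcases Nat.lt_succ_iff_lt_or_eq.1 hi with h | rfl
            · exact h
            · omega
          refine h top htop (Ne.symm hne) (Or.inl ⟨i, q, hiq, hq', hlast, ?_⟩)
          change blockEnd γ q + k + 1 = _; omega
        · have hle' : blockEnd γ (i + 1) ≤ blockEnd γ (q + 1) := by
            rcases Nat.lt_succ_iff_lt_or_eq.1 hi with h | rfl
            · exact (hτ _ _ (by omega) hq).le
            · exact le_rfl
          refine h ⟨u + 1, by omega⟩ ?_ ?_ (Or.inr ⟨i, by omega, hi1, ?_, ?_⟩)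
          · simp only [hS, Finset.mem_filter, Finset.mem_univ, true_and]; omega
          · rw [ne_eq, Fin.ext_iff]; simp
          · exact Fin.lt_def.2 (Nat.lt_succ_self _)
          · change (u : ℕ) + 1 < _; omega
      · rintro rfl
        refine ⟨htop, fun v hv _ h => ?_⟩
        have h1 : blockEnd γ q + k < (v : ℕ) := Fin.lt_def.1 (h.lt hτ)
        simp only [hS, Finset.mem_filter, Finset.mem_univ, true_and] at hv
        omega
    have herase : S.erase top = S₁ ∪ S₂ := by
      ext u
      simp only [hS, hS₁, hS₂, Finset.mem_erase, Finset.mem_filter, Finset.mem_univ, true_and,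
        ne_eq, Fin.ext_iff, top, Finset.mem_union]
      omega
    have hdisj : Disjoint S₁ S₂ := by
      rw [Finset.disjoint_left]
      intro u h h'
      simp only [hS₁, hS₂, Finset.mem_filter, Finset.mem_univ, true_and] at h h'
      omega
    have hunrel : ∀ u ∈ S₁, ∀ v ∈ S₂, ¬R u v ∧ ¬R v u := by
      intro u hu v hv
      simp only [hS₁, hS₂, Finset.mem_filter, Finset.mem_univ, true_and] at hu hv
      refine ⟨?_, fun h => ?_⟩
      · rintro (⟨i, j, hij, hj, hu', hv'⟩ | ⟨i, hi, hu', huv, hv'⟩)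
        · rcases lt_trichotomy j q with h | rfl | h
          · rcases Nat.lt_succ_iff_lt_or_eq.1 (Nat.succ_lt_succ h) with h | h
            · have := hτ (j + 1) q h (by omega); omega
            · rw [show j + 1 = q from h] at hv'; omega
          · omega
          · have := hτ (q + 1) (j + 1) (by omega) (by omega); omega
        · have hiq : i < q := by
            by_contra hcon
            rcases Nat.lt_or_ge q i with h | h
            · have := hτ q i h (by omega); omega
            · have : i = q := by omega
              subst this; omega
          rcases Nat.lt_succ_iff_lt_or_eq.1 (Nat.succ_lt_succ hiq) with h | h
          · have := hτ (i + 1) q h (by omega); omega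
          · rw [show i + 1 = q from h] at hv'; omega
      · have := Fin.lt_def.1 (h.lt hτ)
        omega
    have hlab : γ.flatten.get top = γ[q][k] := flatten_getElem γ hq' (by omega) _
    have h1 := hasDifferential_linExtInt_of_maximals_eq (lab := γ.flatten.get) hβ hβ1 hx S hmax
    rw [herase] at h1
    set M := multInt (fun w t => iterInt x a t w) a (fun _ => 1) (γ.take q) with hM
    have hMh : IsHolder β a b M :=
      isHolder_multInt hβ hβ1 (fun w => isHolder_iterInt hβ hβ1 hx w) (IsHolder.const 1) _
    have hXw := hasDifferential_iterInt_concat hβ hβ1 hx (γ[q].take k) γ[q][k]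
    rw [← List.take_succ_eq_append_getElem (show k < γ[q].length by omega),
      List.take_of_length_le (show γ[q].length ≤ k + 1 by omega)] at hXw
    have h2 := ((hMh.isIntegrand hβ).hasDifferential_rsInt hβ0
      (isHolder_iterInt hβ hβ1 hx γ[q])).subst (η := fun c ξ e => M ξ *
        (iterInt x a ξ (γ[q].take k) * (x γ[q][k] e - x γ[q][k] c)))
      ((Negligible.bdd_mul hXw (hMh.bounded hβ0)).congr fun c ξ e _ _ _ _ => by ring)
    have h1' := h1.congr (η := fun c ξ e => M ξ *
        (iterInt x a ξ (γ[q].take k) * (x γ[q][k] e - x γ[q][k] c))) fun c ξ e g1 g2 g3 g4 => by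
      have hξ : ξ ∈ Set.Icc a b := ⟨g1.trans g2, g3.trans g4⟩
      rw [linExtInt_union hβ hβ1 hx S₁ S₂ hdisj hunrel ξ hξ, ih (by omega) ξ hξ,
        linExtInt_block hβ hβ1 hx hγ hq' k (by omega) ξ hξ, hlab]
      ring
    have h3 := h1'.sub_eq_sub h2 ht
    rw [linExtInt_self _ ⟨top, htop⟩, rsInt_self] at h3
    rw [List.take_succ_eq_append_getElem hq', multInt_concat]
    linarith

theorem multInt_iterInt_eq_shuffleInt (hβ : 1 / 2 < β) (hβ1 : β ≤ 1)
    (hx : ∀ j, IsHolder β a b (x j)) {γ : List (List (Fin m))} (hγ : ∀ w ∈ γ, w ≠ []) {t : ℝ}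
    (ht : t ∈ Set.Icc a b) :
    multInt (fun w t => iterInt x a t w) a (fun _ => 1) γ t = shuffleInt x a t γ := by
  have h := multInt_iterInt_eq_linExtInt hβ hβ1 hx hγ γ.length le_rfl t ht
  rw [List.take_length] at h
  rw [← h, shuffleInt, sum_Xi_eq_linExtInt (blockEnd_lt hγ)]
  congr 1
  ext u
  simp only [blockEnd_length, Fin.is_lt, Finset.filter_true]

end Shuffle

/-! ### Iterated vector fields -/

section VectorFields

variable {d m : ℕ} {V : Fin m → (Fin d → ℝ) → (Fin d → ℝ)}

theorem pderiv_sum {ι : Type*} (s : Finset ι) {f : ι → (Fin d → ℝ) → ℝ}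
    (hf : ∀ i ∈ s, Differentiable ℝ (f i)) (l : Fin d) :
    (pderiv l fun y => ∑ i ∈ s, f i y) = fun y => ∑ i ∈ s, pderiv l (f i) y := by
  funext y
  rw [pderiv, fderiv_fun_sum fun i hi => hf i hi y]
  simp [pderiv]

theorem pderiv_mul {f g : (Fin d → ℝ) → ℝ} (hf : Differentiable ℝ f) (hg : Differentiable ℝ g)
    (l : Fin d) :
    (pderiv l fun y => f y * g y) = fun y => f y * pderiv l g y + g y * pderiv l f y := by
  funext y
  rw [pderiv, fderiv_fun_mul (hf y) (hg y)]
  simp [pderiv]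

theorem pderiv_coord (l i : Fin d) :
    (pderiv l fun z => z i) = fun _ => (Pi.single l 1 : Fin d → ℝ) i := by
  funext y
  rw [pderiv, (hasFDerivAt_apply (𝕜 := ℝ) i y).fderiv]
  rfl

theorem vf_sum {ι : Type*} (s : Finset ι) {f : ι → (Fin d → ℝ) → ℝ}
    (hf : ∀ i ∈ s, Differentiable ℝ (f i)) (j : Fin m) :
    (vf V j fun y => ∑ i ∈ s, f i y) = fun y => ∑ i ∈ s, vf V j (f i) y := by
  funext y
  simp only [vf, pderiv_sum s hf, Finset.mul_sum]
  rw [Finset.sum_comm]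

/-- The vector fields are derivations. -/
theorem vf_mul {f g : (Fin d → ℝ) → ℝ} (hf : Differentiable ℝ f) (hg : Differentiable ℝ g)
    (j : Fin m) :
    (vf V j fun y => f y * g y) = fun y => f y * vf V j g y + vf V j f y * g y := by
  funext y
  simp only [vf, pderiv_mul hf hg, Finset.mul_sum, Finset.sum_mul, ← Finset.sum_add_distrib]
  exact Finset.sum_congr rfl fun l _ => by ring

theorem vf_coord (j : Fin m) (i : Fin d) : (vf V j fun z => z i) = fun y => V j y i := by
  funext y
  simp [vf, pderiv_coord, Pi.single_apply]

theorem contDiff_vf {k : ℕ} (hV : ∀ j, ContDiff ℝ (k : ℕ) (V j)) {f : (Fin d → ℝ) → ℝ}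
    (hf : ContDiff ℝ (k + 1 : ℕ) f) (j : Fin m) : ContDiff ℝ (k : ℕ) (vf V j f) :=
  ContDiff.sum fun i _ => (contDiff_pi.1 (hV j) i).mul (ContDiff.pderiv hf i)

theorem contDiff_vfIter {k : ℕ} (w : List (Fin m)) (hV : ∀ j, ContDiff ℝ (k + w.length : ℕ) (V j))
    {f : (Fin d → ℝ) → ℝ} (hf : ContDiff ℝ (k + w.length : ℕ) f) :
    ContDiff ℝ (k : ℕ) (vfIter V w f) := by
  induction w generalizing k with
  | nil => simpa [vfIter] using hf
  | cons j w ih =>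
    have e : k + (j :: w).length = k + 1 + w.length := by rw [List.length_cons]; ring
    rw [e] at hf hV
    exact contDiff_vf (fun j => (hV j).of_le (by exact_mod_cast (by omega : k ≤ k + 1 + w.length)))
      (ih hV hf) j

theorem vfIter_concat (w : List (Fin m)) (j : Fin m) (f : (Fin d → ℝ) → ℝ) :
    vfIter V (w ++ [j]) f = vfIter V w (vf V j f) := by
  simp [vfIter, List.foldr_append]

theorem vfIter_sum {ι : Type*} (s : Finset ι) {f : ι → (Fin d → ℝ) → ℝ} (w : List (Fin m))
    (hV : ∀ j, ContDiff ℝ (w.length : ℕ) (V j)) (hf : ∀ i ∈ s, ContDiff ℝ (w.length : ℕ) (f i)) :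
    (vfIter V w fun y => ∑ i ∈ s, f i y) = fun y => ∑ i ∈ s, vfIter V w (f i) y := by
  induction w with
  | nil => rfl
  | cons j w ih =>
    have hle : (w.length : WithTop ℕ∞) ≤ ((j :: w).length : ℕ) := by
      exact_mod_cast (by simp : w.length ≤ (j :: w).length)
    have e : (j :: w).length = 1 + w.length := by rw [List.length_cons]; ring
    change vf V j (vfIter V w _) = _
    rw [ih (fun j => (hV j).of_le hle) fun i hi => (hf i hi).of_le hle,
      vf_sum s fun i hi => ?_]
    · rfl
    · rw [e] at hV hf
      exact (contDiff_vfIter (k := 1) w hV (hf i hi)).differentiable (by simp)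

end VectorFields

/-! ### Taylor sums along the driving path -/

section TaylorSums

variable {a b β : ℝ} {d m : ℕ} (V : Fin m → (Fin d → ℝ) → (Fin d → ℝ)) (x : Fin m → ℝ → ℝ)
  (a) (z : Fin d → ℝ)

/-- The term of degree `r` of the Taylor expansion of `f` along the flow started from `z` at time
`a`: the sum of `(𝒱_w f)(z) x^w_{a,t}` over the words `w` of length `r`. -/
noncomputable def taylorTerm (r : ℕ) (f : (Fin d → ℝ) → ℝ) (t : ℝ) : ℝ :=
  wordSum Finset.univ r fun w => vfIter V w f z * iterInt x a t w

/-- The sum of the terms of degree at most `M`. -/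
noncomputable def taylorSum (M : ℕ) (f : (Fin d → ℝ) → ℝ) (t : ℝ) : ℝ :=
  ∑ r ∈ Finset.range (M + 1), taylorTerm V x a z r f t

variable {V x a z}

theorem taylorTerm_zero (f : (Fin d → ℝ) → ℝ) (t : ℝ) : taylorTerm V x a z 0 f t = f z := by
  simp [taylorTerm, wordSum_zero, iterInt, multInt, vfIter]

theorem taylorTerm_succ_self (r : ℕ) (f : (Fin d → ℝ) → ℝ) :
    taylorTerm V x a z (r + 1) f a = 0 := by
  refine Finset.sum_eq_zero fun w _ => ?_
  change _ * iterInt x a a _ = 0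
  rw [iterInt_self a (by simp), mul_zero]

theorem taylorSum_self (M : ℕ) (f : (Fin d → ℝ) → ℝ) : taylorSum V x a z M f a = f z := by
  rw [taylorSum, Finset.sum_range_succ']
  simp [taylorTerm_succ_self, taylorTerm_zero]

theorem taylorSum_zero (f : (Fin d → ℝ) → ℝ) (t : ℝ) : taylorSum V x a z 0 f t = f z := by
  simp [taylorSum, taylorTerm_zero]

theorem isHolder_taylorTerm (hβ : 1 / 2 < β) (hβ1 : β ≤ 1) (hx : ∀ j, IsHolder β a b (x j))
    (r : ℕ) (f : (Fin d → ℝ) → ℝ) : IsHolder β a b (taylorTerm V x a z r f) :=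
  IsHolder.sum _ fun w _ => (isHolder_iterInt hβ hβ1 hx _).const_mul (by linarith) _

theorem isHolder_taylorSum (hβ : 1 / 2 < β) (hβ1 : β ≤ 1) (hx : ∀ j, IsHolder β a b (x j))
    (M : ℕ) (f : (Fin d → ℝ) → ℝ) : IsHolder β a b (taylorSum V x a z M f) :=
  IsHolder.sum _ fun r _ => isHolder_taylorTerm hβ hβ1 hx r f

theorem hasDifferential_taylorTerm_succ (hβ : 1 / 2 < β) (hβ1 : β ≤ 1)
    (hx : ∀ j, IsHolder β a b (x j)) (r : ℕ) (f : (Fin d → ℝ) → ℝ) :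
    HasDifferential a b (taylorTerm V x a z (r + 1) f)
      fun c ξ e => ∑ j, taylorTerm V x a z r (vf V j f) ξ * (x j e - x j c) := by
  have h := HasDifferential.sum (Finset.univ : Finset (Fin m)) fun j _ =>
    HasDifferential.sum (Fintype.piFinset fun _ : Fin r => (Finset.univ : Finset (Fin m)))
      fun w _ => (hasDifferential_iterInt_concat hβ hβ1 hx (List.ofFn w) j).const_mul
        (vfIter V (List.ofFn w ++ [j]) f z)
  refine (h.congr_fun fun t _ => ?_).congr fun c ξ e _ _ _ _ => ?_
  · rw [taylorTerm, wordSum_succ_last]; rfl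
  · refine Finset.sum_congr rfl fun j _ => ?_
    rw [taylorTerm, wordSum, Finset.sum_mul]
    refine Finset.sum_congr rfl fun w _ => ?_
    rw [vfIter_concat]; ring

theorem hasDifferential_taylorSum_succ (hβ : 1 / 2 < β) (hβ1 : β ≤ 1)
    (hx : ∀ j, IsHolder β a b (x j)) (M : ℕ) (f : (Fin d → ℝ) → ℝ) :
    HasDifferential a b (taylorSum V x a z (M + 1) f)
      fun c ξ e => ∑ j, taylorSum V x a z M (vf V j f) ξ * (x j e - x j c) := by
  have h := (HasDifferential.sum (Finset.range (M + 1)) fun r _ =>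
    hasDifferential_taylorTerm_succ (V := V) (z := z) hβ hβ1 hx r f).add
      (HasDifferential.const (f z))
  refine (h.congr_fun fun t _ => ?_).congr fun c ξ e _ _ _ _ => ?_
  · rw [taylorSum, Finset.sum_range_succ' _ (M + 1), taylorTerm_zero]
  · rw [add_zero, Finset.sum_comm]
    refine Finset.sum_congr rfl fun j _ => ?_
    rw [taylorSum, Finset.sum_mul]

theorem taylorTerm_sum {ι : Type*} (s : Finset ι) (r : ℕ) (hV : ∀ j, ContDiff ℝ (r : ℕ) (V j))
    {f : ι → (Fin d → ℝ) → ℝ} (hf : ∀ i ∈ s, ContDiff ℝ (r : ℕ) (f i)) (t : ℝ) :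
    taylorTerm V x a z r (fun y => ∑ i ∈ s, f i y) t = ∑ i ∈ s, taylorTerm V x a z r (f i) t := by
  unfold taylorTerm
  rw [← wordSum_finset_sum]
  refine wordSum_congr fun w hw _ => ?_
  rw [vfIter_sum s w (by rwa [hw]) (by rwa [hw]), Finset.sum_mul]

theorem taylorSum_sum {ι : Type*} (s : Finset ι) (M : ℕ) (hV : ∀ j, ContDiff ℝ (M : ℕ) (V j))
    {f : ι → (Fin d → ℝ) → ℝ} (hf : ∀ i ∈ s, ContDiff ℝ (M : ℕ) (f i)) (t : ℝ) :
    taylorSum V x a z M (fun y => ∑ i ∈ s, f i y) t = ∑ i ∈ s, taylorSum V x a z M (f i) t := by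
  unfold taylorSum
  rw [Finset.sum_comm]
  refine Finset.sum_congr rfl fun r hr => ?_
  have hle : (r : WithTop ℕ∞) ≤ (M : ℕ) := by
    exact_mod_cast Nat.lt_succ_iff.1 (Finset.mem_range.1 hr)
  exact taylorTerm_sum s r (fun j => (hV j).of_le hle) (fun i hi => (hf i hi).of_le hle) t

theorem taylorSum_add (M : ℕ) (hV : ∀ j, ContDiff ℝ (M : ℕ) (V j)) {f g : (Fin d → ℝ) → ℝ}
    (hf : ContDiff ℝ (M : ℕ) f) (hg : ContDiff ℝ (M : ℕ) g) (t : ℝ) :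
    taylorSum V x a z M (fun y => f y + g y) t =
      taylorSum V x a z M f t + taylorSum V x a z M g t := by
  have := taylorSum_sum (V := V) (x := x) (a := a) (z := z) (Finset.univ : Finset Bool) M hV
    (f := fun i => if i then f else g) (by intro i _; cases i <;> simp [hf, hg]) t
  simpa using this

/-- Taylor sums are multiplicative up to terms of higher degree, because the vector fields are
derivations and integration obeys the product rule. -/
theorem taylorSum_mul (hβ : 1 / 2 < β) (hβ1 : β ≤ 1) (hx : ∀ j, IsHolder β a b (x j)) (M : ℕ)
    (hV : ∀ j, ContDiff ℝ (M : ℕ) (V j)) {f g : (Fin d → ℝ) → ℝ} (hf : ContDiff ℝ (M : ℕ) f)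
    (hg : ContDiff ℝ (M : ℕ) g) : ∀ t ∈ Set.Icc a b,
    taylorSum V x a z M (fun y => f y * g y) t = ∑ r ∈ Finset.range (M + 1),
      taylorSum V x a z (M - r) f t * taylorTerm V x a z r g t := by
  induction M generalizing f g with
  | zero => intro t _; simp [taylorSum_zero, taylorTerm_zero]
  | succ M ih =>
    intro t ht
    have hle : (M : WithTop ℕ∞) ≤ (M + 1 : ℕ) := by exact_mod_cast Nat.le_succ M
    have hV' : ∀ j, ContDiff ℝ (M : ℕ) (V j) := fun j => (hV j).of_le hle
    have hfd : Differentiable ℝ f := hf.differentiable (by simp)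
    have hgd : Differentiable ℝ g := hg.differentiable (by simp)
    have hL := (hasDifferential_taylorSum_succ (V := V) (z := z) hβ hβ1 hx M
      fun y => f y * g y).congr (η := fun c ξ e => ∑ j,
        (∑ r ∈ Finset.range (M + 1), taylorSum V x a z (M - r) f ξ *
            taylorTerm V x a z r (vf V j g) ξ
          + ∑ r ∈ Finset.range (M + 1), taylorSum V x a z (M - r) (vf V j f) ξ *
            taylorTerm V x a z r g ξ) * (x j e - x j c)) fun c ξ e h1 h2 h3 h4 => by
        have hξ : ξ ∈ Set.Icc a b := ⟨h1.trans h2, h3.trans h4⟩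
        refine Finset.sum_congr rfl fun j _ => ?_
        have hvf := contDiff_vf hV' hf j
        have hvg := contDiff_vf hV' hg j
        rw [vf_mul hfd hgd, taylorSum_add M hV' ((hf.of_le hle).mul hvg) (hvf.mul (hg.of_le hle)),
          ih hV' (hf.of_le hle) hvg ξ hξ, ih hV' hvf (hg.of_le hle) ξ hξ]
    -- the differentials of the terms and of the sums, which vanish in degree zero
    have hT : ∀ r, HasDifferential a b (taylorTerm V x a z r g) fun c ξ e => if r = 0 then 0 else
        ∑ j, taylorTerm V x a z (r - 1) (vf V j g) ξ * (x j e - x j c) := by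
      intro r
      cases r with
      | zero => exact (HasDifferential.const (g z)).congr_fun fun t _ => (taylorTerm_zero g t).symm
      | succ r => exact hasDifferential_taylorTerm_succ hβ hβ1 hx r g
    have hS : ∀ r, HasDifferential a b (taylorSum V x a z r f) fun c ξ e => if r = 0 then 0 else
        ∑ j, taylorSum V x a z (r - 1) (vf V j f) ξ * (x j e - x j c) := by
      intro r
      cases r with
      | zero => exact (HasDifferential.const (f z)).congr_fun fun t _ => (taylorSum_zero f t).symm
      | succ r => exact hasDifferential_taylorSum_succ hβ hβ1 hx r f
    have hR := HasDifferential.sum (Finset.range (M + 1 + 1)) fun r _ =>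
      (hS (M + 1 - r)).mul hβ (hT r) (isHolder_taylorSum hβ hβ1 hx _ f)
        (isHolder_taylorTerm hβ hβ1 hx r g)
    have hR' := hR.congr (η := fun c ξ e => ∑ j,
        (∑ r ∈ Finset.range (M + 1), taylorSum V x a z (M - r) f ξ *
            taylorTerm V x a z r (vf V j g) ξ
          + ∑ r ∈ Finset.range (M + 1), taylorSum V x a z (M - r) (vf V j f) ξ *
            taylorTerm V x a z r g ξ) * (x j e - x j c)) fun c ξ e _ _ _ _ => by
        rw [Finset.sum_add_distrib, Finset.sum_range_succ' _ (M + 1),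
          Finset.sum_range_succ _ (M + 1)]
        simp only [add_mul, Finset.sum_add_distrib]
        congr 1
        · simp only [if_true, mul_zero, add_zero, Nat.succ_ne_zero, if_false, Nat.add_sub_cancel,
            Nat.add_sub_add_right, Finset.mul_sum, Finset.sum_mul]
          rw [Finset.sum_comm]
          exact Finset.sum_congr rfl fun j _ => Finset.sum_congr rfl fun r _ => by ring
        · simp only [Nat.sub_self, if_true, mul_zero, add_zero, Finset.sum_mul]
          rw [Finset.sum_comm]
          refine Finset.sum_congr rfl fun r hr => ?_
          have hr' := Finset.mem_range.1 hr
          rw [if_neg (by omega), show M + 1 - r - 1 = M - r by omega, Finset.mul_sum]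
          exact Finset.sum_congr rfl fun j _ => by ring
    have := hL.sub_eq_sub hR' ht
    simp only [taylorSum_self] at this
    rw [Finset.sum_range_succ' (fun r => f z * taylorTerm V x a z r g a)] at this
    simp only [taylorTerm_succ_self, taylorTerm_zero, mul_zero, Finset.sum_const_zero] at this
    linarith

/-- The chain rule for Taylor sums. The sum multiplying the term of degree `r + 1` is truncated so
that the total degree is at most `M`. -/
theorem hasDifferential_taylorSum_chain (hβ : 1 / 2 < β) (hβ1 : β ≤ 1)
    (hx : ∀ j, IsHolder β a b (x j)) (M : ℕ) (hV : ∀ j, ContDiff ℝ (M : ℕ) (V j))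
    {f : (Fin d → ℝ) → ℝ} (hf : ContDiff ℝ (M : ℕ) f) :
    HasDifferential a b (taylorSum V x a z M f) fun c ξ e =>
      ∑ l, ∑ r ∈ Finset.range M, taylorSum V x a z (M - (r + 1)) (pderiv l f) ξ *
        (taylorTerm V x a z (r + 1) (fun y => y l) e
          - taylorTerm V x a z (r + 1) (fun y => y l) c) := by
  cases M with
  | zero =>
    refine ((HasDifferential.const (f z)).congr_fun fun t _ => (taylorSum_zero f t).symm).congr
      fun c ξ e _ _ _ _ => by simp
  | succ M =>
    have hβ0 : 0 < β := by linarith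
    have hle : (M : WithTop ℕ∞) ≤ (M + 1 : ℕ) := by exact_mod_cast Nat.le_succ M
    have hV' : ∀ j, ContDiff ℝ (M : ℕ) (V j) := fun j => (hV j).of_le hle
    have hterm : ∀ l, ∀ r, HasDifferential a b (taylorTerm V x a z (r + 1) fun y => y l)
        fun c ξ e => ∑ j, taylorTerm V x a z r (fun y => V j y l) ξ * (x j e - x j c) := by
      intro l r
      have := hasDifferential_taylorTerm_succ (V := V) (z := z) hβ hβ1 hx r fun y => y l
      simp only [vf_coord] at this
      exact this
    refine (hasDifferential_taylorSum_succ (V := V) (z := z) hβ hβ1 hx M f).subst ?_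
    have hneg : Negligible a b fun c ξ e => ∑ l, ∑ r ∈ Finset.range (M + 1),
        taylorSum V x a z (M + 1 - (r + 1)) (pderiv l f) ξ *
          (taylorTerm V x a z (r + 1) (fun y => y l) e
            - taylorTerm V x a z (r + 1) (fun y => y l) c
            - ∑ j, taylorTerm V x a z r (fun y => V j y l) ξ * (x j e - x j c)) :=
      Negligible.sum _ fun l _ => Negligible.sum _ fun r _ =>
        Negligible.bdd_mul (hterm l r) ((isHolder_taylorSum hβ hβ1 hx _ _).bounded hβ0)
    refine hneg.neg.congr fun c ξ e h1 h2 h3 h4 => ?_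
    have hξ : ξ ∈ Set.Icc a b := ⟨h1.trans h2, h3.trans h4⟩
    have key : ∀ j, taylorSum V x a z M (vf V j f) ξ = ∑ l, ∑ r ∈ Finset.range (M + 1),
        taylorSum V x a z (M - r) (pderiv l f) ξ *
          taylorTerm V x a z r (fun y => V j y l) ξ := by
      intro j
      have hp : ∀ l, ContDiff ℝ (M : ℕ) (pderiv l f) := fun l => ContDiff.pderiv hf l
      have hVl : ∀ l, ContDiff ℝ (M : ℕ) fun y => V j y l := fun l => contDiff_pi.1 (hV' j) l
      have e : vf V j f = fun y => ∑ l, pderiv l f y * V j y l := by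
        funext y; simp only [vf, mul_comm]
      rw [e, taylorSum_sum Finset.univ M hV' fun l _ => (hp l).mul (hVl l)]
      exact Finset.sum_congr rfl fun l _ => taylorSum_mul hβ hβ1 hx M hV' (hp l) (hVl l) ξ hξ
    have key2 : ∑ j, taylorSum V x a z M (vf V j f) ξ * (x j e - x j c) =
        ∑ l, ∑ r ∈ Finset.range (M + 1), taylorSum V x a z (M + 1 - (r + 1)) (pderiv l f) ξ *
          ∑ j, taylorTerm V x a z r (fun y => V j y l) ξ * (x j e - x j c) := by
      simp only [key, Finset.sum_mul, Finset.mul_sum, Nat.add_sub_add_right]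
      rw [Finset.sum_comm]
      refine Finset.sum_congr rfl fun l _ => ?_
      rw [Finset.sum_comm]
      exact Finset.sum_congr rfl fun r _ => Finset.sum_congr rfl fun j _ => by ring
    rw [key2]
    simp only [mul_sub, Finset.sum_sub_distrib]
    ring

end TaylorSums

/-! ### The complete expansion of the integral of a function -/

section CompleteExpansion

variable {a b β : ℝ} {d m : ℕ} {V : Fin m → (Fin d → ℝ) → (Fin d → ℝ)} {x : Fin m → ℝ → ℝ}
  {z : Fin d → ℝ}

theorem multInt_map {ι κ : Type*} (g : κ → ℝ → ℝ) (s : ℝ) (f : ℝ → ℝ) (φ : ι → κ) (α : List ι) :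
    multInt (fun i => g (φ i)) s f α = multInt g s f (α.map φ) := by
  simp [multInt, List.foldl_map]

theorem isHolder_expansionPath (hβ : 1 / 2 < β) (hβ1 : β ≤ 1) (hx : ∀ j, IsHolder β a b (x j))
    (G : Finset (List (Fin m))) (l : Fin d) : IsHolder β a b (expansionPath V x G a z l) :=
  IsHolder.sum _ fun _ _ => (isHolder_iterInt hβ hβ1 hx _).const_mul (by linarith) _

theorem expansion_self {G : Finset (List (Fin m))} (hG : [] ∉ G) (s : ℝ) (y : Fin d → ℝ) :
    expansion V x G s s y = 0 := by
  funext i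
  refine Finset.sum_eq_zero fun γ hγ => ?_
  rw [iterInt_self s (fun h => hG (h ▸ hγ)), mul_zero]

theorem nil_notMem_words (m N : ℕ) : [] ∉ words m N := fun h => by
  simpa using (length_of_mem_words h).1

theorem expansionPath_words (N : ℕ) (i : Fin d) (t : ℝ) :
    expansionPath V x (words m N) a z i t =
      ∑ r ∈ Finset.range N, taylorTerm V x a z (r + 1) (fun y => y i) t :=
  sum_words N _

/-- The iterated integrals of the complete expansion, without the terms of degree above `M`. -/
theorem iterInt_expansion_sub_Qterm (hβ : 1 / 2 < β) (hβ1 : β ≤ 1)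
    (hx : ∀ j, IsHolder β a b (x j)) (M N : ℕ) {p : ℕ} (ζ : Fin p → Fin d) {t : ℝ}
    (ht : t ∈ Set.Icc a b) :
    iterInt (expansionPath V x (words m N) a z) a t (List.ofFn ζ) - Qterm V x M N ζ a t z =
      ∑ γ ∈ Fintype.piFinset fun _ : Fin p => words m N,
        if ∑ i, (γ i).length ≤ M then
          multInt (fun (k : Fin d × List (Fin m)) t =>
            vfIter V k.2 (fun y => y k.1) z * iterInt x a t k.2) a (fun _ => 1)
            (List.ofFn fun i => (ζ i, γ i)) t
        else 0 := by
  have hβ0 : 0 < β := by linarith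
  have h1 : IsIntegrand β a b fun _ => (1 : ℝ) := (IsHolder.const 1).isIntegrand hβ
  have hX : ∀ k : Fin d × List (Fin m), IsHolder β a b fun t => iterInt x a t k.2 := fun k =>
    isHolder_iterInt hβ hβ1 hx k.2
  have e1 := multInt_eq_sum_integrators (words m N) (g := expansionPath V x (words m N) a z)
    (G := fun (k : Fin d × List (Fin m)) t =>
      vfIter V k.2 (fun y => y k.1) z * iterInt x a t k.2) hβ hβ1
    (fun k => (hX k).const_mul hβ0 _) (fun i t _ => rfl) h1 ζ t ht
  have e2 : ∀ γ ∈ Fintype.piFinset fun _ : Fin p => words m N,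
      multInt (fun (k : Fin d × List (Fin m)) t =>
        vfIter V k.2 (fun y => y k.1) z * iterInt x a t k.2) a (fun _ => 1)
        (List.ofFn fun i => (ζ i, γ i)) t =
      (∏ i, vfIter V (γ i) (fun z => z (ζ i)) z) * shuffleInt x a t (List.ofFn γ) := by
    intro γ hγ
    rw [Fintype.mem_piFinset] at hγ
    rw [multInt_smul_integrators (fun k : Fin d × List (Fin m) => vfIter V k.2 (fun y => y k.1) z)
      hβ hβ1 hX h1 _ t ht, multInt_map (fun w t => iterInt x a t w) a (fun _ => 1)
      (fun k : Fin d × List (Fin m) => k.2), List.map_ofFn, List.map_ofFn, List.prod_ofFn,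
      ← multInt_iterInt_eq_shuffleInt hβ hβ1 hx ?_ ht]
    · rfl
    · intro w hw
      obtain ⟨i, rfl⟩ := (List.mem_ofFn' _ _).1 hw
      exact fun h => nil_notMem_words m N (h ▸ hγ i)
  rw [iterInt, e1, Qterm, ← Finset.sum_filter, sub_eq_iff_eq_add, add_comm,
    ← Finset.sum_filter_add_sum_filter_not _ fun γ : Fin p → List (Fin m) =>
      M < ∑ i, (γ i).length]
  congr 1
  · exact Finset.sum_congr rfl fun γ hγ => e2 γ (Finset.mem_filter.1 hγ).1
  · simp only [not_lt]

/-- The expansion of the Taylor sum of `f` in the iterated integrals of the expansion of the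
identity, a Faà di Bruno formula. It is the iteration of the chain rule for Taylor sums; as every
iteration raises the degree, the remainder vanishes after `N > M` of them. -/
theorem sum_pderivIter_mul_iterInt_expansion (hβ : 1 / 2 < β) (hβ1 : β ≤ 1)
    (hx : ∀ j, IsHolder β a b (x j)) {M N : ℕ} (hMN : M < N)
    (hV : ∀ j, ContDiff ℝ (M : ℕ) (V j)) {f : (Fin d → ℝ) → ℝ} (hf : ContDiff ℝ (M : ℕ) f) :
    ∀ t ∈ Set.Icc a b, ∑ p ∈ Finset.range N, ∑ ζ : Fin p → Fin d, pderivIter (List.ofFn ζ) f z *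
      (iterInt (expansionPath V x (words m N) a z) a t (List.ofFn ζ) - Qterm V x M N ζ a t z)
      = taylorSum V x a z M f t := by
  classical
  have hβ0 : 0 < β := by linarith
  -- a word over `K` lists coordinates together with words of the driving path of total length `tot`
  let tot : List (Fin d × List (Fin m)) → ℕ := fun α => (α.map fun k => k.2.length).sum
  let A : List (Fin d × List (Fin m)) → ℝ → ℝ := fun α t =>
    if tot α ≤ M then taylorSum V x a z (M - tot α) (pderivIter (α.map Prod.fst) f) t else 0
  let c : List (Fin d × List (Fin m)) → ℝ := fun α =>
    if tot α ≤ M then pderivIter (α.map Prod.fst) f z else 0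
  let g : Fin d × List (Fin m) → ℝ → ℝ := fun k t =>
    vfIter V k.2 (fun y => y k.1) z * iterInt x a t k.2
  let K : Finset (Fin d × List (Fin m)) := Finset.univ ×ˢ words m N
  have hg : ∀ k, IsHolder β a b (g k) := fun k =>
    (isHolder_iterInt hβ hβ1 hx k.2).const_mul hβ0 _
  have hA : ∀ α, IsHolder β a b (A α) := by
    intro α
    by_cases h : tot α ≤ M
    · simp only [A, if_pos h]; exact isHolder_taylorSum hβ hβ1 hx _ _
    · simp only [A, if_neg h]; exact IsHolder.const 0
  have hlen : ∀ α : List (Fin d × List (Fin m)), (∀ k ∈ α, k ∈ K) → α.length ≤ tot α := by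
    intro α
    induction α with
    | nil => intro _; simp
    | cons k α ih =>
      intro h
      have h1 := ih fun k hk => h k (by simp [hk])
      have h2 := (length_of_mem_words (Finset.mem_product.1 (h k (by simp))).2).1
      simp only [tot, List.map_cons, List.sum_cons, List.length_cons] at h1 ⊢
      omega
  have hstep : ∀ α, (∀ k ∈ α, k ∈ K) → ∀ t ∈ Set.Icc a b,
      A α t = c α + ∑ k ∈ K, rsInt (A (k :: α)) (g k) a t := by
    intro α hα t ht
    have hcons : ∀ k, tot (k :: α) = k.2.length + tot α := fun k => rfl
    by_cases h : tot α ≤ M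
    · set M' := M - tot α with hM'
      have hlα := hlen α hα
      have hle : (M' : WithTop ℕ∞) ≤ (M : ℕ) := by exact_mod_cast (by omega : M' ≤ M)
      have hf' : ContDiff ℝ (M' : ℕ) (pderivIter (α.map Prod.fst) f) :=
        ContDiff.pderivIter _ (hf.of_le (by
          rw [List.length_map]
          exact_mod_cast (by omega : M' + α.length ≤ M)))
      have h1 := hasDifferential_taylorSum_chain (V := V) (z := z) hβ hβ1 hx M'
        (fun j => (hV j).of_le hle) hf'
      have h2 : HasDifferential a b (fun t => c α + ∑ k ∈ K, rsInt (A (k :: α)) (g k) a t)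
          fun c ξ e => ∑ k ∈ K, A (k :: α) ξ * (g k e - g k c) :=
        ((HasDifferential.const (c α)).add (HasDifferential.sum K fun k _ =>
          ((hA (k :: α)).isIntegrand hβ).hasDifferential_rsInt hβ0 (hg k))).congr
          fun c ξ e _ _ _ _ => by ring
      have h3 := h2.congr (η := fun c ξ e =>
          ∑ l, ∑ r ∈ Finset.range M', taylorSum V x a z (M' - (r + 1))
            (pderiv l (pderivIter (α.map Prod.fst) f)) ξ *
            (taylorTerm V x a z (r + 1) (fun y => y l) e
              - taylorTerm V x a z (r + 1) (fun y => y l) c)) fun c ξ e _ _ _ _ => by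
        rw [Finset.sum_product]
        refine Finset.sum_congr rfl fun l _ => ?_
        rw [sum_words]
        -- the words that are too long do not contribute
        have hsub : Finset.range M' ⊆ Finset.range N :=
          Finset.range_subset_range.2 (by omega)
        rw [← Finset.sum_subset hsub]
        · refine Finset.sum_congr rfl fun r hr => ?_
          have hr' := Finset.mem_range.1 hr
          rw [taylorTerm, taylorTerm, wordSum, wordSum, wordSum, ← Finset.sum_sub_distrib,
            Finset.mul_sum]
          refine Finset.sum_congr rfl fun w _ => ?_
          simp only [A, hcons, g, List.length_ofFn]
          rw [if_pos (by omega), show M - (r + 1 + tot α) = M' - (r + 1) by omega]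
          rfl
        · intro r _ hr
          have hr' : M' ≤ r := by simpa using hr
          refine Finset.sum_eq_zero fun w _ => ?_
          simp only [A, hcons, List.length_ofFn]
          rw [if_neg (by omega), zero_mul]
      have h4 := h1.sub_eq_sub h3 ht
      rw [taylorSum_self] at h4
      simp only [rsInt_self, Finset.sum_const_zero, add_zero] at h4
      have h5 : A α t = taylorSum V x a z M' (pderivIter (α.map Prod.fst) f) t := if_pos h
      have h6 : c α = pderivIter (α.map Prod.fst) f z := if_pos h
      rw [h5]
      linarith
    · have h5 : A α t = 0 := if_neg h
      have h6 : c α = 0 := if_neg h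
      rw [h5, h6, zero_add, Finset.sum_eq_zero fun k _ => ?_]
      have h7 : A (k :: α) = fun _ => 0 := by
        funext t
        exact if_neg (by rw [hcons]; omega)
      have h8 : HasDifferential a b (fun _ => 0) fun c ξ e => A (k :: α) ξ * (g k e - g k c) :=
        (HasDifferential.const 0).congr fun c ξ e _ _ _ _ => by rw [h7]; ring
      simpa using h8.rsInt_eq le_rfl ht.1 ht.2
  intro t ht
  have key := expand_multInt K hβ hβ1 hg A c N (fun α _ => (hA α).isIntegrand hβ)
    (fun α _ hα => hstep α hα) t ht
  have hrem : (wordSum K N fun α => multInt g a (A α) α t) = 0 := by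
    refine Finset.sum_eq_zero fun α hα => ?_
    rw [Fintype.mem_piFinset] at hα
    have h1 := hlen (List.ofFn α) fun k hk => by
      obtain ⟨i, rfl⟩ := (List.mem_ofFn' _ _).1 hk
      exact hα i
    rw [List.length_ofFn] at h1
    have h2 : ∀ t ∈ Set.Icc a b, A (List.ofFn α) t = ∑ i ∈ (∅ : Finset ℕ), (0 : ℝ) * 0 :=
      fun t _ => if_neg (by omega)
    have h3 := multInt_eq_sum (∅ : Finset ℕ) (c := fun _ => 0) (f := fun _ _ => 0) hβ hβ1 hg
      (by simp) h2 (List.ofFn α) t ht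
    simpa using h3
  have hA0 : A [] t = taylorSum V x a z M f t := if_pos (Nat.zero_le M)
  rw [hrem, add_zero, hA0] at key
  rw [key]
  refine Finset.sum_congr rfl fun p _ => ?_
  rw [wordSum_product, Fintype.piFinset_univ]
  refine Finset.sum_congr rfl fun ζ _ => ?_
  rw [iterInt_expansion_sub_Qterm hβ hβ1 hx M N ζ ht, Finset.mul_sum]
  refine Finset.sum_congr rfl fun γ _ => ?_
  have e1 : tot (List.ofFn fun i => (ζ i, γ i)) = ∑ i, (γ i).length := by
    simp only [tot, List.map_ofFn, List.sum_ofFn]; rfl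
  have e2 : (List.ofFn fun i => (ζ i, γ i)).map Prod.fst = List.ofFn ζ := by
    rw [List.map_ofFn]; rfl
  simp only [c, e1, e2]
  split_ifs <;> simp [g]

end CompleteExpansion

/-! ### One step of the scheme -/

section OneStep

variable {a b β : ℝ} {d m : ℕ} {V : Fin m → (Fin d → ℝ) → (Fin d → ℝ)} {x : Fin m → ℝ → ℝ}
  {z : Fin d → ℝ}

theorem add_sum_Icc_one (F : ℕ → ℝ) (N : ℕ) :
    F 0 + ∑ p ∈ Finset.Icc 1 N, F p = ∑ p ∈ Finset.range (N + 1), F p := by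
  rw [Finset.range_eq_Ico, Finset.sum_eq_sum_Ico_succ_bot (Nat.succ_pos N)]
  rfl

theorem Qterm_zero (M N : ℕ) (ζ : Fin 0 → Fin d) (s t : ℝ) (y : Fin d → ℝ) :
    Qterm V x M N ζ s t y = 0 := by
  simp [Qterm]

theorem isHolder_Qterm (hβ : 1 / 2 < β) (hβ1 : β ≤ 1) (hx : ∀ j, IsHolder β a b (x j))
    (M N : ℕ) {p : ℕ} (ζ : Fin p → Fin d) : IsHolder β a b fun t => Qterm V x M N ζ a t z :=
  IsHolder.sum _ fun _ _ => IsHolder.const_mul (by linarith) _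
    (IsHolder.sum _ fun _ _ => isHolder_iterInt hβ hβ1 hx _)

/-- The function `f` is of class `C^{N + 1}` and its partial derivatives of order `N + 1`, composed
with `β`-Hölder paths, are integrands. -/
def HasRegularDerivatives (β : ℝ) (N : ℕ) (f : (Fin d → ℝ) → ℝ) : Prop :=
  ContDiff ℝ (N + 1 : ℕ) f ∧
    ∀ ζ : List (Fin d), ζ.length = N + 1 → IsLocallyRegular β (pderivIter ζ f)

theorem HasRegularDerivatives.contDiff_pderivIter {N : ℕ} {f : (Fin d → ℝ) → ℝ}
    (hf : HasRegularDerivatives β N f) {ζ : List (Fin d)} (hζ : ζ.length ≤ N) :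
    ContDiff ℝ 1 (pderivIter ζ f) := by
  have := ContDiff.pderivIter (k := 1) ζ
    (hf.1.of_le (by exact_mod_cast (by omega : 1 + ζ.length ≤ N + 1)))
  exact_mod_cast this

theorem HasRegularDerivatives.isLocallyRegular (hβ : 1 / 2 < β) {N : ℕ} {f : (Fin d → ℝ) → ℝ}
    (hf : HasRegularDerivatives β N f) {ζ : List (Fin d)} (hζ : ζ.length ≤ N + 1) :
    IsLocallyRegular β (pderivIter ζ f) := by
  rcases Nat.le_or_eq_of_le_succ hζ with h | h
  · exact IsLocallyRegular.of_contDiff hβ (hf.contDiff_pderivIter h)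
  · exact hf.2 ζ h

/-- Taylor's formula along a Hölder path, with multiple integrals of the path. -/
theorem HasRegularDerivatives.taylor (hβ : 1 / 2 < β) (hβ1 : β ≤ 1) {N : ℕ}
    {f : (Fin d → ℝ) → ℝ} (hf : HasRegularDerivatives β N f) {P : Fin d → ℝ → ℝ}
    (hP : ∀ l, IsHolder β a b (P l)) (hPa : ∀ l, P l a = 0) :
    ∀ t ∈ Set.Icc a b, f (z + fun l => P l t) =
      ∑ p ∈ Finset.range (N + 1), ∑ ζ : Fin p → Fin d,
        pderivIter (List.ofFn ζ) f z * iterInt P a t (List.ofFn ζ)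
      + ∑ ζ : Fin (N + 1) → Fin d, multInt P a
        (fun v => pderivIter (List.ofFn ζ) f (z + fun l => P l v)) (List.ofFn ζ) t := by
  classical
  have hβ0 : 0 < β := by linarith
  have hzP : ∀ l, IsHolder β a b fun t => (z + fun l => P l t) l := fun l =>
    (IsHolder.const (z l)).add (hP l)
  have hA : ∀ ζ : List (Fin d), ζ.length ≤ N + 1 →
      IsIntegrand β a b fun t => pderivIter ζ f (z + fun l => P l t) := fun ζ hζ =>
    (hf.isLocallyRegular hβ hζ).isIntegrand_comp hβ0 hzP
  have key := expand_multInt (Finset.univ : Finset (Fin d)) hβ hβ1 hP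
    (fun ζ t => pderivIter ζ f (z + fun l => P l t)) (fun ζ => pderivIter ζ f z) (N + 1) hA
    (fun ζ hζ _ t ht => by
      have h1 := hasDifferential_comp (hf.contDiff_pderivIter (Nat.lt_succ_iff.1 hζ))
        (fun l => hf.isLocallyRegular (ζ := l :: ζ) hβ (by simpa using hζ)) hβ0 hzP
      have h2 := HasDifferential.sum (Finset.univ : Finset (Fin d)) fun l _ =>
        (hA (l :: ζ) (by simpa using hζ)).hasDifferential_rsInt hβ0 (hP l)
      have h3 := (h1.congr fun c ξ e _ _ _ _ => Finset.sum_congr rfl fun l _ => by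
        rw [show (z + fun l => P l e) l - (z + fun l => P l c) l = P l e - P l c by simp];
        rfl).sub_eq_sub h2 ht
      simp only [rsInt_self, Finset.sum_const_zero, sub_zero] at h3
      have h4 : (z + fun l => P l a) = z := by funext l; simp [hPa]
      rw [h4] at h3
      linarith)
  intro t ht
  rw [show f (z + fun l => P l t) = pderivIter [] f (z + fun l => P l t) from rfl, key t ht]
  simp only [wordSum_univ]
  rfl

variable {G : Finset (List (Fin m))} {N : ℕ}

theorem remainder_self (hG : [] ∉ G) (e : Fin 4) (s : ℝ) (y : Fin d → ℝ) :
    remainder V x N G e s s y = 0 := by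
  fin_cases e
  · funext i; simp [remainder, R1, rsInt_self]
  · funext i; simp [remainder, R2, rsInt_self]
  · funext i; simp [remainder, R3, rsInt_self]
  · simp [remainder, R4, expansion_self hG, expansion_self (nil_notMem_words m N)]

theorem hasDifferential_R1 (hβ : 1 / 2 < β) (hβ1 : β ≤ 1) (hx : ∀ j, IsHolder β a b (x j))
    (i : Fin d) :
    HasDifferential a b (fun t => R1 V x N a t z i) (fun c ξ e =>
      (∑ ζ : Fin N → Fin d, ∑ j, iterInt (expansionPath V x (words m N) a z) a ξ (List.ofFn ζ)
        * pderivIter (List.ofFn ζ) (fun y => V j y i) z * (x j e - x j c))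
      + ∑ p ∈ Finset.Icc 1 (N - 1), ∑ ζ : Fin p → Fin d, ∑ j, Qterm V x (N - 1) N ζ a ξ z
        * pderivIter (List.ofFn ζ) (fun y => V j y i) z * (x j e - x j c))
    ∧ IsHolder β a b fun t => R1 V x N a t z i := by
  have hβ0 : 0 < β := by linarith
  have h1 : ∀ (ζ : Fin N → Fin d) (j : Fin m), IsIntegrand β a b fun u =>
      iterInt (expansionPath V x (words m N) a z) a u (List.ofFn ζ)
        * pderivIter (List.ofFn ζ) (fun y => V j y i) z := fun ζ j =>
    ((isHolder_multInt hβ hβ1 (isHolder_expansionPath hβ hβ1 hx _) (IsHolder.const 1) _).mul hβ0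
      (IsHolder.const _)).isIntegrand hβ
  have h2 : ∀ (p : ℕ) (ζ : Fin p → Fin d) (j : Fin m), IsIntegrand β a b fun u =>
      Qterm V x (N - 1) N ζ a u z * pderivIter (List.ofFn ζ) (fun y => V j y i) z :=
    fun p ζ j => ((isHolder_Qterm hβ hβ1 hx _ _ ζ).mul hβ0 (IsHolder.const _)).isIntegrand hβ
  constructor
  · refine HasDifferential.add ?_ ?_
    · exact HasDifferential.sum _ fun ζ _ => HasDifferential.sum _ fun j _ =>
        (h1 ζ j).hasDifferential_rsInt hβ0 (hx j)
    · exact HasDifferential.sum _ fun p _ => HasDifferential.sum _ fun ζ _ =>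
        HasDifferential.sum _ fun j _ => (h2 p ζ j).hasDifferential_rsInt hβ0 (hx j)
  · refine IsHolder.add ?_ ?_
    · exact IsHolder.sum _ fun ζ _ => IsHolder.sum _ fun j _ =>
        (h1 ζ j).isHolder_rsInt hβ0 hβ1 (hx j)
    · exact IsHolder.sum _ fun p _ => IsHolder.sum _ fun ζ _ =>
        IsHolder.sum _ fun j _ => (h2 p ζ j).isHolder_rsInt hβ0 hβ1 (hx j)

theorem hasDifferential_R2 (hβ : 1 / 2 < β) (hβ1 : β ≤ 1) (hx : ∀ j, IsHolder β a b (x j))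
    (hV : ∀ j i, HasRegularDerivatives β N fun y => V j y i) (i : Fin d) :
    HasDifferential a b (fun t => R2 V x N G a t z i) (fun c ξ e =>
      ∑ ζ : Fin (N + 1) → Fin d, ∑ j, multInt (expansionPath V x G a z) a
        (fun v => pderivIter (List.ofFn ζ) (fun y => V j y i) (z + expansion V x G a v z))
        (List.ofFn ζ) ξ * (x j e - x j c))
    ∧ IsHolder β a b fun t => R2 V x N G a t z i := by
  have hβ0 : 0 < β := by linarith
  have hP := isHolder_expansionPath (V := V) (z := z) hβ hβ1 hx G
  have h1 : ∀ (ζ : Fin (N + 1) → Fin d) (j : Fin m), IsIntegrand β a b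
      (multInt (expansionPath V x G a z) a
        (fun v => pderivIter (List.ofFn ζ) (fun y => V j y i) (z + expansion V x G a v z))
        (List.ofFn ζ)) := fun ζ j =>
    isIntegrand_multInt hβ hβ1 hP (((hV j i).isLocallyRegular hβ (by simp)).isIntegrand_comp hβ0
      fun l => (IsHolder.const (z l)).add (hP l)) _
  exact ⟨HasDifferential.sum _ fun ζ _ => HasDifferential.sum _ fun j _ =>
      (h1 ζ j).hasDifferential_rsInt hβ0 (hx j),
    IsHolder.sum _ fun ζ _ => IsHolder.sum _ fun j _ => (h1 ζ j).isHolder_rsInt hβ0 hβ1 (hx j)⟩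

theorem hasDifferential_R3 (hβ : 1 / 2 < β) (hβ1 : β ≤ 1) (hx : ∀ j, IsHolder β a b (x j))
    (i : Fin d) :
    HasDifferential a b (fun t => R3 V x N G a t z i) (fun c ξ e =>
      ∑ p ∈ Finset.Icc 1 N, ∑ ζ : Fin p → Fin d, ∑ j,
        (iterInt (expansionPath V x G a z) a ξ (List.ofFn ζ)
          - iterInt (expansionPath V x (words m N) a z) a ξ (List.ofFn ζ))
        * pderivIter (List.ofFn ζ) (fun y => V j y i) z * (x j e - x j c))
    ∧ IsHolder β a b fun t => R3 V x N G a t z i := by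
  have hβ0 : 0 < β := by linarith
  have h1 : ∀ (p : ℕ) (ζ : Fin p → Fin d) (j : Fin m), IsIntegrand β a b fun u =>
      (iterInt (expansionPath V x G a z) a u (List.ofFn ζ)
          - iterInt (expansionPath V x (words m N) a z) a u (List.ofFn ζ))
        * pderivIter (List.ofFn ζ) (fun y => V j y i) z := fun p ζ j =>
    (((isHolder_multInt hβ hβ1 (isHolder_expansionPath hβ hβ1 hx _) (IsHolder.const 1) _).sub hβ0
      (isHolder_multInt hβ hβ1 (isHolder_expansionPath hβ hβ1 hx _) (IsHolder.const 1) _)).mul hβ0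
      (IsHolder.const _)).isIntegrand hβ
  exact ⟨HasDifferential.sum _ fun p _ => HasDifferential.sum _ fun ζ _ =>
      HasDifferential.sum _ fun j _ => (h1 p ζ j).hasDifferential_rsInt hβ0 (hx j),
    IsHolder.sum _ fun p _ => IsHolder.sum _ fun ζ _ => IsHolder.sum _ fun j _ =>
      (h1 p ζ j).isHolder_rsInt hβ0 hβ1 (hx j)⟩

theorem isHolder_remainder (hβ : 1 / 2 < β) (hβ1 : β ≤ 1) (hx : ∀ j, IsHolder β a b (x j))
    (hV : ∀ j i, HasRegularDerivatives β N fun y => V j y i) (e : Fin 4) (i : Fin d) :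
    IsHolder β a b fun t => remainder V x N G e a t z i := by
  have hβ0 : 0 < β := by linarith
  fin_cases e
  · exact (hasDifferential_R1 hβ hβ1 hx i).2
  · exact (hasDifferential_R2 hβ hβ1 hx hV i).2
  · exact (hasDifferential_R3 hβ hβ1 hx i).2
  · exact (isHolder_expansionPath hβ hβ1 hx (words m N) i).sub hβ0
      (isHolder_expansionPath hβ hβ1 hx G i)

/-- Over one step, the integral of the vector fields along the scheme is the increment of the
scheme plus the four remainders. -/
theorem sum_rsInt_scheme_eq (hβ : 1 / 2 < β) (hβ1 : β ≤ 1) (hx : ∀ j, IsHolder β a b (x j))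
    (hG : [] ∉ G) (hN : 1 ≤ N)
    (hV : ∀ j i, HasRegularDerivatives β N fun y => V j y i) (i : Fin d) :
    ∀ t ∈ Set.Icc a b, ∑ j, rsInt (fun u => V j (z + expansion V x G a u z) i) (x j) a t =
      expansion V x G a t z i + ∑ e, remainder V x N G e a t z i := by
  have hβ0 : 0 < β := by linarith
  obtain ⟨M, rfl⟩ : ∃ M, N = M + 1 := ⟨N - 1, by omega⟩
  have hP := isHolder_expansionPath (V := V) (z := z) hβ hβ1 hx G
  have hPa : ∀ l, expansionPath V x G a z l a = 0 := fun l =>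
    congrFun (expansion_self (V := V) (x := x) hG a z) l
  have hVC : ∀ j, ContDiff ℝ (M : ℕ) (V j) := fun j => contDiff_pi.2 fun l =>
    (hV j l).1.of_le (by exact_mod_cast (by omega : M ≤ M + 1 + 1))
  have hint : ∀ j, IsIntegrand β a b fun u => V j (z + expansion V x G a u z) i := fun j =>
    (isHolder_comp_of_contDiff ((hV j i).contDiff_pderivIter (ζ := []) (by simp)) hβ0
      (P := fun u => z + expansion V x G a u z)
      fun l => (IsHolder.const (z l)).add (hP l)).isIntegrand hβ
  -- the pointwise decomposition of the integrand
  have hpt : ∀ j, ∀ t ∈ Set.Icc a b, V j (z + expansion V x G a t z) i =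
      taylorSum V x a z M (fun y => V j y i) t
      + ((∑ ζ : Fin (M + 1) → Fin d, iterInt (expansionPath V x (words m (M + 1)) a z) a t
          (List.ofFn ζ) * pderivIter (List.ofFn ζ) (fun y => V j y i) z)
        + ∑ p ∈ Finset.Icc 1 M, ∑ ζ : Fin p → Fin d, Qterm V x M (M + 1) ζ a t z
          * pderivIter (List.ofFn ζ) (fun y => V j y i) z)
      + (∑ ζ : Fin (M + 1 + 1) → Fin d, multInt (expansionPath V x G a z) a
          (fun v => pderivIter (List.ofFn ζ) (fun y => V j y i) (z + expansion V x G a v z))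
          (List.ofFn ζ) t)
      + ∑ p ∈ Finset.Icc 1 (M + 1), ∑ ζ : Fin p → Fin d,
          (iterInt (expansionPath V x G a z) a t (List.ofFn ζ)
          - iterInt (expansionPath V x (words m (M + 1)) a z) a t (List.ofFn ζ))
          * pderivIter (List.ofFn ζ) (fun y => V j y i) z := by
    intro j t ht
    have h1 := (hV j i).taylor (z := z) hβ hβ1 hP hPa t ht
    have h2 := sum_pderivIter_mul_iterInt_expansion (V := V) (z := z) hβ hβ1 hx
      (Nat.lt_succ_self M) hVC (contDiff_pi.1 (hVC j) i) t ht
    have h3 := add_sum_Icc_one (fun p => ∑ ζ : Fin p → Fin d, Qterm V x M (M + 1) ζ a t z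
          * pderivIter (List.ofFn ζ) (fun y => V j y i) z) M
    have h4 := add_sum_Icc_one (fun p => ∑ ζ : Fin p → Fin d,
          (iterInt (expansionPath V x G a z) a t (List.ofFn ζ)
          - iterInt (expansionPath V x (words m (M + 1)) a z) a t (List.ofFn ζ))
          * pderivIter (List.ofFn ζ) (fun y => V j y i) z) (M + 1)
    simp only [Qterm_zero, zero_mul, Finset.sum_const_zero, zero_add] at h3
    have h40 : ∑ ζ : Fin 0 → Fin d, (iterInt (expansionPath V x G a z) a t (List.ofFn ζ)
          - iterInt (expansionPath V x (words m (M + 1)) a z) a t (List.ofFn ζ))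
          * pderivIter (List.ofFn ζ) (fun y => V j y i) z = 0 := by
      simp [iterInt, multInt]
    rw [h40, zero_add] at h4
    rw [h3, h4, ← h2]
    refine Eq.trans h1 ?_
    simp only [Finset.sum_range_succ _ (M + 1), sub_mul, Finset.sum_sub_distrib,
      mul_comm (pderivIter _ _ _)]
    have h5 : ∀ v, (fun l => expansionPath V x G a z l v) = expansion V x G a v z := fun v => rfl
    simp only [h5]
    ring
  have hF := ((((HasDifferential.sum (Finset.range (M + 1)) fun r _ =>
      hasDifferential_taylorTerm_succ (V := V) (z := z) hβ hβ1 hx r fun y => y i).add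
    (hasDifferential_R1 (V := V) (z := z) (N := M + 1) hβ hβ1 hx i).1).add
    (hasDifferential_R2 (G := G) (z := z) hβ hβ1 hx hV i).1).add
    (hasDifferential_R3 (V := V) (z := z) (G := G) (N := M + 1) hβ hβ1 hx i).1)
  have hL := HasDifferential.sum (Finset.univ : Finset (Fin m)) fun j _ =>
    (hint j).hasDifferential_rsInt hβ0 (hx j)
  intro t ht
  have h := hL.sub_eq_sub (hF.congr fun c ξ e h1 h2 h3 h4 => ?_) ht
  · have e1 : ∀ t, ∑ r ∈ Finset.range (M + 1), taylorTerm V x a z (r + 1) (fun y => y i) t =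
        expansion V x (words m (M + 1)) a t z i := fun t => (expansionPath_words (M + 1) i t).symm
    have e2 := fun e : Fin 4 => congrFun (remainder_self (V := V) (x := x) (N := M + 1) hG e a z) i
    have e3 : R1 V x (M + 1) a a z i = 0 := e2 0
    have e4 : R2 V x (M + 1) G a a z i = 0 := e2 1
    have e5 : R3 V x (M + 1) G a a z i = 0 := e2 2
    have e6 : expansion V x (words m (M + 1)) a a z i = 0 :=
      congrFun (expansion_self (nil_notMem_words m (M + 1)) a z) i
    simp only [rsInt_self, Finset.sum_const_zero, sub_zero, e1, e3, e4, e5, e6, add_zero] at h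
    rw [h, Fin.sum_univ_four]
    simp only [remainder, Matrix.cons_val_zero, Matrix.cons_val_one, Matrix.cons_val, R4,
      Pi.sub_apply]
    ring
  · have hξ : ξ ∈ Set.Icc a b := ⟨h1.trans h2, h3.trans h4⟩
    simp only [hpt _ ξ hξ, add_mul, Finset.sum_add_distrib, Finset.sum_mul, vf_coord, taylorSum]
    have c1 : ∀ (p : ℕ) (F : (Fin p → Fin d) → Fin m → ℝ), ∑ ζ, ∑ j, F ζ j = ∑ j, ∑ ζ, F ζ j :=
      fun p F => Finset.sum_comm
    have c2 : ∀ (s : Finset ℕ) (F : ℕ → Fin m → ℝ), ∑ p ∈ s, ∑ j, F p j = ∑ j, ∑ p ∈ s, F p j :=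
      fun s F => Finset.sum_comm
    simp only [c1, c2, Nat.add_sub_cancel]

end OneStep

/-! ### Gluing the steps -/

section Grid

variable {T : ℝ} {n : ℕ}

theorem grid_zero : grid T n 0 = 0 := by simp [grid]

theorem grid_self (hn : 0 < n) : grid T n n = T := by
  have : (n : ℝ) ≠ 0 := by positivity
  rw [grid]; field_simp

theorem grid_mono (hT : 0 < T) {k l : ℕ} (h : k ≤ l) : grid T n k ≤ grid T n l := by
  unfold grid
  gcongr

theorem grid_le (hT : 0 < T) (hn : 0 < n) {k : ℕ} (h : k ≤ n) : grid T n k ≤ T := by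
  have := grid_mono (T := T) (n := n) hT h
  rwa [grid_self hn] at this

theorem grid_nonneg (hT : 0 < T) (k : ℕ) : 0 ≤ grid T n k := by
  have := grid_mono (T := T) (n := n) hT (Nat.zero_le k)
  rwa [grid_zero] at this

theorem le_floor_iff_grid_le (hT : 0 < T) (hn : 0 < n) {t : ℝ} (ht : 0 ≤ t) {k : ℕ} :
    k ≤ ⌊(n : ℝ) * t / T⌋₊ ↔ grid T n k ≤ t := by
  have hn' : (0 : ℝ) < n := by exact_mod_cast hn
  rw [Nat.le_floor_iff (by positivity), grid, le_div_iff₀ hT, div_le_iff₀ hn', mul_comm t]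

theorem exists_mem_grid (hT : 0 < T) (hn : 0 < n) {t : ℝ} (ht : t ∈ Set.Icc 0 T) :
    ∃ k < n, t ∈ Set.Icc (grid T n k) (grid T n (k + 1)) := by
  by_cases h : ⌊(n : ℝ) * t / T⌋₊ < n
  · refine ⟨_, h, (le_floor_iff_grid_le hT hn ht.1).1 le_rfl, ?_⟩
    by_contra hcon
    have := (le_floor_iff_grid_le hT hn ht.1).2 (not_le.1 hcon).le
    omega
  · have h1 := (le_floor_iff_grid_le hT hn ht.1).1 (not_lt.1 h)
    rw [grid_self hn] at h1
    refine ⟨n - 1, by omega, (grid_le hT hn (Nat.sub_le n 1)).trans h1, ?_⟩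
    rw [Nat.sub_add_cancel hn, grid_self hn]
    exact ht.2

theorem IsHolder.of_grid {β : ℝ} (hβ : 0 < β) (hn : 0 < n) {f : ℝ → ℝ}
    (h : ∀ k < n, IsHolder β (grid T n k) (grid T n (k + 1)) f) : IsHolder β 0 T f := by
  have key : ∀ k ≤ n, IsHolder β 0 (grid T n k) f := by
    intro k
    induction k with
    | zero =>
      intro _
      refine ⟨0, le_rfl, fun s t h1 h2 h3 => ?_⟩
      rw [grid_zero] at h3
      rw [show s = t by linarith]
      simp
    | succ k ih => exact fun hk => (ih (by omega)).union hβ (h k (by omega))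
  have := key n le_rfl
  rwa [grid_self hn] at this

variable {d : ℕ} {R : ℝ → ℝ → (Fin d → ℝ) → Fin d → ℝ} {z : ℝ → Fin d → ℝ}

/-- At a grid point the sum that defines the accumulated remainder has an additional term, which
vanishes. -/
theorem accumulated_eq (hR : ∀ s y, R s s y = 0) (hT : 0 < T) (hn : 0 < n) {k : ℕ} {s : ℝ}
    (hs : s ∈ Set.Icc (grid T n k) (grid T n (k + 1))) :
    accumulated R T n z s = ∑ l ∈ Finset.range k, R (grid T n l) (grid T n (l + 1)) (z (grid T n l))
      + R (grid T n k) s (z (grid T n k)) := by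
  have hs0 : 0 ≤ s := (grid_nonneg hT k).trans hs.1
  have hlt : ∀ l, l ≤ k → grid T n l ≤ s := fun l hl => (grid_mono hT hl).trans hs.1
  have hfull : ∀ l ∈ Finset.range k, R (grid T n l) (min (grid T n (l + 1)) s) (z (grid T n l)) =
      R (grid T n l) (grid T n (l + 1)) (z (grid T n l)) := fun l hl => by
    rw [min_eq_left (hlt _ (Finset.mem_range.1 hl))]
  have hk : k ≤ ⌊(n : ℝ) * s / T⌋₊ := (le_floor_iff_grid_le hT hn hs0).2 hs.1
  unfold accumulated
  rcases hs.2.eq_or_lt with h | h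
  · have hfl : ⌊(n : ℝ) * s / T⌋₊ = k + 1 := by
      refine le_antisymm ?_ ((le_floor_iff_grid_le hT hn hs0).2 h.ge)
      by_contra hcon
      have h1 := (le_floor_iff_grid_le hT hn hs0 (k := k + 2)).1 (by omega)
      have h2 : grid T n (k + 1) < grid T n (k + 2) := by
        unfold grid
        have hn' : (0 : ℝ) < n := by exact_mod_cast hn
        gcongr
        norm_num
      linarith
    rw [hfl, Finset.sum_range_succ, Finset.sum_range_succ, Finset.sum_congr rfl hfull,
      min_eq_right hs.2, min_eq_right (h.le.trans (grid_mono hT (Nat.le_succ _))), ← h, hR,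
      add_zero]
  · have hfl : ⌊(n : ℝ) * s / T⌋₊ = k := by
      refine le_antisymm ?_ hk
      by_contra hcon
      have h1 := (le_floor_iff_grid_le hT hn hs0 (k := k + 1)).1 (by omega)
      linarith
    rw [hfl, Finset.sum_range_succ, Finset.sum_congr rfl hfull, min_eq_right hs.2]

theorem accumulated_zero (hR : ∀ s y, R s s y = 0) (hT : 0 < T) (hn : 0 < n) :
    accumulated R T n z 0 = 0 := by
  have := accumulated_eq (z := z) hR hT hn (k := 0) (s := 0)
    ⟨grid_zero.le, grid_nonneg hT 1⟩
  rw [this, Finset.sum_range_zero, zero_add, grid_zero, hR]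

theorem accumulated_sub (hR : ∀ s y, R s s y = 0) (hT : 0 < T) (hn : 0 < n) {k : ℕ} {s u : ℝ}
    (hs : s ∈ Set.Icc (grid T n k) (grid T n (k + 1)))
    (hu : u ∈ Set.Icc (grid T n k) (grid T n (k + 1))) :
    accumulated R T n z u - accumulated R T n z s =
      R (grid T n k) u (z (grid T n k)) - R (grid T n k) s (z (grid T n k)) := by
  rw [accumulated_eq hR hT hn hs, accumulated_eq hR hT hn hu]
  abel

theorem isHolder_accumulated {β : ℝ} (hβ : 0 < β) (hR : ∀ s y, R s s y = 0) (hT : 0 < T)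
    (hn : 0 < n) (l : Fin d) (hRH : ∀ k < n, IsHolder β (grid T n k) (grid T n (k + 1))
      fun s => R (grid T n k) s (z (grid T n k)) l) :
    IsHolder β 0 T fun s => accumulated R T n z s l := by
  refine IsHolder.of_grid hβ hn fun k hk => ?_
  refine ((IsHolder.const ((∑ l ∈ Finset.range k,
    R (grid T n l) (grid T n (l + 1)) (z (grid T n l))) l)).add (hRH k hk)).congr fun s hs => ?_
  rw [accumulated_eq hR hT hn hs, Pi.add_apply]

/-- The integral against the accumulated remainder is the sum of the integrals over the steps. -/
theorem sum_rsInt_grid_eq {β : ℝ} (hβ : 1 / 2 < β) (hR : ∀ s y, R s s y = 0) (hT : 0 < T)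
    (hn : 0 < n) (l : Fin d) (hRH : ∀ k < n, IsHolder β (grid T n k) (grid T n (k + 1))
      fun s => R (grid T n k) s (z (grid T n k)) l) {f : ℝ → ℝ} (hf : IsHolder β 0 T f) {t : ℝ}
    (ht : t ∈ Set.Icc 0 T) :
    (∀ k ∈ Finset.range (⌊(n : ℝ) * t / T⌋₊ + 1), RSIntegrable f
      (fun s => R (grid T n k) s (z (grid T n k)) l) (grid T n k) (min (grid T n (k + 1)) t)) ∧
    ∑ k ∈ Finset.range (⌊(n : ℝ) * t / T⌋₊ + 1), rsInt f
      (fun s => R (grid T n k) s (z (grid T n k)) l) (grid T n k) (min (grid T n (k + 1)) t) =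
      rsInt f (fun s => accumulated R T n z s l) 0 t := by
  have hβ0 : 0 < β := by linarith
  have hacc := isHolder_accumulated hβ0 hR hT hn l hRH
  have hF := (hf.isIntegrand hβ).hasDifferential_rsInt hβ0 hacc
  have hterm : ∀ k ∈ Finset.range (⌊(n : ℝ) * t / T⌋₊ + 1), HasRSIntegral f
      (fun s => R (grid T n k) s (z (grid T n k)) l) (grid T n k) (min (grid T n (k + 1)) t)
      (rsInt f (fun s => accumulated R T n z s l) 0 (min (grid T n (k + 1)) t)
        - rsInt f (fun s => accumulated R T n z s l) 0 (grid T n k)) := by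
    intro k hk
    have hkt : grid T n k ≤ t := (le_floor_iff_grid_le hT hn ht.1).1
      (Nat.lt_succ_iff.1 (Finset.mem_range.1 hk))
    have hmin : grid T n k ≤ min (grid T n (k + 1)) t := le_min (grid_mono hT (Nat.le_succ k)) hkt
    by_cases hkn : k < n
    · refine HasDifferential.hasRSIntegral (a := grid T n k) (b := min (grid T n (k + 1)) t)
        (F := fun t => rsInt f (fun s => accumulated R T n z s l) 0 t) ?_ le_rfl hmin le_rfl
      refine (hF.mono (grid_nonneg hT k) ((min_le_right _ _).trans ht.2)).congr
        fun c ξ e h1 h2 h3 h4 => ?_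
      have h5 := h4.trans (min_le_left _ _)
      have := congrFun (accumulated_sub (z := z) hR hT hn (k := k) (s := c) (u := e)
        ⟨h1, h2.trans (h3.trans h5)⟩ ⟨h1.trans (h2.trans h3), h5⟩) l
      simp only [Pi.sub_apply] at this
      rw [this]
    · have h1 : grid T n k = t := le_antisymm hkt (by
        have := grid_mono (T := T) (n := n) hT (not_lt.1 hkn)
        rw [grid_self hn] at this
        exact ht.2.trans this)
      have h2 : min (grid T n (k + 1)) t = t := min_eq_right (h1 ▸ grid_mono hT (Nat.le_succ k))
      rw [h2, h1, sub_self]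
      exact hasRSIntegral_self _ _ _
  refine ⟨fun k hk => ⟨_, hterm k hk⟩, ?_⟩
  rw [Finset.sum_congr rfl fun k hk => (hterm k hk).rsInt_eq, Finset.sum_range_succ]
  have hlast : t ≤ grid T n (⌊(n : ℝ) * t / T⌋₊ + 1) := by
    by_contra hcon
    have := (le_floor_iff_grid_le hT hn ht.1).2 (not_le.1 hcon).le
    omega
  have hmid : ∀ k ∈ Finset.range ⌊(n : ℝ) * t / T⌋₊,
      rsInt f (fun s => accumulated R T n z s l) 0 (min (grid T n (k + 1)) t)
        - rsInt f (fun s => accumulated R T n z s l) 0 (grid T n k) =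
      rsInt f (fun s => accumulated R T n z s l) 0 (grid T n (k + 1))
        - rsInt f (fun s => accumulated R T n z s l) 0 (grid T n k) := fun k hk => by
    rw [min_eq_left ((le_floor_iff_grid_le hT hn ht.1).1 (Finset.mem_range.1 hk))]
  rw [Finset.sum_congr rfl hmid, Finset.sum_range_sub
    (fun k => rsInt f (fun s => accumulated R T n z s l) 0 (grid T n k)), min_eq_right hlast,
    grid_zero, rsInt_self]
  ring

end Grid

/-! ### The linear equations and the error -/

section Linear

variable {d m : ℕ} {T β : ℝ} {x : Fin m → ℝ → ℝ} {A : Fin m → ℝ → Matrix (Fin d) (Fin d) ℝ}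
  {Φ Ψ : ℝ → Matrix (Fin d) (Fin d) ℝ}

theorem isHolder_mul_apply {A B : ℝ → Matrix (Fin d) (Fin d) ℝ} (hβ : 0 < β)
    (hA : ∀ i l, IsHolder β 0 T fun t => A t i l) (hB : ∀ i l, IsHolder β 0 T fun t => B t i l)
    (i l : Fin d) : IsHolder β 0 T fun t => (A t * B t) i l := by
  simp only [Matrix.mul_apply]
  exact IsHolder.sum _ fun p _ => (hA i p).mul hβ (hB p l)

theorem hasDifferential_of_eq_add_sum_rsInt (hβ : 1 / 2 < β) (hx : ∀ j, IsHolder β 0 T (x j))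
    {F : ℝ → ℝ} {k : ℝ} {f : Fin m → ℝ → ℝ} (hf : ∀ j, IsHolder β 0 T (f j))
    (hF : ∀ t ∈ Set.Icc 0 T, F t = k + ∑ j, rsInt (f j) (x j) 0 t) :
    HasDifferential 0 T F fun c ξ e => ∑ j, f j ξ * (x j e - x j c) :=
  (((HasDifferential.const k).add (HasDifferential.sum Finset.univ fun j _ =>
    ((hf j).isIntegrand hβ).hasDifferential_rsInt (by linarith) (hx j))).congr_fun
      fun t ht => (hF t ht).symm).congr fun c ξ e _ _ _ _ => zero_add _

/-- The solution operators of a linear equation and of its adjoint are inverse to each other. -/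
theorem inverse_mul_fundamental (hβ : 1 / 2 < β)
    (hΦH : ∀ i l, IsHolder β 0 T fun t => Φ t i l) (hΨH : ∀ i l, IsHolder β 0 T fun t => Ψ t i l)
    (hΦ0 : Φ 0 = 1) (hΨ0 : Ψ 0 = 1)
    (hΦ : ∀ i l, HasDifferential 0 T (fun t => Φ t i l) fun c ξ e =>
      ∑ j, (A j ξ * Φ ξ) i l * (x j e - x j c))
    (hΨ : ∀ i l, HasDifferential 0 T (fun t => Ψ t i l) fun c ξ e =>
      -∑ j, (Ψ ξ * A j ξ) i l * (x j e - x j c)) {t : ℝ} (ht : t ∈ Set.Icc 0 T) :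
    Ψ t * Φ t = 1 := by
  ext i l
  have h := HasDifferential.sum (Finset.univ : Finset (Fin d)) fun p _ =>
    (hΨ i p).mul hβ (hΦ p l) (hΨH i p) (hΦH p l)
  have h0 : HasDifferential 0 T (fun t => (Ψ t * Φ t) i l) fun _ _ _ => 0 := by
    refine (h.congr_fun fun t _ => (Matrix.mul_apply ..).symm).congr fun c ξ e _ _ _ _ => ?_
    have key : ∀ j, ∑ p, Ψ ξ i p * (A j ξ * Φ ξ) p l =
        ∑ p, (Ψ ξ * A j ξ) i p * Φ ξ p l := fun j => by
      rw [← Matrix.mul_apply, ← Matrix.mul_apply, Matrix.mul_assoc]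
    calc ∑ p, (Ψ ξ i p * ∑ j, (A j ξ * Φ ξ) p l * (x j e - x j c)
          + Φ ξ p l * -∑ j, (Ψ ξ * A j ξ) i p * (x j e - x j c))
        = ∑ j, (∑ p, Ψ ξ i p * (A j ξ * Φ ξ) p l - ∑ p, (Ψ ξ * A j ξ) i p * Φ ξ p l)
            * (x j e - x j c) := by
          simp only [mul_neg, Finset.mul_sum, Finset.sum_add_distrib, Finset.sum_neg_distrib,
            sub_mul, Finset.sum_mul, Finset.sum_sub_distrib]
          rw [Finset.sum_comm, sub_eq_add_neg]
          congr 1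
          · exact Finset.sum_congr rfl fun j _ => Finset.sum_congr rfl fun p _ => by ring
          · rw [Finset.sum_comm]
            exact congrArg Neg.neg (Finset.sum_congr rfl fun j _ =>
              Finset.sum_congr rfl fun p _ => by ring)
      _ = 0 := by simp [key]
  have := h0.sub_eq_sub (HasDifferential.const 0) ht
  rw [hΦ0, hΨ0, Matrix.mul_one] at this
  linarith

/-- Variation of constants. -/
theorem inverse_mulVec_eq_sum_matRSInt (hβ : 1 / 2 < β)
    {ι : Type*} [Fintype ι] {r : ι → ℝ → Fin d → ℝ}
    (hr : ∀ e l, IsHolder β 0 T fun t => r e t l) {D : ℝ → Fin d → ℝ}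
    (hDH : ∀ l, IsHolder β 0 T fun t => D t l) (hD0 : D 0 = 0)
    (hD : ∀ i, HasDifferential 0 T (fun t => D t i) fun c ξ e =>
      ∑ j, (A j ξ *ᵥ D ξ) i * (x j e - x j c) + ∑ q, (r q e i - r q c i))
    (hΨH : ∀ i l, IsHolder β 0 T fun t => Ψ t i l)
    (hΨ : ∀ i l, HasDifferential 0 T (fun t => Ψ t i l) fun c ξ e =>
      -∑ j, (Ψ ξ * A j ξ) i l * (x j e - x j c)) {t : ℝ} (ht : t ∈ Set.Icc 0 T) :
    Ψ t *ᵥ D t = ∑ q, matRSInt Ψ (r q) 0 t := by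
  have hβ0 : 0 < β := by linarith
  funext i
  have h := HasDifferential.sum (Finset.univ : Finset (Fin d)) fun p _ =>
    (hΨ i p).mul hβ (hD p) (hΨH i p) (hDH p)
  have h0 : HasDifferential 0 T (fun t => (Ψ t *ᵥ D t) i) fun c ξ e =>
      ∑ q, ∑ p, Ψ ξ i p * (r q e p - r q c p) := by
    refine (h.congr_fun fun t _ => rfl).congr fun c ξ e _ _ _ _ => ?_
    have key : ∀ j, ∑ p, Ψ ξ i p * (A j ξ *ᵥ D ξ) p = ∑ p, (Ψ ξ * A j ξ) i p * D ξ p := fun j =>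
      congrFun (Matrix.mulVec_mulVec (D ξ) (Ψ ξ) (A j ξ)) i
    have f1 : ∑ p, Ψ ξ i p * ∑ j, (A j ξ *ᵥ D ξ) p * (x j e - x j c) =
        ∑ j, (∑ p, Ψ ξ i p * (A j ξ *ᵥ D ξ) p) * (x j e - x j c) := by
      simp only [Finset.mul_sum, Finset.sum_mul]
      rw [Finset.sum_comm]
      exact Finset.sum_congr rfl fun j _ => Finset.sum_congr rfl fun p _ => by ring
    have f2 : ∑ p, D ξ p * ∑ j, (Ψ ξ * A j ξ) i p * (x j e - x j c) =
        ∑ j, (∑ p, (Ψ ξ * A j ξ) i p * D ξ p) * (x j e - x j c) := by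
      simp only [Finset.mul_sum, Finset.sum_mul]
      rw [Finset.sum_comm]
      exact Finset.sum_congr rfl fun j _ => Finset.sum_congr rfl fun p _ => by ring
    have f3 : ∑ p, Ψ ξ i p * ∑ q, (r q e p - r q c p) =
        ∑ q, ∑ p, Ψ ξ i p * (r q e p - r q c p) := by
      simp only [Finset.mul_sum]
      rw [Finset.sum_comm]
    simp only [mul_add, mul_neg, Finset.sum_add_distrib, Finset.sum_neg_distrib]
    rw [f1, f2, f3]
    simp only [key]
    ring
  have h1 := HasDifferential.sum (Finset.univ : Finset ι) fun q _ =>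
    HasDifferential.sum (Finset.univ : Finset (Fin d)) fun p _ =>
      ((hΨH i p).isIntegrand hβ).hasDifferential_rsInt hβ0 (hr q p)
  have := h0.sub_eq_sub h1 ht
  simp only [hD0, Matrix.mulVec_zero, Pi.zero_apply, sub_zero, rsInt_self,
    Finset.sum_const_zero] at this
  rw [this, Finset.sum_apply]
  rfl

end Linear

theorem HolderPath.isHolder {β : ℝ≥0} {T : ℝ} {f : ℝ → ℝ} (hf : HolderPath β T f) :
    IsHolder β 0 T f := by
  obtain ⟨C, hC⟩ := hf
  refine ⟨C, C.2, fun s t h1 h2 h3 => ?_⟩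
  have := hC.dist_le (x := t) (y := s) ⟨h1.trans h2, h3⟩ ⟨h1, h2.trans h3⟩
  rwa [Real.dist_eq, Real.dist_eq, abs_of_nonneg (sub_nonneg.2 h2)] at this

theorem HolderPath.isHolder_apply {β : ℝ≥0} {T : ℝ} {d : ℕ} {f : ℝ → Fin d → ℝ}
    (hf : HolderPath β T f) (l : Fin d) : IsHolder β 0 T fun t => f t l := by
  obtain ⟨C, hC⟩ := hf
  refine ⟨C, C.2, fun s t h1 h2 h3 => ?_⟩
  have := hC.dist_le (x := t) (y := s) ⟨h1.trans h2, h3⟩ ⟨h1, h2.trans h3⟩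
  rw [Real.dist_eq, abs_of_nonneg (sub_nonneg.2 h2)] at this
  rw [← Real.dist_eq]
  exact (dist_le_pi_dist (f t) (f s) l).trans this

/-- For `β < 1` the bound `δ > 1 / β - 1` says that `δ * β + β > 1`; for `β = 1` continuity of the
derivatives is enough. -/
theorem hasRegularDerivatives {d : ℕ} {β : ℝ≥0} (hβ : 0 < β) (hβ1 : β ≤ 1) {N : ℕ}
    {f : (Fin d → ℝ) → ℝ} (hf : ContDiff ℝ ((N + 1 : ℕ) : WithTop ℕ∞) f)
    (hH : β = 1 ∨ ∃ δ : ℝ≥0, 1 / (β : ℝ) - 1 < δ ∧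
      ∀ (ζ : Fin (N + 1) → Fin d) (K : Set (Fin d → ℝ)), IsCompact K →
        ∃ C : ℝ≥0, HolderOnWith C δ (pderivIter (List.ofFn ζ) f) K) :
    HasRegularDerivatives β N f := by
  have hβ0 : (0 : ℝ) < β := by exact_mod_cast hβ
  refine ⟨hf, fun ζ hζ => ?_⟩
  have hcont : Continuous (pderivIter ζ f) :=
    (ContDiff.pderivIter (k := 0) ζ (by rwa [zero_add, hζ])).continuous
  by_cases hβ2 : (β : ℝ) = 1
  · exact Or.inr ⟨hβ2, hcont⟩
  obtain ⟨δ, hδ, H⟩ := hH.resolve_left fun h => hβ2 (by rw [h]; rfl)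
  have hβ3 : (β : ℝ) < 1 := lt_of_le_of_ne (by exact_mod_cast hβ1) hβ2
  rw [sub_lt_iff_lt_add, div_lt_iff₀ hβ0] at hδ
  have hδ0 : (0 : ℝ) < δ := lt_of_le_of_ne δ.2 fun h => by
    have h' : (δ : ℝ) = 0 := h.symm
    rw [h', zero_add, one_mul] at hδ
    linarith
  refine Or.inl ⟨δ, hδ0, by linarith, fun K hK => ?_⟩
  obtain ⟨C, hC⟩ := H (fun i => ζ.get (i.cast hζ.symm)) K hK
  have e : (List.ofFn fun i : Fin (N + 1) => ζ.get (i.cast hζ.symm)) = ζ :=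
    List.ext_get (by simp [hζ]) fun k h h' => by simp [-List.ofFn_succ]
  rw [e] at hC
  refine ⟨C, C.2, fun p hp q hq => ?_⟩
  have := hC.dist_le hp hq
  rwa [Real.dist_eq, dist_eq_norm] at this

/-! ### The scheme as a solution of a perturbed equation -/

section Scheme

variable {d m : ℕ} {β : ℝ≥0} {T : ℝ} {n N : ℕ} {x : Fin m → ℝ → ℝ} {G : Finset (List (Fin m))}
  {V : Fin m → (Fin d → ℝ) → (Fin d → ℝ)} {y0 : Fin d → ℝ} {yn : ℝ → Fin d → ℝ}

theorem IsTaylorScheme.eq_add_expansion (hyn : IsTaylorScheme V x G T n y0 yn) {k : ℕ}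
    (hk : k < n) {t : ℝ} (ht : t ∈ Set.Icc (grid T n k) (grid T n (k + 1))) :
    yn t = yn (grid T n k) + expansion V x G (grid T n k) t (yn (grid T n k)) := by
  refine hyn.2 k hk t ⟨ht.1, ht.2.trans (le_of_eq ?_)⟩
  simp [grid]

theorem isHolder_grid (hT : 0 < T) (hn : 0 < n) {f : ℝ → ℝ} {β : ℝ} (hf : IsHolder β 0 T f)
    {k : ℕ} (hk : k < n) : IsHolder β (grid T n k) (grid T n (k + 1)) f :=
  hf.mono (grid_nonneg hT k) (grid_le hT hn hk)

theorem IsTaylorScheme.isHolder (hyn : IsTaylorScheme V x G T n y0 yn) (hβ : (1 / 2 : ℝ) < β)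
    (hβ1 : (β : ℝ) ≤ 1) (hT : 0 < T) (hn : 0 < n) (hx : ∀ j, IsHolder β 0 T (x j)) (l : Fin d) :
    IsHolder β 0 T fun t => yn t l := by
  refine IsHolder.of_grid (by linarith) hn fun k hk => ?_
  refine ((IsHolder.const (yn (grid T n k) l)).add (isHolder_expansionPath (V := V)
    (z := yn (grid T n k)) hβ hβ1 (fun j => isHolder_grid hT hn (hx j) hk) G l)).congr
      fun t ht => ?_
  rw [hyn.eq_add_expansion hk ht]
  rfl

/-- The scheme solves the equation up to the accumulated remainders. -/
theorem IsTaylorScheme.eq_add_sum_rsInt_sub (hyn : IsTaylorScheme V x G T n y0 yn)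
    (hβ : (1 / 2 : ℝ) < β) (hβ1 : (β : ℝ) ≤ 1) (hT : 0 < T) (hn : 0 < n)
    (hx : ∀ j, IsHolder β 0 T (x j)) (hG : [] ∉ G) (hN : 1 ≤ N)
    (hV : ∀ j i, HasRegularDerivatives β N fun y => V j y i) (i : Fin d) :
    ∀ t ∈ Set.Icc 0 T, yn t i = y0 i + ∑ j, rsInt (fun s => V j (yn s) i) (x j) 0 t
      - ∑ e, accumulated (remainder V x N G e) T n yn t i := by
  have hβ0 : (0 : ℝ) < β := by linarith
  have hR : ∀ e s y, remainder V x N G e s s y = 0 := fun e s y => remainder_self hG e s y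
  have hynH := hyn.isHolder hβ hβ1 hT hn hx
  have hint : ∀ j, IsIntegrand β 0 T fun s => V j (yn s) i := fun j =>
    (isHolder_comp_of_contDiff ((hV j i).contDiff_pderivIter (ζ := []) (by simp)) hβ0
      hynH).isIntegrand hβ
  -- the increments of both sides agree on every step
  have hstep : ∀ k < n, ∀ t ∈ Set.Icc (grid T n k) (grid T n (k + 1)),
      yn t i - ∑ j, rsInt (fun s => V j (yn s) i) (x j) 0 t
        + ∑ e, accumulated (remainder V x N G e) T n yn t i =
      yn (grid T n k) i - ∑ j, rsInt (fun s => V j (yn s) i) (x j) 0 (grid T n k)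
        + ∑ e, accumulated (remainder V x N G e) T n yn (grid T n k) i := by
    intro k hk t ht
    have hxk := fun j => isHolder_grid hT hn (hx j) hk
    have hk0 : grid T n k ∈ Set.Icc (grid T n k) (grid T n (k + 1)) :=
      ⟨le_rfl, grid_mono hT (Nat.le_succ k)⟩
    have h1 := sum_rsInt_scheme_eq (z := yn (grid T n k)) hβ hβ1 hxk hG hN hV i t ht
    have h2 : ∀ j, rsInt (fun u => V j (yn (grid T n k)
        + expansion V x G (grid T n k) u (yn (grid T n k))) i) (x j) (grid T n k) t =
        rsInt (fun s => V j (yn s) i) (x j) 0 t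
          - rsInt (fun s => V j (yn s) i) (x j) 0 (grid T n k) := by
      intro j
      have hd := ((hint j).hasDifferential_rsInt hβ0 (hx j)).mono
        (grid_nonneg (n := n) hT k) (grid_le hT hn (k := k + 1) hk)
      refine HasDifferential.rsInt_eq (hd.congr fun c ξ e g1 g2 g3 g4 => ?_) le_rfl ht.1 ht.2
      rw [hyn.eq_add_expansion hk ⟨g1.trans g2, g3.trans g4⟩]
    have h3 : ∀ e, remainder V x N G e (grid T n k) t (yn (grid T n k)) i =
        accumulated (remainder V x N G e) T n yn t i
          - accumulated (remainder V x N G e) T n yn (grid T n k) i := fun e => by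
      rw [← Pi.sub_apply, accumulated_sub (hR e) hT hn hk0 ht, hR e, sub_zero]
    have h4 := congrFun (hyn.eq_add_expansion hk ht) i
    rw [Pi.add_apply] at h4
    simp only [h2, h3, Finset.sum_sub_distrib] at h1
    linarith
  have hgrid : ∀ k ≤ n,
      yn (grid T n k) i - ∑ j, rsInt (fun s => V j (yn s) i) (x j) 0 (grid T n k)
        + ∑ e, accumulated (remainder V x N G e) T n yn (grid T n k) i = y0 i := by
    intro k
    induction k with
    | zero =>
      intro _
      simp [grid_zero, rsInt_self, fun e => accumulated_zero (z := yn) (hR e) hT hn, hyn.1]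
    | succ k ih =>
      intro hk
      rw [hstep k (by omega) _ ⟨grid_mono hT (Nat.le_succ k), le_rfl⟩]
      exact ih (by omega)
  intro t ht
  obtain ⟨k, hk, htk⟩ := exists_mem_grid hT hn ht
  have h1 := hstep k hk t htk
  have h2 := hgrid k hk.le
  linarith

end Scheme

end TaylorScheme

open TaylorScheme in
theorem theorem3 {d m : ℕ} (β : ℝ≥0) (hβ : 1 / 2 < β) (hβ1 : β ≤ 1)
    (T : ℝ) (hT : 0 < T) (n : ℕ) (hn : 0 < n)
    (x : Fin m → ℝ → ℝ) (hx : ∀ j, TaylorScheme.HolderPath β T (x j))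
    (G : Finset (List (Fin m))) (hG : [] ∉ G)
    (N : ℕ) (hN : IsGreatest (List.length '' (G : Set (List (Fin m)))) N)
    (V : Fin m → (Fin d → ℝ) → (Fin d → ℝ))
    (hV : ∀ j, ContDiff ℝ ((N + 1 : ℕ) : WithTop ℕ∞) (V j))
    (hVH : β = 1 ∨ ∃ δ : ℝ≥0, 1 / (β : ℝ) - 1 < δ ∧
      ∀ (j : Fin m) (i : Fin d) (ζ : Fin (N + 1) → Fin d) (K : Set (Fin d → ℝ)), IsCompact K →
        ∃ C : ℝ≥0, HolderOnWith C δ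
          (TaylorScheme.pderivIter (List.ofFn ζ) (fun z => V j z i)) K)
    (y yn : ℝ → Fin d → ℝ)
    (hy : TaylorScheme.IsSolution β V x T y)
    (hyn : TaylorScheme.IsTaylorScheme V x G T n (y 0) yn)
    (Φ Ψ : ℝ → Matrix (Fin d) (Fin d) ℝ)
    (hΦ : TaylorScheme.IsFundamental β (fun j s => TaylorScheme.Vdot V j (y s) (yn s)) x T Φ)
    (hΨ : TaylorScheme.IsInverseFundamental β
      (fun j s => TaylorScheme.Vdot V j (y s) (yn s)) x T Ψ)
    (t : ℝ) (ht : t ∈ Set.Icc 0 T) :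
    Ψ t * Φ t = 1 ∧
    (∀ e : Fin 4, ∀ k ∈ Finset.range (⌊(n : ℝ) * t / T⌋₊ + 1),
      TaylorScheme.MatRSIntegrable Ψ
        (fun s => TaylorScheme.remainder V x N G e (TaylorScheme.grid T n k) s
          (yn (TaylorScheme.grid T n k)))
        (TaylorScheme.grid T n k) (min (TaylorScheme.grid T n (k + 1)) t)) ∧
    (∀ e : Fin 4, TaylorScheme.MatRSIntegrable Ψ
      (TaylorScheme.accumulated (TaylorScheme.remainder V x N G e) T n yn) 0 t) ∧
    y t - yn t = ∑ e : Fin 4, Φ t *ᵥ ∑ k ∈ Finset.range (⌊(n : ℝ) * t / T⌋₊ + 1),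
      TaylorScheme.matRSInt Ψ
        (fun s => TaylorScheme.remainder V x N G e (TaylorScheme.grid T n k) s
          (yn (TaylorScheme.grid T n k)))
        (TaylorScheme.grid T n k) (min (TaylorScheme.grid T n (k + 1)) t) ∧
    y t - yn t = ∑ e : Fin 4, Φ t *ᵥ
      TaylorScheme.matRSInt Ψ
        (TaylorScheme.accumulated (TaylorScheme.remainder V x N G e) T n yn) 0 t := by
  have hβ' : (1 / 2 : ℝ) < β := by exact_mod_cast hβ
  have hβ1' : (β : ℝ) ≤ 1 := by exact_mod_cast hβ1
  have hβ0 : (0 : ℝ) < β := by linarith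
  have hN1 : 1 ≤ N := by
    obtain ⟨γ, hγ, rfl⟩ := hN.1
    exact List.length_pos_of_ne_nil fun h => hG (h ▸ hγ)
  have hxH := fun j => (hx j).isHolder
  have hyH := fun l => hy.1.isHolder_apply l
  have hynH := hyn.isHolder hβ' hβ1' hT hn hxH
  have hreg : ∀ j i, HasRegularDerivatives β N fun z => V j z i := fun j i =>
    hasRegularDerivatives (by exact_mod_cast hβ0) hβ1 (contDiff_pi.1 (hV j) i)
      (hVH.imp_right fun ⟨δ, hδ, h⟩ => ⟨δ, hδ, fun ζ K hK => h j i ζ K hK⟩)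
  have hC1 : ∀ j i, ContDiff ℝ 1 fun z => V j z i := fun j i =>
    (hreg j i).contDiff_pderivIter (ζ := []) (by simp)
  have hC1' : ∀ j i l, ContDiff ℝ 1 (pderiv l fun z => V j z i) := fun j i l =>
    (hreg j i).contDiff_pderivIter (ζ := [l]) (by simpa using hN1)
  have hR : ∀ e s z, remainder V x N G e s s z = 0 := fun e s z => remainder_self hG e s z
  have hRH : ∀ e l, ∀ k < n, IsHolder β (grid T n k) (grid T n (k + 1))
      fun s => remainder V x N G e (grid T n k) s (yn (grid T n k)) l := fun e l k hk =>
    isHolder_remainder hβ' hβ1' (fun j => isHolder_grid hT hn (hxH j) hk) hreg e l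
  have hacc : ∀ e l, IsHolder β 0 T fun s => accumulated (remainder V x N G e) T n yn s l :=
    fun e l => isHolder_accumulated hβ0 (hR e) hT hn l (hRH e l)
  -- the linear equations in differential form
  set A : Fin m → ℝ → Matrix (Fin d) (Fin d) ℝ := fun j s => Vdot V j (y s) (yn s) with hAdef
  have hAH : ∀ j i l, IsHolder β 0 T fun t => A j t i l := fun j i l =>
    isHolder_average (hC1' j i l) hβ0 hyH hynH
  have hΦH := fun i l => (hΦ.1 i l).isHolder
  have hΨH := fun i l => (hΨ.1 i l).isHolder
  have hΦd : ∀ i l, HasDifferential 0 T (fun t => Φ t i l) fun c ξ e =>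
      ∑ j, (A j ξ * Φ ξ) i l * (x j e - x j c) := fun i l =>
    hasDifferential_of_eq_add_sum_rsInt hβ' hxH
      (fun j => isHolder_mul_apply hβ0 (hAH j) hΦH i l) fun t ht => hΦ.2 t ht i l
  have hΨd : ∀ i l, HasDifferential 0 T (fun t => Ψ t i l) fun c ξ e =>
      -∑ j, (Ψ ξ * A j ξ) i l * (x j e - x j c) := fun i l =>
    ((((HasDifferential.const ((1 : Matrix (Fin d) (Fin d) ℝ) i l)).sub
      (HasDifferential.sum Finset.univ fun j _ =>
        ((isHolder_mul_apply hβ0 hΨH (hAH j) i l).isIntegrand hβ').hasDifferential_rsInt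
          hβ0 (hxH j))).congr_fun fun t ht => (hΨ.2 t ht i l).symm)).congr
      fun c ξ e _ _ _ _ => zero_sub _
  have h00 : (0 : ℝ) ∈ Set.Icc 0 T := ⟨le_rfl, hT.le⟩
  have hΦ0 : Φ 0 = 1 := by
    ext i l; rw [hΦ.2 0 h00 i l]; simp [rsInt_self]
  have hΨ0 : Ψ 0 = 1 := by
    ext i l; rw [hΨ.2 0 h00 i l]; simp [rsInt_self]
  have hinv : Ψ t * Φ t = 1 := inverse_mul_fundamental hβ' hΦH hΨH hΦ0 hΨ0 hΦd hΨd ht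
  -- the error solves the inhomogeneous linear equation
  have hDd : ∀ i, HasDifferential 0 T (fun t => (y t - yn t) i) fun c ξ e =>
      ∑ j, (A j ξ *ᵥ (y ξ - yn ξ)) i * (x j e - x j c)
        + ∑ q, (accumulated (remainder V x N G q) T n yn e i
          - accumulated (remainder V x N G q) T n yn c i) := by
    intro i
    have h1 := hasDifferential_of_eq_add_sum_rsInt hβ' hxH
      (fun j => isHolder_comp_of_contDiff (hC1 j i) hβ0 hyH) fun t ht => hy.2 t ht i
    have h2 := (((HasDifferential.const (y 0 i)).add (HasDifferential.sum Finset.univ fun j _ =>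
      ((isHolder_comp_of_contDiff (hC1 j i) hβ0 hynH).isIntegrand hβ').hasDifferential_rsInt
        hβ0 (hxH j))).sub (HasDifferential.sum (Finset.univ : Finset (Fin 4)) fun q _ =>
        HasDifferential.self fun t => accumulated (remainder V x N G q) T n yn t i)).congr_fun
      fun t ht =>
        (hyn.eq_add_sum_rsInt_sub hβ' hβ1' hT hn hxH hG hN1 hreg i t ht).symm
    refine (h1.sub h2).congr fun c ξ e _ _ _ _ => ?_
    have key : ∀ j, (A j ξ *ᵥ (y ξ - yn ξ)) i = V j (y ξ) i - V j (yn ξ) i := fun j =>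
      sum_average_pderiv_mul_sub (hC1 j i) (y ξ) (yn ξ)
    simp only [key, sub_mul, Finset.sum_sub_distrib]
    ring
  have hsolve : Ψ t *ᵥ (y t - yn t) =
      ∑ e, matRSInt Ψ (accumulated (remainder V x N G e) T n yn) 0 t :=
    inverse_mulVec_eq_sum_matRSInt (D := fun t => y t - yn t) hβ' hacc
      (fun l => (hyH l).sub hβ0 (hynH l)) (by simp [hyn.1]) hDd hΨH hΨd ht
  have hfinal : y t - yn t = ∑ e : Fin 4, Φ t *ᵥ
      matRSInt Ψ (accumulated (remainder V x N G e) T n yn) 0 t := by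
    rw [← Matrix.mulVec_sum, ← hsolve, Matrix.mulVec_mulVec, mul_eq_one_comm.1 hinv,
      Matrix.one_mulVec]
  have hsum := fun e i l => sum_rsInt_grid_eq hβ' (hR e) hT hn l (hRH e l) (hΨH i l) ht
  refine ⟨hinv, fun e k hk i l => (hsum e i l).1 k hk, fun e i l => ?_, ?_, hfinal⟩
  · exact IsIntegrand.rsIntegrable ht.1 hβ0
      (((hΨH i l).mono le_rfl ht.2).isIntegrand hβ') ((hacc e l).mono le_rfl ht.2)
  · rw [hfinal]
    refine Finset.sum_congr rfl fun e _ => congrArg _ ?_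
    funext i
    rw [Finset.sum_apply]
    simp only [matRSInt]
    rw [Finset.sum_comm]
    exact Finset.sum_congr rfl fun l _ => ((hsum e i l).2).symm
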